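/- **Setting.** A diagram of the ZX-calculus with $n$ inputs and $m$ outputs is built, by sequential and parallel composition, from wires (which may cross and bend), green and red nodes ("spiders") with any numbers $n,m\ge 0$ of inputs and outputs and a phase $\alpha\in\mathbb R/2\pi\mathbb Z$, yellow Hadamard nodes (one input, one output) and black star nodes (no inputs or outputs). Write $G^{n}_{m}(\alpha)$, $R^{n}_{m}(\alpha)$ for the green and red spiders with $n$ inputs and $m$ outputs, $H$ for the Hadamard node, $\star$ for the star, $\circ$ for sequential and juxtaposition or $\otimes$ for parallel composition, and $\sigma$ for the wire crossing. Let $\langle\alpha,\beta\rangle := R^1_0(\beta)\circ G^0_1(\alpha)$, a scalar diagram (no inputs or outputs), and $t:=\langle 0,0\rangle$. Two diagrams are *equal within the ZX-calculus* if this can be derived, by replacing parts of diagrams, from the topology rule (diagrams that are isomorphic as string diagrams, with inputs and outputs kept fixed, are equal, i.e. the laws of a compact closed category hold; the legs of a spider may be permuted, and inputs and outputs of spiders need not be distinguished) and the following rules, each of which may be used in both directions, with the colours green and red interchanged, and upside-down: 1. spider: two green spiders with phases $\alpha,\beta$ joined by a wire equal a single green spider with phase $\alpha+\beta$ having all the remaining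 legs; 2. loop: a wire joining a green spider to itself may be deleted; 3. cup: $G^0_2(0)$ equals a bent wire with two outputs; 4. bialgebra: $t\otimes\big[(R^2_1(0)\otimes R^2_1(0))\circ(1\otimes\sigma\otimes 1)\circ(G^1_2(0)\otimes G^1_2(0))\big]=G^1_2(0)\circ R^2_1(0)$; 5. copy: $t\otimes\big[G^1_2(0)\circ R^0_1(0)\big]=R^0_1(0)\otimes R^0_1(0)$; 6. $\pi$-copy: $G^1_m(0)\circ R^1_1(\pi)=R^1_1(\pi)^{\otimes m}\circ G^1_m(0)$; 7. $\pi$-commutation: $t\otimes\big[R^1_1(\pi)\circ G^1_1(\alpha)\big]=\langle\alpha,\pi\rangle\otimes\big[G^1_1(-\alpha)\circ R^1_1(\pi)\big]$; 8. colour change: $H^{\otimes m}\circ G^n_m(\alpha)\circ H^{\otimes n}=R^n_m(\alpha)$; 9. Euler decomposition: $t\otimes t\otimes H=\langle-\tfrac\pi2,-\tfrac\pi2\rangle\otimes\big[G^1_1(\tfrac\pi2)\circ R^1_1(\tfrac\pi2)\circ G^1_1(\tfrac\pi2)\big]$; 10. star: $\star\otimes G^0_0(0)$ equals the empty diagram;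 11. zero: $G^0_0(\pi)\otimes 1=G^0_0(\pi)\otimes\big[R^0_1(0)\circ G^1_0(0)\big]$, where $1$ is a single wire; 12. zero scalar: $G^0_0(\pi)\otimes G^0_0(\alpha)=G^0_0(\pi)$. A *stabilizer diagram* is a diagram in which all phases are integer multiples of $\pi/2$. A *state diagram* on $n\ge 1$ qubits is a diagram with no inputs and $n$ outputs. A *GS-LC diagram* on $n$ qubits consists of: * the graph state diagram of some simple graph with vertex set $\{1,\dots,n\}$, that is, for each vertex $v$ a green node with phase $0$ attached to the $v$-th of $n$ wires, and for each edge $\{u,v\}$ a Hadamard node connected to the green nodes of $u$ and $v$; * on each of these $n$ wires a single-qubit Clifford operator, that is, a finite vertical composite of Hadamard nodes and of green and red phase shifts $G^1_1(\alpha)$, $R^1_1(\alpha)$ with $\alpha\in\frac\pi2\mathbb Z$; the ends of the wires are the $n$ outputs; * an arbitrary stabilizer scalar diagram placed next to it. **Theorem.** Every stabilizer state diagram is equal, within the ZX-calculus, to some GS-LC diagram. -/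

import Mathlib

namespace ZX

/-- Diagrams of the ZX-calculus, read from the inputs to the outputs.  The input wires are labelled
by a finite type `A` and the output wires by a finite type `B`, so that `Diagram (Fin n) (Fin m)`
is the type of diagrams with `n` inputs and `m` outputs; `Empty` labels no wires and `Unit` a single
wire.  Phases are real numbers modulo `2π`. -/
inductive Diagram : Type → Type → Type 1
  /-- wires only, possibly crossing: input `a` is joined to output `e a` -/
  | wires {A B : Type} [Finite A] [Finite B] (e : A ≃ B) : Diagram A B
  /-- a bent wire with two outputs -/
  | cup : Diagram Empty (Unit ⊕ Unit)
  /-- a bent wire with two inputs -/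
  | cap : Diagram (Unit ⊕ Unit) Empty
  /-- a green spider with phase `α` -/
  | green (A B : Type) [Finite A] [Finite B] (α : Real.Angle) : Diagram A B
  /-- a red spider with phase `α` -/
  | red (A B : Type) [Finite A] [Finite B] (α : Real.Angle) : Diagram A B
  /-- the yellow Hadamard node -/
  | had : Diagram Unit Unit
  /-- the black star node -/
  | star : Diagram Empty Empty
  /-- sequential composition: the first diagram is applied first -/
  | comp {A B C : Type} (D : Diagram A B) (E : Diagram B C) : Diagram A C
  /-- parallel composition: the two diagrams side by side -/
  | tensor {A B A' B' : Type} (D : Diagram A B) (E : Diagram A' B') : Diagram (A ⊕ A') (B ⊕ B')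

infixl:70 " ⨾ " => Diagram.comp
infixl:75 " ⊠ " => Diagram.tensor

namespace Diagram

/-- Parallel straight wires. -/
def idw (A : Type) [Finite A] : Diagram A A := wires (Equiv.refl A)

/-- The diagram with green and red interchanged. -/
noncomputable def colourSwap : {A B : Type} → Diagram A B → Diagram A B
  | _, _, wires e => wires e
  | _, _, cup => cup
  | _, _, cap => cap
  | _, _, green A B α => red A B α
  | _, _, red A B α => green A B α
  | _, _, had => had
  | _, _, star => star
  | _, _, comp D E => comp (colourSwap D) (colourSwap E)
  | _, _, tensor D E => tensor (colourSwap D) (colourSwap E)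

/-- The diagram turned upside-down (phases are kept). -/
noncomputable def flip : {A B : Type} → Diagram A B → Diagram B A
  | _, _, wires e => wires e.symm
  | _, _, cup => cap
  | _, _, cap => cup
  | _, _, green A B α => green B A α
  | _, _, red A B α => red B A α
  | _, _, had => had
  | _, _, star => star
  | _, _, comp D E => comp (flip E) (flip D)
  | _, _, tensor D E => tensor (flip D) (flip E)

/-- A scalar diagram `s` placed next to the diagram `D`. -/
def scale {A B : Type} [Finite A] [Finite B] (s : Diagram Empty Empty) (D : Diagram A B) :
    Diagram A B :=
  wires (Equiv.emptySum Empty A).symm ⨾ (s ⊠ D) ⨾ wires (Equiv.emptySum Empty B)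

end Diagram

open Diagram

/-- Splitting off the first member of a finite disjoint union. -/
def sigmaFinSucc {n : ℕ} (A : Fin (n + 1) → Type) :
    (Σ i, A i) ≃ A 0 ⊕ (Σ i : Fin n, A i.succ) where
  toFun x := Fin.cases (motive := fun i => A i → A 0 ⊕ (Σ i : Fin n, A i.succ))
    (fun a => Sum.inl a) (fun i a => Sum.inr ⟨i, a⟩) x.1 x.2
  invFun x := Sum.elim (fun a => ⟨0, a⟩) (fun y => ⟨y.1.succ, y.2⟩) x
  left_inv := by
    rintro ⟨i, a⟩
    induction i using Fin.cases <;> rfl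
  right_inv := by
    rintro (a | ⟨i, a⟩) <;> rfl

/-- The diagrams `D 0`, ..., `D (n - 1)` side by side. -/
def finTensor : {n : ℕ} → {A B : Fin n → Type} → [∀ i, Finite (A i)] → [∀ i, Finite (B i)] →
    (∀ i, Diagram (A i) (B i)) → Diagram (Σ i, A i) (Σ i, B i)
  | 0, _, _, _, _, _ => wires (Equiv.equivOfIsEmpty _ _)
  | _ + 1, A, B, _, _, D =>
      wires (sigmaFinSucc A) ⨾ (D 0 ⊠ finTensor fun i => D i.succ) ⨾ wires (sigmaFinSucc B).symm

/-- The single-wire diagram `U v` on each wire `v` of `n` parallel wires. -/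
def onEach {n : ℕ} (U : Fin n → Diagram Unit Unit) : Diagram (Fin n) (Fin n) :=
  wires (Equiv.sigmaUnique (Fin n) fun _ => Unit).symm ⨾ finTensor U ⨾
    wires (Equiv.sigmaUnique (Fin n) fun _ => Unit)

/-- The phases `π`, `π/2` and `-π/2`. -/
noncomputable abbrev phPi : Real.Angle := ((Real.pi : ℝ) : Real.Angle)
noncomputable abbrev phHalf : Real.Angle := ((Real.pi / 2 : ℝ) : Real.Angle)
noncomputable abbrev phNegHalf : Real.Angle := ((-(Real.pi / 2) : ℝ) : Real.Angle)

/-- The scalar diagram made of a green state of phase `α` and a red effect of phase `β`. -/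
def overlap (α β : Real.Angle) : Diagram Empty Empty :=
  green Empty Unit α ⨾ red Unit Empty β

/-- Phase shifts. -/
def gphase (α : Real.Angle) : Diagram Unit Unit := green Unit Unit α
def rphase (α : Real.Angle) : Diagram Unit Unit := red Unit Unit α

/-- The explicit rewrite rules, each in one colour assignment and one orientation.  The first three
say that the legs of a spider may be permuted and bent (inputs and outputs of spiders need not be
distinguished). -/
inductive Rule : {A B : Type} → Diagram A B → Diagram A B → Prop
  | permIn {A A' B : Type} [Finite A] [Finite A'] [Finite B] (e : A ≃ A') (α : Real.Angle) :
      Rule (wires e ⨾ green A' B α) (green A B α)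
  | permOut {A B B' : Type} [Finite A] [Finite B] [Finite B'] (e : B ≃ B') (α : Real.Angle) :
      Rule (green A B α ⨾ wires e) (green A B' α)
  | bend (A B : Type) [Finite A] [Finite B] (α : Real.Angle) :
      Rule ((green A (B ⊕ Unit) α ⊠ idw Unit) ⨾ wires (Equiv.sumAssoc B Unit Unit) ⨾
          (idw B ⊠ cap) ⨾ wires (Equiv.sumEmpty B Empty))
        (green (A ⊕ Unit) B α)
  | spider (A B A' B' : Type) [Finite A] [Finite B] [Finite A'] [Finite B'] (α β : Real.Angle) :
      Rule ((green A (B ⊕ Unit) α ⊠ idw A') ⨾ wires (Equiv.sumAssoc B Unit A') ⨾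
          (idw B ⊠ green (Unit ⊕ A') B' β))
        (green (A ⊕ A') (B ⊕ B') (α + β))
  | loop (A B : Type) [Finite A] [Finite B] (α : Real.Angle) :
      Rule (green A (B ⊕ (Unit ⊕ Unit)) α ⨾ (idw B ⊠ cap) ⨾ wires (Equiv.sumEmpty B Empty))
        (green A B α)
  | cup : Rule (green Empty (Unit ⊕ Unit) 0) Diagram.cup
  | bialgebra :
      Rule (scale (overlap 0 0)
          ((green Unit (Unit ⊕ Unit) 0 ⊠ green Unit (Unit ⊕ Unit) 0) ⨾
            wires (Equiv.sumSumSumComm Unit Unit Unit Unit) ⨾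
            (red (Unit ⊕ Unit) Unit 0 ⊠ red (Unit ⊕ Unit) Unit 0)))
        (red (Unit ⊕ Unit) Unit 0 ⨾ green Unit (Unit ⊕ Unit) 0)
  | copy :
      Rule (scale (overlap 0 0) (red Empty Unit 0 ⨾ green Unit (Unit ⊕ Unit) 0))
        (wires (Equiv.emptySum Empty Empty).symm ⨾ (red Empty Unit 0 ⊠ red Empty Unit 0))
  | piCopy (m : ℕ) :
      Rule (rphase phPi ⨾ green Unit (Fin m) 0)
        (green Unit (Fin m) 0 ⨾ onEach fun _ => rphase phPi)
  | piComm (α : Real.Angle) :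
      Rule (scale (overlap 0 0) (gphase α ⨾ rphase phPi))
        (scale (overlap α phPi) (rphase phPi ⨾ gphase (-α)))
  | colour (n m : ℕ) (α : Real.Angle) :
      Rule ((onEach fun _ => had) ⨾ green (Fin n) (Fin m) α ⨾ onEach fun _ => had)
        (red (Fin n) (Fin m) α)
  | euler :
      Rule (scale (overlap 0 0) (scale (overlap 0 0) had))
        (scale (overlap phNegHalf phNegHalf) (gphase phHalf ⨾ rphase phHalf ⨾ gphase phHalf))
  | star : Rule (scale Diagram.star (green Empty Empty 0)) (idw Empty)
  | zero :
      Rule (scale (green Empty Empty phPi) (idw Unit))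
        (scale (green Empty Empty phPi) (green Unit Empty 0 ⨾ red Empty Unit 0))
  | zeroScalar (α : Real.Angle) :
      Rule (scale (green Empty Empty phPi) (green Empty Empty α)) (green Empty Empty phPi)

/-- Equality of diagrams within the ZX-calculus: the least congruence for sequential and parallel
composition that contains the laws of a (self-dual) compact closed category, that is, equality of
string diagrams up to isomorphism (associators, unitors and symmetries are relabelled wires), and all
rewrite rules, which may also be applied with the colours
interchanged and upside-down. -/
inductive Equal : {A B : Type} → Diagram A B → Diagram A B → Prop
  | refl {A B : Type} (D : Diagram A B) : Equal D D
  | symm {A B : Type} {D E : Diagram A B} : Equal D E → Equal E D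
  | trans {A B : Type} {D E F : Diagram A B} : Equal D E → Equal E F → Equal D F
  | congr_comp {A B C : Type} {D D' : Diagram A B} {E E' : Diagram B C} :
      Equal D D' → Equal E E' → Equal (D ⨾ E) (D' ⨾ E')
  | congr_tensor {A B A' B' : Type} {D D' : Diagram A B} {E E' : Diagram A' B'} :
      Equal D D' → Equal E E' → Equal (D ⊠ E) (D' ⊠ E')
  | comp_assoc {A B C C' : Type} (D : Diagram A B) (E : Diagram B C) (F : Diagram C C') :
      Equal (D ⨾ E ⨾ F) (D ⨾ (E ⨾ F))
  | id_comp {A B : Type} [Finite A] (D : Diagram A B) : Equal (idw A ⨾ D) D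
  | comp_id {A B : Type} [Finite B] (D : Diagram A B) : Equal (D ⨾ idw B) D
  | wires_comp {A B C : Type} [Finite A] [Finite B] [Finite C] (e : A ≃ B) (f : B ≃ C) :
      Equal (wires e ⨾ wires f) (wires (e.trans f))
  | wires_tensor {A B A' B' : Type} [Finite A] [Finite B] [Finite A'] [Finite B']
      (e : A ≃ B) (f : A' ≃ B') : Equal (wires e ⊠ wires f) (wires (Equiv.sumCongr e f))
  | interchange {A B C A' B' C' : Type} (D : Diagram A B) (E : Diagram B C)
      (D' : Diagram A' B') (E' : Diagram B' C') :
      Equal ((D ⨾ E) ⊠ (D' ⨾ E')) ((D ⊠ D') ⨾ (E ⊠ E'))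
  | tensor_assoc {A B A' B' A'' B'' : Type} [Finite A] [Finite B] [Finite A'] [Finite B']
      [Finite A''] [Finite B''] (D : Diagram A B) (E : Diagram A' B') (F : Diagram A'' B'') :
      Equal (((D ⊠ E) ⊠ F) ⨾ wires (Equiv.sumAssoc B B' B''))
        (wires (Equiv.sumAssoc A A' A'') ⨾ (D ⊠ (E ⊠ F)))
  | empty_tensor {A B : Type} [Finite A] [Finite B] (D : Diagram A B) :
      Equal ((idw Empty ⊠ D) ⨾ wires (Equiv.emptySum Empty B))
        (wires (Equiv.emptySum Empty A) ⨾ D)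
  | tensor_swap {A B A' B' : Type} [Finite A] [Finite B] [Finite A'] [Finite B']
      (D : Diagram A B) (E : Diagram A' B') :
      Equal ((D ⊠ E) ⨾ wires (Equiv.sumComm B B')) (wires (Equiv.sumComm A A') ⨾ (E ⊠ D))
  -- compact structure: snake equations and symmetry of bent wires
  | snake_left : Equal (wires (Equiv.sumEmpty Unit Empty).symm ⨾ (idw Unit ⊠ cup) ⨾
        wires (Equiv.sumAssoc Unit Unit Unit).symm ⨾ (cap ⊠ idw Unit) ⨾
        wires (Equiv.emptySum Empty Unit)) (idw Unit)
  | snake_right : Equal (wires (Equiv.emptySum Empty Unit).symm ⨾ (cup ⊠ idw Unit) ⨾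
        wires (Equiv.sumAssoc Unit Unit Unit) ⨾ (idw Unit ⊠ cap) ⨾
        wires (Equiv.sumEmpty Unit Empty)) (idw Unit)
  | cup_swap : Equal (cup ⨾ wires (Equiv.sumComm Unit Unit)) cup
  | cap_swap : Equal (wires (Equiv.sumComm Unit Unit) ⨾ cap) cap
  -- rewrite rules
  | rule {A B : Type} {D E : Diagram A B} : Rule D E → Equal D E
  | rule_colourSwap {A B : Type} {D E : Diagram A B} :
      Rule D E → Equal D.colourSwap E.colourSwap
  | rule_flip {A B : Type} {D E : Diagram A B} : Rule D E → Equal D.flip E.flip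
  | rule_colourSwap_flip {A B : Type} {D E : Diagram A B} :
      Rule D E → Equal D.colourSwap.flip E.colourSwap.flip

/-- Phases that are integer multiples of `π/2`. -/
def IsQuarter (α : Real.Angle) : Prop := ∃ k : ℤ, α = k • phHalf

/-- Stabilizer diagrams: all phases are integer multiples of `π/2`. -/
def Diagram.IsStabilizer : {A B : Type} → Diagram A B → Prop
  | _, _, green _ _ α => IsQuarter α
  | _, _, red _ _ α => IsQuarter α
  | _, _, comp D E => D.IsStabilizer ∧ E.IsStabilizer
  | _, _, tensor D E => D.IsStabilizer ∧ E.IsStabilizer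
  | _, _, wires _ => True
  | _, _, cup => True
  | _, _, cap => True
  | _, _, had => True
  | _, _, star => True

/-- Diagrams of single-qubit Clifford operators: the finite vertical composites of Hadamard nodes
and of green and red phase shifts by multiples of `π/2`. -/
inductive IsClifford : Diagram Unit Unit → Prop
  | id : IsClifford (idw Unit)
  | green {α : Real.Angle} (h : IsQuarter α) : IsClifford (gphase α)
  | red {α : Real.Angle} (h : IsQuarter α) : IsClifford (rphase α)
  | had : IsClifford Diagram.had
  | comp {U V : Diagram Unit Unit} : IsClifford U → IsClifford V → IsClifford (U ⨾ V)

/-- A disjoint union of copies of the empty type is empty. -/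
def sigmaNone (n : ℕ) : (Σ _ : Fin n, Empty) ≃ Empty where
  toFun x := x.2
  invFun x := x.elim
  left_inv x := x.2.elim
  right_inv x := x.elim

section GraphState

variable {n : ℕ}

/-- The edges of a graph on `Fin n`, each written as an increasing pair. -/
def Edge (G : SimpleGraph (Fin n)) : Type := {p : Fin n × Fin n // p.1 < p.2 ∧ G.Adj p.1 p.2}

variable {G : SimpleGraph (Fin n)} {k : ℕ}

/-- For a list `ε` of all edges, the vertex at either end of the `j`-th edge. -/
def endpoint (ε : Fin k ≃ Edge G) : Fin k × (Unit ⊕ Unit) → Fin n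
  | (j, Sum.inl _) => (ε j).1.1
  | (j, Sum.inr _) => (ε j).1.2

/-- The edge ends at the vertex `v`. -/
abbrev Leg (ε : Fin k ≃ Edge G) (v : Fin n) : Type :=
  {l : Fin k × (Unit ⊕ Unit) // endpoint ε l = v}

/-- The first leg of the spider of each vertex `v` becomes output `v`, the other legs go to the edge
ends at `v`. -/
def wiring (ε : Fin k ≃ Edge G) :
    (Σ v : Fin n, Unit ⊕ Leg ε v) ≃ Fin n ⊕ (Σ _ : Fin k, Unit ⊕ Unit) :=
  (Equiv.sigmaSumDistrib (fun _ => Unit) (Leg ε)).trans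
    (Equiv.sumCongr (Equiv.sigmaUnique (Fin n) fun _ => Unit)
      ((Equiv.sigmaFiberEquiv (endpoint ε)).trans
        (Equiv.sigmaEquivProd (Fin k) (Unit ⊕ Unit)).symm))

/-- A Hadamard node on a bent wire, the edges of a graph state diagram. -/
def hadCap : Diagram (Unit ⊕ Unit) Empty := (had ⊠ idw Unit) ⨾ cap

/-- The (non-scalar part of the) graph state diagram of `G`: for each vertex `v` a green node of
phase 0 with one output, and for each edge a Hadamard node connected to the green nodes of its two
ends. -/
noncomputable def graphState (ε : Fin k ≃ Edge G) : Diagram Empty (Fin n) :=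
  wires (sigmaNone n).symm ⨾
    finTensor (fun v : Fin n => green Empty (Unit ⊕ Leg ε v) 0) ⨾
    wires (wiring ε) ⨾
    (idw (Fin n) ⊠ finTensor fun _ : Fin k => hadCap) ⨾
    wires ((Equiv.sumCongr (Equiv.refl (Fin n)) (sigmaNone k)).trans (Equiv.sumEmpty (Fin n) Empty))

end GraphState

/-- GS-LC diagrams on `n` qubits: a graph state diagram with a single-qubit Clifford operator
applied to each output, together with an arbitrary stabilizer scalar diagram. -/
def IsGSLC {n : ℕ} (E : Diagram Empty (Fin n)) : Prop :=
  ∃ (G : SimpleGraph (Fin n)) (k : ℕ) (ε : Fin k ≃ Edge G) (U : Fin n → Diagram Unit Unit)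
    (s : Diagram Empty Empty), (∀ v, IsClifford (U v)) ∧ s.IsStabilizer ∧
      E = scale s (graphState ε ⨾ onEach U)

end ZX

/-!
States are treated as functions.  A diagram `Empty → X`, taken up to provable equality, plays the
role of a function of two-valued variables indexed by `X`: merging equally labelled outputs
of two states by green spiders is a commutative product (`mulSt`), a map `X → Y` acts by
substitution of variables (`ren`, built from the functor `P`, which merges the wires of each fibre),
and deleting outputs by green effects is summation (`sum`).  These operations satisfy the usual laws
of finite sums (`mul_sum`, `sum_comm`, `sum_delta_all`), and bending the inputs turns every diagram
into a kernel `K D`, with composition given by summation (`K_comp`).  The kernels of all generators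
are sums of products of phases `ze α i`, equalities `dl i j` and Hadamard edges `hh i j`.

The rewrite rules then become statements about such sums.  The copy and star rules make the scalar
`√2` invertible (`tt_mul_star`), the bialgebra rule says that functions of the form
`q ↦ ∏ hh q x` are characters (`exists_isChar`) and implies that Hadamard edges cancel in pairs
(`hopf`), and the Euler rule, whose scalar is invertible by the commutation rule (`scalar_eq`),
expresses a Hadamard edge by phases.  Together these give local complementation
(`exists_sum_odd`): summing over a variable whose phase is an odd multiple of `π/2` again gives a
product of scalars, phases and Hadamard edges, that is, a graph function.  A variable of even
phase is summed together with one of its neighbours (`sum_sum_mem`); if both phases are even, a new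
variable on the edge between them makes all three phases odd.

Every stabilizer state is a sum of a graph function over some auxiliary variables
(`isGraphSum_mor`).  These are removed by induction on their number (`isGSLCState_sum`).  Only a
variable of even phase all of whose neighbours are outputs needs more: a Hadamard operator on such
an output turns the neighbour into a summed variable, and the operator is absorbed by the local
Clifford operators of the result.  In the end a graph function of the outputs remains, which is a graph
state with phases on its outputs (`graphState_mor`, `isGSLCState_of_mem`).
-/

namespace ZX
open Diagram

set_option linter.unusedSectionVars false

/-! ### Diagrams up to provable equality -/

/-- Provable equality as a setoid. -/
def equalSetoid (A B : Type) : Setoid (Diagram A B) :=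
  ⟨Equal, Equal.refl, Equal.symm, Equal.trans⟩

/-- Diagrams modulo equality within the ZX-calculus. -/
def Mor (A B : Type) : Type 1 := Quotient (equalSetoid A B)

/-- The class of a diagram. -/
def Diagram.mor {A B : Type} (D : Diagram A B) : Mor A B := Quotient.mk (equalSetoid A B) D

theorem mor_eq_iff {A B : Type} {D E : Diagram A B} : D.mor = E.mor ↔ Equal D E :=
  ⟨fun h => Quotient.exact (s := equalSetoid A B) h, fun h => Quotient.sound (s := equalSetoid A B) h⟩

namespace Mor

/-- Sequential composition. -/
def comp {A B C : Type} : Mor A B → Mor B C → Mor A C :=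
  Quotient.map₂ Diagram.comp fun _ _ h _ _ h' => Equal.congr_comp h h'

/-- Parallel composition. -/
def tensor {A B A' B' : Type} : Mor A B → Mor A' B' → Mor (A ⊕ A') (B ⊕ B') :=
  Quotient.map₂ Diagram.tensor fun _ _ h _ _ h' => Equal.congr_tensor h h'

end Mor

infixr:70 " ≫ₘ " => Mor.comp
infixl:75 " ⊗ₘ " => Mor.tensor

/-- Relabelled wires. -/
def W {A B : Type} [Finite A] [Finite B] (e : A ≃ B) : Mor A B := (wires e).mor

/-- Parallel straight wires. -/
abbrev ident (A : Type) [Finite A] : Mor A A := W (Equiv.refl A)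

/-- Green spiders. -/
def gr (A B : Type) [Finite A] [Finite B] (α : Real.Angle) : Mor A B := (green A B α).mor

/-- Red spiders. -/
def rd (A B : Type) [Finite A] [Finite B] (α : Real.Angle) : Mor A B := (red A B α).mor

/-- The bent wire with two outputs. -/
def cupM : Mor Empty (Unit ⊕ Unit) := Diagram.cup.mor

/-- The bent wire with two inputs. -/
def capM : Mor (Unit ⊕ Unit) Empty := Diagram.cap.mor

/-- The Hadamard node. -/
def hadM : Mor Unit Unit := Diagram.had.mor

section basics

variable {A B C A' B' C' A'' B'' : Type}

theorem mor_comp (D : Diagram A B) (E : Diagram B C) : (D ⨾ E).mor = D.mor ≫ₘ E.mor := rfl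

theorem mor_tensor (D : Diagram A B) (E : Diagram A' B') : (D ⊠ E).mor = D.mor ⊗ₘ E.mor := rfl

theorem Mor.ind {p : Mor A B → Prop} (h : ∀ D : Diagram A B, p D.mor) (f : Mor A B) : p f :=
  Quotient.ind (s := equalSetoid A B) h f

theorem comp_assoc (f : Mor A B) (g : Mor B C) (h : Mor C C') :
    (f ≫ₘ g) ≫ₘ h = f ≫ₘ (g ≫ₘ h) := by
  induction f using Mor.ind; induction g using Mor.ind; induction h using Mor.ind
  exact mor_eq_iff.2 (Equal.comp_assoc _ _ _)

theorem id_comp [Finite A] (f : Mor A B) : ident A ≫ₘ f = f := by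
  induction f using Mor.ind
  exact mor_eq_iff.2 (Equal.id_comp _)

theorem comp_id [Finite B] (f : Mor A B) : f ≫ₘ ident B = f := by
  induction f using Mor.ind
  exact mor_eq_iff.2 (Equal.comp_id _)

theorem W_comp [Finite A] [Finite B] [Finite C] (e : A ≃ B) (f : B ≃ C) :
    W e ≫ₘ W f = W (e.trans f) := mor_eq_iff.2 (Equal.wires_comp _ _)

theorem W_comp_assoc [Finite A] [Finite B] [Finite C] (e : A ≃ B) (f : B ≃ C) (g : Mor C C') :
    W e ≫ₘ W f ≫ₘ g = W (e.trans f) ≫ₘ g := by rw [← comp_assoc, W_comp]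

theorem W_tensor [Finite A] [Finite B] [Finite A'] [Finite B'] (e : A ≃ B) (f : A' ≃ B') :
    W e ⊗ₘ W f = W (Equiv.sumCongr e f) := mor_eq_iff.2 (Equal.wires_tensor _ _)

theorem interchange (f : Mor A B) (g : Mor B C) (f' : Mor A' B') (g' : Mor B' C') :
    (f ≫ₘ g) ⊗ₘ (f' ≫ₘ g') = (f ⊗ₘ f') ≫ₘ (g ⊗ₘ g') := by
  induction f using Mor.ind; induction g using Mor.ind
  induction f' using Mor.ind; induction g' using Mor.ind
  exact mor_eq_iff.2 (Equal.interchange _ _ _ _)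

/-- The wires of a diagram are labelled by finite types, which `Mor` itself does not record. -/
theorem Mor.finite (f : Mor A B) : Finite A ∧ Finite B := by
  induction f using Mor.ind with | _ D =>
  induction D with
  | comp _ _ h h' => exact ⟨h.1, h'.2⟩
  | tensor _ _ h h' =>
    have := h.1; have := h'.1; have := h.2; have := h'.2
    exact ⟨inferInstance, inferInstance⟩
  | _ => exact ⟨inferInstance, inferInstance⟩

theorem tensor_assoc (f : Mor A B) (g : Mor A' B') (h : Mor A'' B'')
    [Finite A] [Finite B] [Finite A'] [Finite B'] [Finite A''] [Finite B''] :
    ((f ⊗ₘ g) ⊗ₘ h) ≫ₘ W (Equiv.sumAssoc B B' B'') =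
      W (Equiv.sumAssoc A A' A'') ≫ₘ (f ⊗ₘ (g ⊗ₘ h)) := by
  induction f using Mor.ind; induction g using Mor.ind; induction h using Mor.ind
  exact mor_eq_iff.2 (Equal.tensor_assoc _ _ _)

theorem empty_tensor [Finite A] [Finite B] (f : Mor A B) :
    (ident Empty ⊗ₘ f) ≫ₘ W (Equiv.emptySum Empty B) = W (Equiv.emptySum Empty A) ≫ₘ f := by
  induction f using Mor.ind
  exact mor_eq_iff.2 (Equal.empty_tensor _)

theorem tensor_swap [Finite A] [Finite B] [Finite A'] [Finite B'] (f : Mor A B) (g : Mor A' B') :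
    (f ⊗ₘ g) ≫ₘ W (Equiv.sumComm B B') = W (Equiv.sumComm A A') ≫ₘ (g ⊗ₘ f) := by
  induction f using Mor.ind; induction g using Mor.ind
  exact mor_eq_iff.2 (Equal.tensor_swap _ _)

theorem tensor_comp_id [Finite A'] (f : Mor A B) (g : Mor B C) :
    (f ≫ₘ g) ⊗ₘ ident A' = (f ⊗ₘ ident A') ≫ₘ (g ⊗ₘ ident A') := by
  rw [← interchange, id_comp]

theorem id_tensor_comp [Finite A'] (f : Mor A B) (g : Mor B C) :
    ident A' ⊗ₘ (f ≫ₘ g) = (ident A' ⊗ₘ f) ≫ₘ (ident A' ⊗ₘ g) := by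
  rw [← interchange, id_comp]

theorem tensor_eq [Finite A] [Finite B'] (f : Mor A B) (g : Mor A' B') :
    f ⊗ₘ g = (ident A ⊗ₘ g) ≫ₘ (f ⊗ₘ ident B') := by
  rw [← interchange, id_comp, comp_id]

theorem tensor_eq' [Finite B] [Finite A'] (f : Mor A B) (g : Mor A' B') :
    f ⊗ₘ g = (f ⊗ₘ ident A') ≫ₘ (ident B ⊗ₘ g) := by
  rw [← interchange, id_comp, comp_id]

/-- A wire relabelling moved to the other side of an equation. -/
theorem W_comp_eq [Finite A] [Finite B] (e : A ≃ B) {f : Mor B C} {g : Mor A C} :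
    W e ≫ₘ f = g ↔ f = W e.symm ≫ₘ g := by
  constructor
  · rintro rfl
    rw [W_comp_assoc, Equiv.symm_trans_self, id_comp]
  · rintro rfl
    rw [W_comp_assoc, Equiv.self_trans_symm, id_comp]

/-- The same on the output side. -/
theorem comp_W_eq [Finite C] [Finite B] (e : B ≃ C) {f : Mor A B} {g : Mor A C} :
    f ≫ₘ W e = g ↔ f = g ≫ₘ W e.symm := by
  constructor
  · rintro rfl
    rw [comp_assoc, W_comp, Equiv.self_trans_symm, comp_id]
  · rintro rfl
    rw [comp_assoc, W_comp, Equiv.symm_trans_self, comp_id]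

theorem tensor_W_sandwich {A₁ B₁ A₂ B₂ : Type} [Finite A] [Finite B] [Finite A'] [Finite B'] [Finite A₁]
    [Finite B₁] [Finite A₂] [Finite B₂] (e : A ≃ A₁) (f : Mor A₁ B₁) (e' : B₁ ≃ B)
    (i : A' ≃ A₂) (g : Mor A₂ B₂) (i' : B₂ ≃ B') :
    (W e ≫ₘ f ≫ₘ W e') ⊗ₘ (W i ≫ₘ g ≫ₘ W i') =
      W (Equiv.sumCongr e i) ≫ₘ (f ⊗ₘ g) ≫ₘ W (Equiv.sumCongr e' i') := by
  rw [interchange, interchange, W_tensor, W_tensor]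

end basics

/-! ### Turning diagrams upside-down and interchanging the colours -/

section symmetries

variable {A B C A' B' : Type}

theorem flip_flip (D : Diagram A B) : D.flip.flip = D := by
  induction D <;> simp_all [Diagram.flip]

theorem colourSwap_colourSwap (D : Diagram A B) : D.colourSwap.colourSwap = D := by
  induction D <;> simp_all [colourSwap]

theorem colourSwap_flip (D : Diagram A B) : D.flip.colourSwap = D.colourSwap.flip := by
  induction D <;> simp_all [colourSwap, Diagram.flip]

/-- The rules come in both colour assignments, so that derivations may be colour-swapped. -/
theorem Equal.colourSwap {D E : Diagram A B} (h : Equal D E) :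
    Equal D.colourSwap E.colourSwap := by
  induction h with
  | refl D => exact .refl _
  | symm _ h => exact .symm h
  | trans _ _ h h' => exact .trans h h'
  | congr_comp _ _ h h' => exact .congr_comp h h'
  | congr_tensor _ _ h h' => exact .congr_tensor h h'
  | comp_assoc D E F => exact .comp_assoc _ _ _
  | id_comp D => exact .id_comp _
  | comp_id D => exact .comp_id _
  | wires_comp e f => exact .wires_comp _ _
  | wires_tensor e f => exact .wires_tensor _ _
  | interchange D E D' E' => exact .interchange _ _ _ _
  | tensor_assoc D E F => exact .tensor_assoc _ _ _
  | empty_tensor D => exact .empty_tensor _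
  | tensor_swap D E => exact .tensor_swap _ _
  | snake_left => exact .snake_left
  | snake_right => exact .snake_right
  | cup_swap => exact .cup_swap
  | cap_swap => exact .cap_swap
  | rule h => exact .rule_colourSwap h
  | rule_colourSwap h => rw [colourSwap_colourSwap, colourSwap_colourSwap]; exact .rule h
  | rule_flip h => rw [colourSwap_flip, colourSwap_flip]; exact .rule_colourSwap_flip h
  | rule_colourSwap_flip h =>
    rw [colourSwap_flip, colourSwap_flip, colourSwap_colourSwap, colourSwap_colourSwap]
    exact .rule_flip h

/-- Derivations may be turned upside-down. -/
theorem Equal.flip {D E : Diagram A B} (h : Equal D E) : Equal D.flip E.flip := by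
  induction h with
  | refl D => exact .refl _
  | symm _ h => exact .symm h
  | trans _ _ h h' => exact .trans h h'
  | congr_comp _ _ h h' => exact .congr_comp h' h
  | congr_tensor _ _ h h' => exact .congr_tensor h h'
  | comp_assoc D E F => exact .symm (.comp_assoc _ _ _)
  | id_comp D => exact .comp_id _
  | comp_id D => exact .id_comp _
  | wires_comp e f => exact .wires_comp _ _
  | wires_tensor e f => exact .wires_tensor _ _
  | interchange D E D' E' => exact .interchange _ _ _ _
  | tensor_assoc D E F =>
    have h := ZX.tensor_assoc D.flip.mor E.flip.mor F.flip.mor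
    rw [comp_W_eq, ZX.comp_assoc, eq_comm, W_comp_eq] at h
    exact mor_eq_iff.1 h.symm
  | empty_tensor D =>
    have h := ZX.empty_tensor D.flip.mor
    rw [comp_W_eq, ZX.comp_assoc, eq_comm, W_comp_eq] at h
    exact mor_eq_iff.1 h.symm
  | tensor_swap D E =>
    have h := ZX.tensor_swap E.flip.mor D.flip.mor
    exact mor_eq_iff.1 h.symm
  | snake_left =>
    have h := mor_eq_iff.2 Equal.snake_right
    simp only [mor_comp, ZX.comp_assoc] at h
    exact mor_eq_iff.1 h
  | snake_right =>
    have h := mor_eq_iff.2 Equal.snake_left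
    simp only [mor_comp, ZX.comp_assoc] at h
    exact mor_eq_iff.1 h
  | cup_swap => exact .cap_swap
  | cap_swap => exact .cup_swap
  | rule h => exact .rule_flip h
  | rule_colourSwap h => exact .rule_colourSwap_flip h
  | rule_flip h => rw [flip_flip, flip_flip]; exact .rule h
  | rule_colourSwap_flip h => rw [flip_flip, flip_flip]; exact .rule_colourSwap h

namespace Mor

/-- A diagram turned upside-down. -/
noncomputable def flip : Mor A B → Mor B A := Quotient.map Diagram.flip fun _ _ h => h.flip

/-- A diagram with the colours interchanged. -/
noncomputable def swap : Mor A B → Mor A B := Quotient.map Diagram.colourSwap fun _ _ h => h.colourSwap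

end Mor

theorem flip_comp (f : Mor A B) (g : Mor B C) : (f ≫ₘ g).flip = g.flip ≫ₘ f.flip := by
  induction f using Mor.ind; induction g using Mor.ind; rfl

theorem flip_tensor (f : Mor A B) (g : Mor A' B') : (f ⊗ₘ g).flip = f.flip ⊗ₘ g.flip := by
  induction f using Mor.ind; induction g using Mor.ind; rfl

theorem flip_W [Finite A] [Finite B] (e : A ≃ B) : (W e).flip = W e.symm := rfl

theorem flip_gr [Finite A] [Finite B] (α : Real.Angle) : (gr A B α).flip = gr B A α := rfl

theorem swap_comp (f : Mor A B) (g : Mor B C) : (f ≫ₘ g).swap = f.swap ≫ₘ g.swap := by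
  induction f using Mor.ind; induction g using Mor.ind; rfl

theorem swap_W [Finite A] [Finite B] (e : A ≃ B) : (W e).swap = W e := rfl

theorem swap_gr [Finite A] [Finite B] (α : Real.Angle) : (gr A B α).swap = rd A B α := rfl

end symmetries

/-! ### Green spiders and merging of wires -/

section spiders

variable {A B C A' B' X Y Z X' Y' : Type} [Finite A] [Finite B] [Finite C] [Finite A'] [Finite B']
  [Finite X] [Finite Y] [Finite Z] [Finite X'] [Finite Y']

theorem W_congr {e e' : A ≃ B} (h : ∀ x, e x = e' x) : W e = W e' :=
  congrArg W (Equiv.ext h)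

theorem W_gr (e : A ≃ A') (α : Real.Angle) : W e ≫ₘ gr A' B α = gr A B α :=
  mor_eq_iff.2 (.rule (.permIn e α))

theorem gr_W (e : B ≃ B') (α : Real.Angle) : gr A B α ≫ₘ W e = gr A B' α :=
  mor_eq_iff.2 (.rule (.permOut e α))

theorem gr_fuse (A B A' B' : Type) [Finite A] [Finite B] [Finite A'] [Finite B']
    (α β : Real.Angle) :
    (gr A (B ⊕ Unit) α ⊗ₘ ident A') ≫ₘ W (Equiv.sumAssoc B Unit A') ≫ₘ
      (ident B ⊗ₘ gr (Unit ⊕ A') B' β) = gr (A ⊕ A') (B ⊕ B') (α + β) := by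
  have h := mor_eq_iff.2 (.rule (.spider A B A' B' α β))
  simp only [mor_comp, comp_assoc] at h
  exact h

theorem ident_empty_tensor (f : Mor A B) :
    ident Empty ⊗ₘ f = W (Equiv.emptySum Empty A) ≫ₘ f ≫ₘ W (Equiv.emptySum Empty B).symm := by
  rw [← comp_assoc, ← comp_W_eq, empty_tensor]

theorem tensor_ident_empty (f : Mor A B) :
    f ⊗ₘ ident Empty = W (Equiv.sumEmpty A Empty) ≫ₘ f ≫ₘ W (Equiv.sumEmpty B Empty).symm := by
  have h := tensor_swap f (ident Empty)
  rw [comp_W_eq, ident_empty_tensor] at h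
  rw [h]
  simp only [comp_assoc, W_comp, W_comp_assoc]
  congr 2
  · ext x
    rcases x with x | x
    · rfl
    · exact x.elim
  · exact W_congr fun x => rfl

/-- The spider rule along the first input of the second spider. -/
theorem gr_merge (A B C : Type) [Finite A] [Finite B] [Finite C] (α β : Real.Angle) :
    (gr A Unit α ⊗ₘ ident B) ≫ₘ gr (Unit ⊕ B) C β = gr (A ⊕ B) C (α + β) := by
  have h := gr_fuse A Empty B C α β
  rw [← gr_W (Equiv.emptySum Empty Unit).symm, ← gr_W (A := A ⊕ B) (Equiv.emptySum Empty C).symm,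
    ident_empty_tensor, tensor_comp_id, W_tensor] at h
  simp only [comp_assoc, W_comp_assoc] at h
  rw [← comp_assoc, ← comp_assoc, comp_W_eq] at h
  simp only [comp_assoc, W_comp, Equiv.self_trans_symm, comp_id] at h
  rw [← h]
  congr 1
  rw [W_gr]

/-- The bijection sending the extra point to `i` and preserving the order of the others. -/
def insertFin {n : ℕ} (i : Fin (n + 1)) : Unit ⊕ Fin n ≃ Fin (n + 1) :=
  ((Equiv.sumComm _ _).trans (Equiv.optionEquivSumPUnit (Fin n)).symm).trans
    (finSuccEquiv' i).symm

@[simp] theorem insertFin_inl {n : ℕ} (i : Fin (n + 1)) (u : Unit) : insertFin i (.inl u) = i := by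
  simp [insertFin]

@[simp] theorem insertFin_inr {n : ℕ} (i : Fin (n + 1)) (j : Fin n) :
    insertFin i (.inr j) = i.succAbove j := by
  simp [insertFin]

/-- The tensor product of the green spiders of phase `0` with inputs `f ⁻¹ {i}` and output `i`. -/
noncomputable def mrg : {n : ℕ} → {X : Type} → [Finite X] → (X → Fin n) → Mor X (Fin n)
  | 0, X, _, f => haveI : IsEmpty X := ⟨fun x => (f x).elim0⟩; W (Equiv.equivOfIsEmpty X (Fin 0))
  | n + 1, X, _, f => W (Equiv.sumCompl fun x => f x = 0).symm ≫ₘ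
      (gr {x // f x = 0} Unit 0 ⊗ₘ mrg fun x : {x // ¬ f x = 0} => (f x).pred x.2) ≫ₘ
      W (insertFin 0)

theorem W_mrg {n : ℕ} (e : X ≃ Y) (f : Y → Fin n) : W e ≫ₘ mrg f = mrg (f ∘ e) := by
  induction n generalizing X Y with
  | zero =>
    rw [mrg, mrg, W_comp]
    congr 1
    ext x; exact (f (e x)).elim0
  | succ n ih =>
    rw [mrg, mrg]
    let e0 : {x // f (e x) = 0} ≃ {y // f y = 0} := e.subtypeEquiv fun _ => Iff.rfl
    let e1 : {x // ¬ f (e x) = 0} ≃ {y // ¬ f y = 0} := e.subtypeEquiv fun _ => Iff.rfl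
    have h1 := ih e1 (fun y : {y // ¬ f y = 0} => (f y).pred y.2)
    have h0 := W_gr (B := Unit) e0 0
    change _ = W (Equiv.sumCompl fun x => f (e x) = 0).symm ≫ₘ
      (gr {x // f (e x) = 0} Unit 0 ⊗ₘ mrg ((fun y : {y // ¬ f y = 0} => (f y).pred y.2) ∘ e1)) ≫ₘ _
    rw [← h1, ← h0, interchange, W_tensor, W_comp_assoc, comp_assoc, W_comp_assoc]
    congr 2
    rw [← Equiv.symm_symm (Equiv.trans (Equiv.sumCompl fun x => f (e x) = 0).symm _),
      ← Equiv.symm_symm (Equiv.trans e _)]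
    congr 1
    ext x
    rcases x with ⟨x, hx⟩ | ⟨x, hx⟩ <;> rfl

/-- Computation of `mrg` from any presentation of the fibre over `0` and its complement. -/
theorem mrg_succ {n : ℕ} (e : X ≃ A ⊕ X') (f' : X' → Fin n) (f : X → Fin (n + 1))
    (hf : ∀ x, f x = Sum.elim (fun _ => 0) (fun x' => (f' x').succ) (e x)) :
    mrg f = W e ≫ₘ (gr A Unit 0 ⊗ₘ mrg f') ≫ₘ W (insertFin 0) := by
  have hs : f = (Sum.elim (fun _ => 0) (fun x' => (f' x').succ) : A ⊕ X' → Fin (n + 1)) ∘ e :=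
    funext hf
  rw [hs, ← W_mrg, mrg]
  set g : A ⊕ X' → Fin (n + 1) := Sum.elim (fun _ => 0) (fun x' => (f' x').succ) with hg
  let e0 : A ≃ {x // g x = 0} := Equiv.ofBijective (fun a => ⟨.inl a, rfl⟩)
    ⟨fun a b h => Sum.inl_injective (congrArg Subtype.val h), by
      rintro ⟨a | x, h⟩
      · exact ⟨a, rfl⟩
      · exact (Fin.succ_ne_zero _ h).elim⟩
  let e1 : X' ≃ {x // ¬ g x = 0} := Equiv.ofBijective (fun a => ⟨.inr a, Fin.succ_ne_zero _⟩)
    ⟨fun a b h => Sum.inr_injective (congrArg Subtype.val h), by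
      rintro ⟨a | x, h⟩
      · exact (h rfl).elim
      · exact ⟨x, rfl⟩⟩
  have h1 := W_mrg e1 (fun x : {x // ¬ g x = 0} => (g x).pred x.2)
  have h0 := W_gr (B := Unit) e0 0
  have h2 : (fun x : {x // ¬ g x = 0} => (g x).pred x.2) ∘ e1 = f' := by
    ext x
    exact congrArg Fin.val (Fin.pred_succ (f' x) (h := Fin.succ_ne_zero _))
  rw [h2] at h1
  have h3 : W (Equiv.sumCompl fun x => g x = 0).symm = W (Equiv.sumCongr e0 e1) := by
    apply W_congr
    rintro (a | x)
    · exact Equiv.sumCompl_symm_apply_of_pos (p := fun x => g x = 0) rfl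
    · have hx : ¬ g (.inr x) = 0 := Fin.succ_ne_zero _
      exact Equiv.sumCompl_symm_apply_of_neg (p := fun x => g x = 0) hx
  rw [← h0, ← h1, interchange, W_tensor, comp_assoc, h3]

theorem tensor_assoc_left (f : Mor A B) (g : Mor A' B') (h : Mor X Y) :
    f ⊗ₘ (g ⊗ₘ h) = W (Equiv.sumAssoc A A' X).symm ≫ₘ ((f ⊗ₘ g) ⊗ₘ h) ≫ₘ
      W (Equiv.sumAssoc B B' Y) := by
  rw [eq_comm, tensor_assoc, W_comp_assoc, Equiv.symm_trans_self, id_comp]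

theorem tensor_assoc_right (f : Mor A B) (g : Mor A' B') (h : Mor X Y) :
    (f ⊗ₘ g) ⊗ₘ h = W (Equiv.sumAssoc A A' X) ≫ₘ (f ⊗ₘ (g ⊗ₘ h)) ≫ₘ
      W (Equiv.sumAssoc B B' Y).symm := by
  rw [← comp_assoc, ← tensor_assoc, comp_assoc, W_comp, Equiv.self_trans_symm, comp_id]

theorem tensor_comm (f : Mor A B) (g : Mor A' B') :
    f ⊗ₘ g = W (Equiv.sumComm A A') ≫ₘ (g ⊗ₘ f) ≫ₘ W (Equiv.sumComm B' B) := by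
  have h : (Equiv.sumComm B B').trans (Equiv.sumComm B' B) = Equiv.refl _ := by
    ext x; rcases x with x | x <;> rfl
  rw [← comp_assoc, ← tensor_swap, comp_assoc, W_comp, h, comp_id]

/-- Exchanging the first two factors of a threefold tensor product. -/
theorem tensor_left_comm (f : Mor A B) (g : Mor A' B') (h : Mor X Y) :
    f ⊗ₘ (g ⊗ₘ h) = W ((Equiv.sumAssoc A A' X).symm.trans
        ((Equiv.sumCongr (Equiv.sumComm A A') (Equiv.refl X)).trans (Equiv.sumAssoc A' A X))) ≫ₘ
      (g ⊗ₘ (f ⊗ₘ h)) ≫ₘ W ((Equiv.sumAssoc B' B Y).symm.trans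
        ((Equiv.sumCongr (Equiv.sumComm B' B) (Equiv.refl Y)).trans (Equiv.sumAssoc B B' Y))) := by
  have h0 : h = W (Equiv.refl X) ≫ₘ h ≫ₘ W (Equiv.refl Y) := by rw [id_comp, comp_id]
  rw [tensor_assoc_left f g h, tensor_comm f g]
  conv_lhs => rw [h0, tensor_W_sandwich, tensor_assoc_right]
  simp only [comp_assoc, W_comp, W_comp_assoc]
  rfl

/-- `mrg` does not depend on the order of its outputs: the spider of any output `i` may be split
off first. -/
theorem mrg_extract {n : ℕ} (i : Fin (n + 1)) (e : X ≃ A ⊕ X') (f' : X' → Fin n)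
    (f : X → Fin (n + 1)) (hf : ∀ x, f x = Sum.elim (fun _ => i) (fun x' => i.succAbove (f' x')) (e x)) :
    mrg f = W e ≫ₘ (gr A Unit 0 ⊗ₘ mrg f') ≫ₘ W (insertFin i) := by
  induction n generalizing X X' with
  | zero =>
    obtain rfl : i = 0 := Fin.fin_one_eq_zero i
    exact mrg_succ e f' f (by simpa using hf)
  | succ n ih =>
    induction i using Fin.cases with
    | zero => exact mrg_succ e f' f (by simpa using hf)
    | succ j =>
      let s := (Equiv.sumCompl fun x => f' x = 0).symm
      let f'' : {x // ¬ f' x = 0} → Fin n := fun x => (f' x).pred x.2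
      have h1 : mrg f' = W s ≫ₘ (gr {x // f' x = 0} Unit 0 ⊗ₘ mrg f'') ≫ₘ W (insertFin 0) := by
        rw [mrg]
      have h2 := ih (X := A ⊕ {x // ¬ f' x = 0}) j (Equiv.refl _) f'' _ (fun _ => rfl)
      have h3 := mrg_succ (X := X) (A := {x // f' x = 0}) (X' := A ⊕ {x // ¬ f' x = 0})
        (e.trans ((Equiv.sumCongr (Equiv.refl A) s).trans
          ((Equiv.sumAssoc _ _ _).symm.trans ((Equiv.sumCongr (Equiv.sumComm _ _) (Equiv.refl _)).trans
            (Equiv.sumAssoc _ _ _)))))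
        (Sum.elim (fun _ => j) (fun x' => j.succAbove (f'' x'))) f (by
          intro x
          rw [hf]
          obtain ⟨x, rfl⟩ := e.symm.surjective x
          rcases x with a | x
          · simp
          · obtain ⟨x, rfl⟩ := s.symm.surjective x
            rcases x with ⟨x, hx⟩ | ⟨x, hx⟩
            · simp [s, hx]
            · simp only [Equiv.apply_symm_apply, Sum.elim_inr, Equiv.trans_apply, f'', Equiv.sumCongr_apply,
                Sum.map_inr, Equiv.sumAssoc_symm_apply_inr_inr, Equiv.refl_apply, Equiv.sumAssoc_apply_inr]
              rw [← Fin.succ_succAbove_succ, Fin.succ_pred]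
              rfl)
      have h2' : mrg (Sum.elim (fun _ => j) (fun x' => j.succAbove (f'' x'))) =
        (gr A Unit 0 ⊗ₘ mrg f'') ≫ₘ W (insertFin j) := by
        rw [← id_comp ((gr A Unit 0 ⊗ₘ mrg f'') ≫ₘ W (insertFin j)), ← h2]; rfl
      have h4 : gr A Unit 0 = W (Equiv.refl A) ≫ₘ gr A Unit 0 ≫ₘ W (Equiv.refl Unit) := by
        rw [id_comp, comp_id]
      have h5 : gr {x // f' x = 0} Unit 0 = W (Equiv.refl _) ≫ₘ gr {x // f' x = 0} Unit 0 ≫ₘ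
        W (Equiv.refl Unit) := by rw [id_comp, comp_id]
      rw [h3, h1, h2', ← id_comp ((gr A Unit 0 ⊗ₘ mrg f'') ≫ₘ W (insertFin j))]
      conv_lhs => rw [h5, tensor_W_sandwich, tensor_left_comm]
      conv_rhs => rw [h4, tensor_W_sandwich]
      simp only [comp_assoc, W_comp, W_comp_assoc]
      congr 1
      · apply W_congr
        intro x
        rcases h : e x with a | x'
        · simp [h]
        · rcases h' : s x' with a | x' <;> simp [h, h']
      · congr 1
        apply W_congr
        rintro (_ | _ | _) <;> simp

/-- The inductive step of `mrg_tensor` when the first output belongs to the left factor. -/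
theorem mrg_tensor_aux {a b n : ℕ} (i : Fin (a + 1)) (e : Fin (a + 1) ⊕ Fin b ≃ Fin (n + 1))
    (hi : e (.inl i) = 0)
    (ih : ∀ {X Y : Type} [Finite X] [Finite Y] (f : X → Fin a) (g : Y → Fin b)
      (e' : Fin a ⊕ Fin b ≃ Fin n), (mrg f ⊗ₘ mrg g) ≫ₘ W e' = mrg (e' ∘ Sum.map f g))
    (f : X → Fin (a + 1)) (g : Y → Fin b) : (mrg f ⊗ₘ mrg g) ≫ₘ W e = mrg (e ∘ Sum.map f g) := by
  let s := (Equiv.sumCompl fun x => f x = i).symm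
  choose f' hf' using fun x : {x // ¬ f x = i} => Fin.exists_succAbove_eq x.2
  have h1 := mrg_extract i s f' f (by
    intro x
    obtain ⟨x, rfl⟩ := s.symm.surjective x
    rcases x with ⟨x, hx⟩ | x
    · simp [s, hx]
    · simp [s, hf'])
  have hne : ∀ y : Fin a ⊕ Fin b, e (Sum.map i.succAbove id y) ≠ 0 := by
    rintro (y | y) h <;> rw [← hi, e.injective.eq_iff] at h
    · exact Fin.succAbove_ne i y (Sum.inl_injective h)
    · cases h
  let e' : Fin a ⊕ Fin b ≃ Fin n :=
    Equiv.ofBijective (fun y => (e (Sum.map i.succAbove id y)).pred (hne y)) ⟨by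
      intro y z h
      exact (Fin.succAbove_right_injective.sumMap Function.injective_id) (e.injective (Fin.pred_inj.1 h)), by
      intro k
      obtain ⟨z, hz⟩ := e.surjective k.succ
      rcases z with z | z
      · have hzi : z ≠ i := by
          rintro rfl
          exact Fin.succ_ne_zero k (hz.symm.trans hi)
        obtain ⟨y, rfl⟩ := Fin.exists_succAbove_eq hzi
        exact ⟨.inl y, by simp [hz]⟩
      · exact ⟨.inr z, by simp [hz]⟩⟩
  have he' : ∀ y, (e' y).succ = e (Sum.map i.succAbove id y) := fun y => by
    simp [e', Equiv.ofBijective]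
  have h2 := mrg_succ (X := X ⊕ Y) (A := {x // f x = i}) (X' := {x // ¬ f x = i} ⊕ Y)
    ((Equiv.sumCongr s (Equiv.refl Y)).trans (Equiv.sumAssoc _ _ _)) (e' ∘ Sum.map f' g)
    (e ∘ Sum.map f g) (by
      rintro (x | y)
      · obtain ⟨x, rfl⟩ := s.symm.surjective x
        rcases x with ⟨x, hx⟩ | x
        · simp [s, hx, hi]
        · simp [s, he', hf']
      · simp [he'])
  have h3 : mrg g = W (Equiv.refl Y) ≫ₘ mrg g ≫ₘ W (Equiv.refl (Fin b)) := by rw [id_comp, comp_id]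
  have h4 : gr {x // f x = i} Unit 0 =
      W (Equiv.refl _) ≫ₘ gr {x // f x = i} Unit 0 ≫ₘ W (Equiv.refl Unit) := by
    rw [id_comp, comp_id]
  rw [h2, h1, ← ih, ← id_comp ((mrg f' ⊗ₘ mrg g) ≫ₘ W e')]
  conv_lhs => rw [h3, tensor_W_sandwich, tensor_assoc_right]
  conv_rhs => rw [h4, tensor_W_sandwich]
  simp only [comp_assoc, W_comp, W_comp_assoc]
  congr 1
  · exact W_congr fun x => by simp
  · congr 1
    apply W_congr
    rintro (_ | _ | _) <;> simp [hi, he']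

/-- A tensor product of merges is a merge. -/
theorem mrg_tensor {a b n : ℕ} (f : X → Fin a) (g : Y → Fin b) (e : Fin a ⊕ Fin b ≃ Fin n) :
    (mrg f ⊗ₘ mrg g) ≫ₘ W e = mrg (e ∘ Sum.map f g) := by
  induction n generalizing a b X Y with
  | zero =>
    obtain rfl : a = 0 := by
      by_contra h
      exact (e (.inl ⟨0, Nat.pos_of_ne_zero h⟩)).elim0
    obtain rfl : b = 0 := by
      by_contra h
      exact (e (.inr ⟨0, Nat.pos_of_ne_zero h⟩)).elim0
    rw [mrg, mrg, mrg, W_tensor, W_comp]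
    apply W_congr
    rintro (x | x)
    · exact (f x).elim0
    · exact (g x).elim0
  | succ n ih =>
    rcases h : e.symm 0 with i | i
    · obtain ⟨a, rfl⟩ : ∃ a', a = a' + 1 := ⟨a - 1, by have := i.pos; omega⟩
      exact mrg_tensor_aux i e (by rw [← h, e.apply_symm_apply]) ih f g
    · obtain ⟨b, rfl⟩ : ∃ b', b = b' + 1 := ⟨b - 1, by have := i.pos; omega⟩
      have := mrg_tensor_aux i ((Equiv.sumComm _ _).trans e) (by simp [← h]) ih g f
      rw [tensor_comm, comp_assoc, comp_assoc, W_comp, this, W_mrg]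
      congr 1
      ext x
      rcases x with x | x <;> rfl

theorem mrg_comp_W {n m : ℕ} (f : X → Fin n) (e : Fin n ≃ Fin m) :
    mrg f ≫ₘ W e = mrg (e ∘ f) := by
  have h := mrg_tensor f (Empty.elim : Empty → Fin 0)
    ((Equiv.sumEmpty (Fin n) (Fin 0)).trans e)
  have h0 : mrg (Empty.elim : Empty → Fin 0) =
      W (Equiv.refl Empty) ≫ₘ ident Empty ≫ₘ W (Equiv.equivOfIsEmpty Empty (Fin 0)) := by
    rw [mrg, id_comp, id_comp]
  have h1 : mrg f = W (Equiv.refl X) ≫ₘ mrg f ≫ₘ W (Equiv.refl _) := by rw [id_comp, comp_id]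
  rw [h0] at h
  conv_lhs at h => rw [h1, tensor_W_sandwich, tensor_ident_empty]
  simp only [comp_assoc, W_comp, W_comp_assoc] at h
  have h2 : mrg (e ∘ f) = W (Equiv.sumEmpty X Empty).symm ≫ₘ
      mrg (((Equiv.sumEmpty (Fin n) (Fin 0)).trans e) ∘ Sum.map f (Empty.elim : Empty → Fin 0)) := by
    rw [W_mrg]; rfl
  rw [h2, ← h, W_comp_assoc]
  have h3 : ((Equiv.sumEmpty X Empty).symm.trans
      (((Equiv.refl X).sumCongr (Equiv.refl Empty)).trans (Equiv.sumEmpty X Empty))) = Equiv.refl X := by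
    ext x; rfl
  rw [h3, id_comp]
  congr 1

theorem mrg_comp_gr_aux {n : ℕ} (f : X → Fin n) (A : Type) [Finite A] (α : Real.Angle) :
    (ident A ⊗ₘ mrg f) ≫ₘ gr (A ⊕ Fin n) C α = gr (A ⊕ X) C α := by
  induction n generalizing X A with
  | zero => rw [mrg, W_tensor, W_gr]
  | succ n ih =>
    have h : ident A = W (Equiv.refl A) ≫ₘ ident A ≫ₘ W (Equiv.refl A) := by rw [id_comp, comp_id]
    rw [mrg, h, tensor_W_sandwich, tensor_left_comm]
    simp only [comp_assoc, W_comp_assoc, W_gr]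
    rw [tensor_eq (gr _ Unit 0), comp_assoc, gr_merge, tensor_assoc_left, W_tensor]
    simp only [comp_assoc, W_comp_assoc, W_gr]
    have h' : Equiv.sumCongr (Equiv.refl {x // f x = 0}) (Equiv.refl A) = Equiv.refl _ := by
      ext x; rcases x with x | x <;> rfl
    rw [zero_add, h', ih, W_gr]

/-- A merge followed by a single green spider. -/
theorem mrg_comp_gr {n : ℕ} (f : X → Fin n) (α : Real.Angle) :
    mrg f ≫ₘ gr (Fin n) C α = gr X C α := by
  have h := mrg_comp_gr_aux (C := C) f Empty α
  rw [ident_empty_tensor, comp_assoc, comp_assoc, W_gr, W_comp_eq, W_gr] at h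
  exact h

/-- The tensor product of the green spiders of phase `0` with inputs `f ⁻¹ {y}` and output `y`. -/
noncomputable def P (f : X → Y) : Mor X Y := mrg (Finite.equivFin Y ∘ f) ≫ₘ W (Finite.equivFin Y).symm

/-- The choice of an enumeration of the outputs is irrelevant. -/
theorem P_eq {n : ℕ} (f : X → Y) (e : Y ≃ Fin n) : P f = mrg (e ∘ f) ≫ₘ W e.symm := by
  have h : e ∘ f = ((Finite.equivFin Y).symm.trans e) ∘ (Finite.equivFin Y ∘ f) := by
    ext x; simp
  rw [h, ← mrg_comp_W, comp_assoc, W_comp, P]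
  congr 1
  apply W_congr; simp

theorem P_comp_gr (f : X → Y) (α : Real.Angle) : P f ≫ₘ gr Y C α = gr X C α := by
  rw [P, comp_assoc, W_gr, mrg_comp_gr]

theorem W_P (e : X ≃ Y) (f : Y → Z) : W e ≫ₘ P f = P (f ∘ e) := by
  rw [P, ← comp_assoc, W_mrg]; rfl

theorem P_W (f : X → Y) (e : Y ≃ Z) : P f ≫ₘ W e = P (e ∘ f) := by
  rw [P_eq (e ∘ f) (e.symm.trans (Finite.equivFin Y)), P, comp_assoc, W_comp]
  congr 2
  ext; simp

theorem P_tensor (f : X → Y) (g : X' → Y') : P f ⊗ₘ P g = P (Sum.map f g) := by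
  rw [P, P, interchange, W_tensor]
  have h := mrg_tensor (Finite.equivFin Y ∘ f) (Finite.equivFin Y' ∘ g) finSumFinEquiv
  rw [comp_W_eq] at h
  rw [h, comp_assoc, W_comp, P_eq _ ((Equiv.sumCongr (Finite.equivFin Y) (Finite.equivFin Y')).trans finSumFinEquiv)]
  congr 2
  ext x; rcases x with x | x <;> rfl

theorem P_isEmpty [IsEmpty Y] (f : X → Y) (e : X ≃ Y) : P f = W e := by
  rw [P_eq f (Equiv.equivOfIsEmpty Y (Fin 0)), mrg, W_comp]
  exact W_congr fun x => isEmptyElim (f x)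

/-- Merging in two steps. -/
theorem P_mrg {n : ℕ} (f : X → Y) (g : Y → Fin n) : P f ≫ₘ mrg g = mrg (g ∘ f) := by
  induction n generalizing X Y with
  | zero =>
    have : IsEmpty Y := ⟨fun y => (g y).elim0⟩
    have : IsEmpty X := ⟨fun x => isEmptyElim (f x)⟩
    rw [mrg, mrg, P_isEmpty f (Equiv.equivOfIsEmpty X Y), W_comp]
    exact W_congr fun x => isEmptyElim x
  | succ n ih =>
    let s := (Equiv.sumCompl fun y => g y = 0).symm
    let r := (Equiv.sumCompl fun x => g (f x) = 0).symm
    let f0 : {x // g (f x) = 0} → {y // g y = 0} := fun x => ⟨f x, x.2⟩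
    let f1 : {x // ¬ g (f x) = 0} → {y // ¬ g y = 0} := fun x => ⟨f x, x.2⟩
    have h : s ∘ f = Sum.map f0 f1 ∘ r := by
      funext x
      obtain ⟨x, rfl⟩ := r.symm.surjective x
      rcases x with ⟨x, hx⟩ | ⟨x, hx⟩
      · simp [s, r, f0, hx]
      · simp [s, r, f1, hx]
    have h2 := ih f1 (fun y => (g y).pred y.2)
    rw [mrg, mrg, ← comp_assoc, P_W, h, ← W_P, ← P_tensor, comp_assoc, ← comp_assoc (_ ⊗ₘ _),
      ← interchange, P_comp_gr, h2]
    rfl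

/-- `P` is a functor. -/
theorem P_comp (f : X → Y) (g : Y → Z) : P f ≫ₘ P g = P (g ∘ f) := by
  rw [P_eq g (Finite.equivFin Z), ← comp_assoc, P_mrg, P]; rfl

/-- An output leg of a spider bent down is an input leg. -/
theorem gr_bend (A B : Type) [Finite A] [Finite B] (α : Real.Angle) :
    (gr A (B ⊕ Unit) α ⊗ₘ ident Unit) ≫ₘ W (Equiv.sumAssoc B Unit Unit) ≫ₘ
      (ident B ⊗ₘ capM) ≫ₘ W (Equiv.sumEmpty B Empty) = gr (A ⊕ Unit) B α := by
  have h := mor_eq_iff.2 (.rule (.bend A B α))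
  simp only [mor_comp, comp_assoc] at h
  exact h

theorem gr_cup : gr Empty (Unit ⊕ Unit) 0 = cupM := mor_eq_iff.2 (.rule .cup)

theorem gr_cap : gr (Unit ⊕ Unit) Empty 0 = capM := mor_eq_iff.2 (.rule_flip .cup)

theorem snake : W (Equiv.emptySum Empty Unit).symm ≫ₘ (cupM ⊗ₘ ident Unit) ≫ₘ
    W (Equiv.sumAssoc Unit Unit Unit) ≫ₘ (ident Unit ⊗ₘ capM) ≫ₘ
    W (Equiv.sumEmpty Unit Empty) = ident Unit := by
  have h := mor_eq_iff.2 Equal.snake_right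
  simp only [mor_comp, comp_assoc] at h
  exact h

/-- A green spider of phase `0` on a wire may be removed: bend one leg of the cup. -/
theorem gr_unit : gr Unit Unit 0 = ident Unit := by
  rw [← W_gr (Equiv.emptySum Empty Unit).symm, ← gr_bend, gr_cup, snake]

theorem mrg_id (n : ℕ) : mrg (id : Fin n → Fin n) = ident (Fin n) := by
  induction n with
  | zero => rw [mrg]; exact W_congr fun x => x.elim0
  | succ n ih =>
    rw [mrg_succ (insertFin 0).symm (id : Fin n → Fin n) id (by
      intro x
      obtain ⟨x, rfl⟩ := (insertFin 0).surjective x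
      rw [Equiv.symm_apply_apply]
      rcases x with x | x <;> simp), ih, gr_unit, W_tensor, W_comp, W_comp]
    exact W_congr fun x => by simp

theorem P_equiv (e : X ≃ Y) : P e = W e := by
  have h : P (id : Y → Y) = ident Y := by
    rw [P, Function.comp_id]
    have := W_mrg (Finite.equivFin Y) id
    rw [Function.id_comp] at this
    rw [← this, mrg_id, comp_id, W_comp, Equiv.self_trans_symm]
  have := W_P e id
  rw [h, comp_id] at this
  exact this.symm

theorem P_unit (f : X → Unit) : P f = gr X Unit 0 := by
  rw [← P_comp_gr f 0, gr_unit, comp_id]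

end spiders

/-! ### States as functions of their output variables -/

section states

variable {A B C A' B' X Y Z X' Y' : Type} [Finite A] [Finite B] [Finite C] [Finite A'] [Finite B']
  [Finite X] [Finite Y] [Finite Z] [Finite X'] [Finite Y']

/-- States with outputs `X`. -/
abbrev St (X : Type) : Type 1 := Mor Empty X

/-- Two states side by side. -/
def ext (φ : St X) (ψ : St Y) : St (X ⊕ Y) := W (Equiv.emptySum Empty Empty).symm ≫ₘ (φ ⊗ₘ ψ)

theorem ext_comp (φ : St X) (ψ : St Y) (f : Mor X X') (g : Mor Y Y') :
    ext (φ ≫ₘ f) (ψ ≫ₘ g) = ext φ ψ ≫ₘ (f ⊗ₘ g) := by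
  rw [ext, ext, interchange, comp_assoc]

theorem ext_comp_left (φ : St X) (ψ : St Y) (f : Mor X X') :
    ext (φ ≫ₘ f) ψ = ext φ ψ ≫ₘ (f ⊗ₘ ident Y) := by
  rw [← ext_comp, comp_id]

theorem ext_comp_right (φ : St X) (ψ : St Y) (g : Mor Y Y') :
    ext φ (ψ ≫ₘ g) = ext φ ψ ≫ₘ (ident X ⊗ₘ g) := by
  rw [← ext_comp, comp_id]

theorem ext_swap (φ : St X) (ψ : St Y) : ext φ ψ ≫ₘ W (Equiv.sumComm X Y) = ext ψ φ := by
  rw [ext, ext, comp_assoc, tensor_swap, W_comp_assoc]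
  congr 1
  exact W_congr fun x => x.elim

theorem ext_assoc (φ : St X) (ψ : St Y) (χ : St Z) :
    ext (ext φ ψ) χ ≫ₘ W (Equiv.sumAssoc X Y Z) = ext φ (ext ψ χ) := by
  have h1 : χ = W (Equiv.refl Empty) ≫ₘ χ := (id_comp χ).symm
  have h2 : φ = W (Equiv.refl Empty) ≫ₘ φ := (id_comp φ).symm
  simp only [ext]
  conv_lhs => rw [h1, interchange, W_tensor]
  conv_rhs => rw [h2, interchange, W_tensor]
  rw [comp_assoc, comp_assoc, tensor_assoc, W_comp_assoc, W_comp_assoc, W_comp_assoc]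
  congr 1
  exact W_congr fun x => x.elim

theorem ext_ident (ψ : St X) : ext ψ (ident Empty) = ψ ≫ₘ W (Equiv.sumEmpty X Empty).symm := by
  rw [ext, tensor_ident_empty, W_comp_assoc]
  have h : (Equiv.emptySum Empty Empty).symm.trans (Equiv.sumEmpty Empty Empty) = Equiv.refl _ :=
    Equiv.ext fun x => x.elim
  rw [h, id_comp]

/-- The product of states: outputs with the same label are merged by green spiders. -/
noncomputable def mulSt (φ ψ : St X) : St X := ext φ ψ ≫ₘ P (Sum.elim id id)

theorem mulSt_assoc (φ ψ χ : St X) : mulSt (mulSt φ ψ) χ = mulSt φ (mulSt ψ χ) := by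
  have hid : ident X = P (id : X → X) := (P_equiv (Equiv.refl X)).symm
  simp only [mulSt]
  rw [ext_comp_left, ext_comp_right, hid, P_tensor, P_tensor, comp_assoc, comp_assoc, P_comp, P_comp,
    ← ext_assoc, comp_assoc, W_P]
  congr 2
  funext x
  rcases x with (x | x) | x <;> rfl

theorem mulSt_comm (φ ψ : St X) : mulSt φ ψ = mulSt ψ φ := by
  rw [mulSt, ← ext_swap, comp_assoc, W_P, mulSt]
  congr 2
  funext x
  rcases x with x | x <;> rfl

theorem mulSt_one (ψ : St X) : mulSt ψ (P Empty.elim) = ψ := by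
  have h : (P Empty.elim : St X) = ident Empty ≫ₘ P Empty.elim := (id_comp _).symm
  have hid : ident X = P (id : X → X) := (P_equiv (Equiv.refl X)).symm
  rw [mulSt, h, ext_comp_right, ext_ident, hid, P_tensor, comp_assoc, comp_assoc, P_comp, W_P]
  convert comp_id ψ
  rw [hid]
  rfl

/-- Pointwise multiplication of functions; the constant function `1` is given by green spiders. -/
noncomputable instance : CommMonoid (St X) where
  mul := mulSt
  one := P Empty.elim
  mul_assoc := mulSt_assoc
  one_mul ψ := (mulSt_comm _ _).trans (mulSt_one ψ)
  mul_one := mulSt_one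
  mul_comm := mulSt_comm

theorem mul_def (φ ψ : St X) : φ * ψ = ext φ ψ ≫ₘ P (Sum.elim id id) := rfl

theorem one_def : (1 : St X) = P Empty.elim := rfl

/-- Substitution of variables along a map `f`. -/
noncomputable def ren (f : X → Y) : St X →* St Y where
  toFun ψ := ψ ≫ₘ P f
  map_one' := by
    rw [one_def, P_comp, one_def]
    congr 1
    funext x
    exact x.elim
  map_mul' φ ψ := by
    simp only [mul_def]
    rw [ext_comp, comp_assoc, comp_assoc, P_tensor, P_comp, P_comp]
    congr 2
    funext x
    rcases x with x | x <;> rfl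

theorem ren_def (f : X → Y) (ψ : St X) : ren f ψ = ψ ≫ₘ P f := rfl

@[simp] theorem ren_ren (f : X → Y) (g : Y → Z) (ψ : St X) : ren g (ren f ψ) = ren (g ∘ f) ψ := by
  rw [ren_def, ren_def, comp_assoc, P_comp]; rfl

theorem ren_id' (f : X → X) (h : ∀ x, f x = x) (ψ : St X) : ren f ψ = ψ := by
  obtain rfl : f = id := funext h
  exact (congrArg _ (P_equiv (Equiv.refl X))).trans (comp_id ψ)

@[simp] theorem ren_id (ψ : St X) : ren id ψ = ψ := ren_id' id (fun _ => rfl) ψ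

theorem ren_equiv (e : X ≃ Y) (ψ : St X) : ren e ψ = ψ ≫ₘ W e := by
  rw [ren_def, P_equiv]

theorem ren_congr {f g : X → Y} (h : ∀ x, f x = g x) (ψ : St X) : ren f ψ = ren g ψ := by
  rw [funext h]

/-- Applying a diagram to some of the outputs. -/
def app (D : Mor A B) (ψ : St (X ⊕ A)) : St (X ⊕ B) := ψ ≫ₘ (ident X ⊗ₘ D)

theorem app_comp (D : Mor A B) (E : Mor B C) (ψ : St (X ⊕ A)) :
    app (D ≫ₘ E) ψ = app E (app D ψ) := by
  rw [app, app, app, comp_assoc, ← id_tensor_comp]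

theorem ident_eq_P : ident X = P (id : X → X) := (P_equiv (Equiv.refl X)).symm

theorem app_P (f : A → B) (ψ : St (X ⊕ A)) : app (P f) ψ = ren (Sum.map id f) ψ := by
  rw [app, ident_eq_P, P_tensor, ren_def]

theorem app_W (f : A ≃ B) (ψ : St (X ⊕ A)) : app (W f) ψ = ren (Sum.map id f) ψ := by
  rw [← P_equiv, app_P]

theorem ren_app (f : X → Y) (D : Mor A B) (ψ : St (X ⊕ A)) :
    ren (Sum.map f id) (app D ψ) = app D (ren (Sum.map f id) ψ) := by
  simp only [app, ren_def, ← P_tensor, ← ident_eq_P]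
  rw [comp_assoc, comp_assoc, ← interchange, ← interchange, id_comp, comp_id, id_comp, comp_id]

/-- A factor that does not involve the variables a diagram acts on may be pulled out. -/
theorem mul_app (φ : St X) (D : Mor A B) (ψ : St (X ⊕ A)) :
    ren Sum.inl φ * app D ψ = app D (ren Sum.inl φ * ψ) := by
  have h : ∀ (A : Type) [Finite A], P (Sum.map Sum.inl id : X ⊕ (X ⊕ A) → (X ⊕ A) ⊕ (X ⊕ A)) ≫ₘ
      P (Sum.elim id id) = W (Equiv.sumAssoc X X A).symm ≫ₘ (P (Sum.elim id id) ⊗ₘ ident A) := by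
    intro A _
    rw [P_comp, ident_eq_P, P_tensor, W_P]
    congr 1
    funext x
    rcases x with x | x | x <;> rfl
  have h' : ∀ (A : Type) [Finite A], ∀ ψ : St (X ⊕ A), ren Sum.inl φ * ψ = ext φ ψ ≫ₘ
      W (Equiv.sumAssoc X X A).symm ≫ₘ (P (Sum.elim id id) ⊗ₘ ident A) := by
    intro A _ ψ
    rw [← h, ← P_tensor, ← ident_eq_P, ← comp_assoc, ← ext_comp_left]
    rfl
  rw [h', h', app, app, ext_comp_right, tensor_assoc_left]
  have h2 : Equiv.sumCongr (Equiv.refl X) (Equiv.refl X) = Equiv.refl (X ⊕ X) := by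
    ext x; rcases x with x | x <;> rfl
  simp only [comp_assoc, W_comp_assoc, Equiv.self_trans_symm, id_comp, W_tensor, h2]
  rw [← tensor_eq, ← tensor_eq']

/-- Deleting wires by green spiders. -/
noncomputable def discard (A : Type) [Finite A] : Mor A Empty := (P (Empty.elim : Empty → A)).flip

/-- Summation over the variables in `A`. -/
noncomputable def sum (A : Type) [Finite A] (ψ : St (X ⊕ A)) : St X :=
  app (discard A) ψ ≫ₘ W (Equiv.sumEmpty X Empty)

theorem sum_eq (ψ : St (X ⊕ A)) : sum A ψ = ren (Equiv.sumEmpty X Empty) (app (discard A) ψ) := by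
  rw [ren_equiv]; rfl

theorem ren_sum (f : X → Y) (ψ : St (X ⊕ A)) : ren f (sum A ψ) = sum A (ren (Sum.map f id) ψ) := by
  rw [sum_eq, sum_eq, ← ren_app, ren_ren, ren_ren]
  apply ren_congr
  rintro (x | x)
  · rfl
  · exact x.elim

/-- Distributivity, for a factor that does not involve the summed variables. -/
theorem mul_sum (φ : St X) (ψ : St (X ⊕ A)) : φ * sum A ψ = sum A (ren Sum.inl φ * ψ) := by
  rw [sum_eq, sum_eq, ← mul_app, map_mul, ren_ren]
  congr 1
  exact (ren_id' _ (fun x => rfl) _).symm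

theorem W_discard (e : A ≃ B) : W e ≫ₘ discard B = discard A := by
  have h := congrArg Mor.flip (P_W (Empty.elim : Empty → B) e.symm)
  rw [flip_comp, flip_W] at h
  rw [discard, discard, ← Equiv.symm_symm e, h]
  congr 2
  funext x
  exact x.elim

theorem sum_equiv (e : A ≃ B) (ψ : St (X ⊕ A)) : sum B (ren (Sum.map id e) ψ) = sum A ψ := by
  rw [sum, sum, ← app_W, ← app_comp, W_discard]

theorem discard_sum : discard (A ⊕ B) = (discard A ⊗ₘ discard B) ≫ₘ W (Equiv.emptySum Empty Empty) := by
  have h := congrArg Mor.flip (P_tensor (Empty.elim : Empty → A) (Empty.elim : Empty → B))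
  rw [flip_tensor] at h
  rw [discard, discard, discard, h, ← Equiv.symm_symm (Equiv.emptySum Empty Empty), ← flip_W, ← flip_comp,
    W_P]
  congr 2
  funext x
  exact x.elim

theorem sum_sum (ψ : St ((X ⊕ A) ⊕ B)) :
    sum A (sum B ψ) = sum (A ⊕ B) (ren (Equiv.sumAssoc X A B) ψ) := by
  have h : ident X = W (Equiv.refl X) ≫ₘ ident X ≫ₘ W (Equiv.refl X) := by rw [id_comp, comp_id]
  have h2 : ident (X ⊕ A) = ident X ⊗ₘ ident A := by
    rw [W_tensor]
    exact W_congr fun x => by simp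
  have h3 : ident X ⊗ₘ (discard A ⊗ₘ discard B) = ident X ⊗ₘ (ident A ⊗ₘ discard B) ≫ₘ
      ident X ⊗ₘ (discard A ⊗ₘ ident Empty) := by
    rw [← interchange, ← interchange, id_comp, id_comp, comp_id]
  rw [ren_equiv]
  simp only [sum, app, discard_sum, id_tensor_comp, h3, h2]
  rw [tensor_ident_empty (discard A), h, tensor_W_sandwich, ← h, tensor_assoc_right]
  simp only [comp_assoc, W_tensor, W_comp]
  congr 2
  have h4 : (Equiv.sumAssoc X A Empty).symm.trans (Equiv.sumEmpty (X ⊕ A) Empty) =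
      (Equiv.refl X).sumCongr (Equiv.sumEmpty A Empty) := by
    ext x; rcases x with x | x | x
    · rfl
    · rfl
    · exact x.elim
  have h5 : (((Equiv.refl X).sumCongr (Equiv.sumEmpty Empty Empty).symm).trans
      ((Equiv.refl X).sumCongr (Equiv.emptySum Empty Empty))).trans (Equiv.sumEmpty X Empty) =
      Equiv.sumEmpty X Empty := by
    ext x; rcases x with x | x <;> rfl
  rw [h4, h5]

theorem sum_isEmpty [IsEmpty A] (ψ : St (X ⊕ A)) :
    sum A ψ = ren (Sum.elim id isEmptyElim) ψ := by
  rw [sum_eq, discard, P_isEmpty _ (Equiv.equivOfIsEmpty Empty A), flip_W, app_W, ren_ren]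
  apply ren_congr
  rintro (x | x)
  · rfl
  · exact isEmptyElim x

/-- Exchanging the last two blocks of variables. -/
def rightComm (X A B : Type) : (X ⊕ A) ⊕ B ≃ (X ⊕ B) ⊕ A :=
  (Equiv.sumAssoc X A B).trans
    (((Equiv.refl X).sumCongr (Equiv.sumComm A B)).trans (Equiv.sumAssoc X B A).symm)

@[simp] theorem rightComm_inl_inl (x : X) : rightComm X A B (.inl (.inl x)) = .inl (.inl x) := rfl
@[simp] theorem rightComm_inl_inr (x : A) : rightComm X A B (.inl (.inr x)) = .inr x := rfl
@[simp] theorem rightComm_inr (x : B) : rightComm X A B (.inr x) = .inl (.inr x) := rfl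

/-- A diagram acting on the middle block of variables. -/
theorem app_middle (D : Mor A A') (ψ : St ((X ⊕ A) ⊕ B)) :
    ren (rightComm X B A') (app D (ren (rightComm X A B) ψ)) =
      ψ ≫ₘ ((ident X ⊗ₘ D) ⊗ₘ ident B) := by
  have h2 : ident (X ⊕ B) = ident X ⊗ₘ ident B := by
    rw [W_tensor]
    exact W_congr fun x => by simp
  have h : ident X = W (Equiv.refl X) ≫ₘ ident X ≫ₘ W (Equiv.refl X) := by rw [id_comp, comp_id]
  rw [ren_equiv, ren_equiv, app, h2, tensor_assoc_right, tensor_comm (ident B), h, tensor_W_sandwich,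
    ← h, tensor_assoc_left]
  simp only [comp_assoc, W_comp, W_comp_assoc]
  have h4 : (rightComm X A B).trans ((Equiv.sumAssoc X B A).trans
      (((Equiv.refl X).sumCongr (Equiv.sumComm B A)).trans (Equiv.sumAssoc X A B).symm)) =
        Equiv.refl _ := by
    ext x; rcases x with (x | x) | x <;> rfl
  have h5 : (((Equiv.sumAssoc X A' B).trans ((Equiv.refl X).sumCongr (Equiv.sumComm A' B))).trans
      (Equiv.sumAssoc X B A').symm).trans (rightComm X B A') = Equiv.refl _ := by
    ext x; rcases x with (x | x) | x <;> rfl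
  rw [h4, h5, id_comp, comp_id]

/-- A diagram applied to some outputs commutes with a sum over other variables. -/
theorem app_sum (D : Mor A A') (ψ : St ((X ⊕ A) ⊕ B)) :
    app D (sum B ψ) = sum B (ren (rightComm X B A') (app D (ren (rightComm X A B) ψ))) := by
  rw [app_middle, app, sum, sum, app, app]
  simp only [comp_assoc]
  rw [← comp_assoc (_ ⊗ₘ ident B), ← tensor_eq', tensor_eq (ident X ⊗ₘ D), comp_assoc, tensor_ident_empty,
    comp_assoc, comp_assoc, W_comp, Equiv.symm_trans_self, comp_id]

theorem sum_comm (ψ : St ((X ⊕ A) ⊕ B)) : sum A (sum B ψ) = sum B (sum A (ren (rightComm X A B) ψ)) := by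
  rw [sum_sum, sum_sum, ← sum_equiv (Equiv.sumComm A B), ren_ren, ren_ren]
  congr 1
  apply ren_congr
  rintro ((x | x) | x) <;> rfl

end states

/-! ### Elementary functions and kernels of diagrams -/

section kernels

variable {A B C A' B' X Y Z X' Y' : Type} [Finite A] [Finite B] [Finite C] [Finite A'] [Finite B']
  [Finite X] [Finite Y] [Finite Z] [Finite X'] [Finite Y']

/-- A scalar regarded as a constant function. -/
noncomputable def con : St Empty →* St X := ren Empty.elim

@[simp] theorem ren_con (f : X → Y) (c : St Empty) : ren f (con c) = con c := by
  rw [con, con, ren_ren]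
  exact ren_congr (fun x => x.elim) c

/-- A two-variable function evaluated at the variables `i` and `j`. -/
noncomputable def two (θ : St (Unit ⊕ Unit)) (i j : X) : St X :=
  ren (Sum.elim (fun _ => i) fun _ => j) θ

@[simp] theorem ren_two (f : X → Y) (θ : St (Unit ⊕ Unit)) (i j : X) :
    ren f (two θ i j) = two θ (f i) (f j) := by
  rw [two, two, ren_ren]
  apply ren_congr
  rintro (x | x) <;> rfl

/-- The equality of two variables. -/
noncomputable def dl (i j : X) : St X := two cupM i j

@[simp] theorem ren_dl (f : X → Y) (i j : X) : ren f (dl i j) = dl (f i) (f j) := ren_two f _ i j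

/-- The phase `α` on a variable. -/
noncomputable def ze (α : Real.Angle) (i : X) : St X := ren (fun _ => i) (gr Empty Unit α)

@[simp] theorem ren_ze (f : X → Y) (α : Real.Angle) (i : X) : ren f (ze α i) = ze α (f i) := by
  rw [ze, ze, ren_ren]; rfl

theorem dl_comm (i j : X) : dl i j = dl j i := by
  have h : cupM ≫ₘ W (Equiv.sumComm Unit Unit) = cupM := mor_eq_iff.2 .cup_swap
  rw [← ren_equiv] at h
  rw [dl, two, ← h, ren_ren]
  apply ren_congr
  rintro (x | x) <;> rfl

theorem gr_phase (α β : Real.Angle) : gr A Unit α ≫ₘ gr Unit B β = gr A B (α + β) := by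
  have h := gr_merge A Empty B α β
  rw [tensor_ident_empty, comp_assoc, comp_assoc, W_gr, W_comp_eq, W_gr] at h
  exact h

theorem discard_unit : discard Unit = gr Unit Empty 0 := by
  rw [discard, P_unit, flip_gr]

theorem ze_mul (α β : Real.Angle) (i : X) : ze α i * ze β i = ze (α + β) i := by
  rw [ze, ze, ze, ← map_mul]
  congr 1
  rw [mul_def, P_unit, ext, comp_assoc, tensor_eq, comp_assoc, gr_merge, ident_empty_tensor]
  simp only [comp_assoc, W_comp_assoc, W_gr]
  rw [gr_phase, W_gr, add_zero, add_comm]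

theorem ze_zero (i : X) : ze 0 i = 1 := by
  rw [ze, ← P_unit Empty.elim, ← one_def, map_one]

/-- The diagonal function is neutral for summation, when the free variable is fresh. -/
theorem sum_delta_fresh (ψ : St (X ⊕ Unit)) :
    sum Unit (ren (Sum.map Sum.inl id) ψ * dl (.inl (.inr ())) (.inr ()) : St ((X ⊕ Unit) ⊕ Unit)) = ψ := by
  let sh : (X ⊕ Unit) ⊕ (Unit ⊕ Unit) ≃ (X ⊕ Unit) ⊕ (Unit ⊕ Unit) :=
    { toFun := Sum.elim (Sum.elim (fun x => .inl (.inl x)) (fun _ => .inr (.inr ())))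
        (Sum.elim (fun _ => .inl (.inr ())) (fun _ => .inr (.inl ())))
      invFun := Sum.elim (Sum.elim (fun x => .inl (.inl x)) (fun _ => .inr (.inl ())))
        (Sum.elim (fun _ => .inr (.inr ())) (fun _ => .inl (.inr ())))
      left_inv := by rintro ((x | x) | (x | x)) <;> rfl
      right_inv := by rintro ((x | x) | (x | x)) <;> rfl }
  have h1 : ren (Sum.map Sum.inl id) ψ * dl (.inl (.inr ())) (.inr ()) =
      ext ψ cupM ≫ₘ W sh ≫ₘ (ident (X ⊕ Unit) ⊗ₘ gr (Unit ⊕ Unit) Unit 0) := by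
    rw [dl, two, mul_def, ren_def, ren_def, ext_comp, P_tensor, comp_assoc, P_comp,
      ← P_unit (fun _ => ()), ident_eq_P, P_tensor, W_P]
    congr 2
    funext x
    rcases x with (x | x) | (x | x) <;> rfl
  have h2 : gr (Unit ⊕ Unit) Unit 0 ≫ₘ discard Unit = capM := by
    rw [discard_unit, gr_phase, add_zero, gr_cap]
  have h3 : ext ψ cupM = ψ ≫ₘ W (Equiv.sumEmpty (X ⊕ Unit) Empty).symm ≫ₘ
      (ident (X ⊕ Unit) ⊗ₘ cupM) := by
    rw [← id_comp cupM, ext_comp_right, ext_ident, id_comp, comp_assoc]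
  have h4 : ident (X ⊕ Unit) = ident X ⊗ₘ ident Unit := by
    rw [W_tensor]
    exact W_congr fun x => by simp
  have h5 : ident X = W (Equiv.refl X) ≫ₘ ident X ≫ₘ W (Equiv.refl X) := by rw [id_comp, comp_id]
  rw [sum, app, h1]
  simp only [comp_assoc]
  rw [← comp_assoc (_ ⊗ₘ _) (_ ⊗ₘ _), ← interchange, h2, id_comp, h3]
  conv_rhs => rw [← comp_id ψ, h4, ← snake]
  simp only [id_tensor_comp]
  rw [tensor_comm cupM, h5, tensor_W_sandwich, ← h5, tensor_assoc_left, tensor_assoc_left, ← h4]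
  simp only [comp_assoc, W_tensor, W_comp, W_comp_assoc]
  congr 1
  refine congrArg₂ _ (W_congr ?_) (congrArg₂ _ rfl (congrArg₂ _ (W_congr ?_) (congrArg₂ _ rfl (W_congr ?_))))
  · rintro (x | x) <;> rfl
  · rintro ((x | x) | (x | x)) <;> rfl
  · rintro ((x | x) | x)
    · rfl
    · rfl
    · exact x.elim

/-- The delta function of a summed variable substitutes for it. -/
theorem sum_delta (x : X) (ψ : St (X ⊕ Unit)) :
    sum Unit (ψ * dl (.inl x) (.inr ())) = ren (Sum.elim id fun _ => x) ψ := by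
  have h := congrArg (ren (Sum.elim id fun _ => x)) (sum_delta_fresh ψ)
  rw [ren_sum, map_mul, ren_ren, ren_dl] at h
  rw [← h]
  congr 2
  refine (ren_id' _ ?_ ψ).symm
  rintro (x | x) <;> rfl

/-- Induction on finite types by adding one point at a time. -/
theorem finite_induction {p : (A : Type) → [Finite A] → Prop}
    (equiv : ∀ (A B : Type) [Finite A] [Finite B], (A ≃ B) → p A → p B) (empty : p Empty)
    (step : ∀ (A : Type) [Finite A], p A → p (A ⊕ Unit)) (A : Type) [h : Finite A] : p A := by
  obtain ⟨n, ⟨e⟩⟩ := Finite.exists_equiv_fin A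
  suffices h : p (Fin n) from equiv _ _ e.symm h
  clear e
  induction n with
  | zero => exact equiv _ _ (Equiv.equivOfIsEmpty Empty (Fin 0)) empty
  | succ n ih => exact equiv _ _ ((Equiv.sumComm _ _).trans (insertFin 0)) (step _ ih)

/-- Summation against equality of the summed variables with given ones is substitution. -/
theorem sum_delta_all [h : Fintype A] (f : A → X) (ψ : St (X ⊕ A)) :
    sum A (ψ * ∏ a, dl (.inl (f a)) (.inr a)) = ren (Sum.elim id f) ψ := by
  have key : ∀ (A : Type) [Finite A], ∀ [Fintype A], ∀ (X : Type) [Finite X] (f : A → X) (ψ : St (X ⊕ A)),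
    sum A (ψ * ∏ a, dl (.inl (f a)) (.inr a)) = ren (Sum.elim id f) ψ := by
    refine finite_induction ?_ ?_ ?_
    · intro A B _ _ e ih _ X _ f ψ
      let _ := Fintype.ofEquiv B e.symm
      have h := ih X (f ∘ e) (ren (Sum.map id e.symm) ψ)
      rw [← sum_equiv e, map_mul, ren_ren, map_prod, ren_ren] at h
      refine Eq.trans ?_ (h.trans ?_)
      · congr 2
        · exact (ren_id' _ (by rintro (x | x) <;> simp) ψ).symm
        · exact (Fintype.prod_equiv e _ _ fun a => by simp).symm
      · apply ren_congr
        rintro (x | x) <;> simp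
    · intro _ X _ f ψ
      rw [sum_isEmpty, Finset.univ_eq_empty, Finset.prod_empty, mul_one]
      apply ren_congr
      rintro (x | x)
      · rfl
      · exact x.elim
    · intro A _ ih i1 X _ f ψ
      let _ := Fintype.ofFinite A
      have h := ih X (f ∘ Sum.inl) (ren (Sum.elim id fun _ => .inl (f (.inr ())))
        (ren (Equiv.sumAssoc X A Unit).symm ψ))
      have h1 := sum_delta (Sum.inl (f (.inr ())) : X ⊕ A) (ren (Equiv.sumAssoc X A Unit).symm ψ)
      rw [← h1, mul_comm, mul_sum, sum_sum, h1] at h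
      simp only [map_mul, map_prod, ren_ren, ren_dl] at h
      refine Eq.trans ?_ (h.trans ?_)
      · congr 1
        obtain rfl : i1 = instFintypeSum A Unit := Subsingleton.elim _ _
        rw [Fintype.prod_sum_type, mul_comm (∏ _, _), ← mul_assoc, mul_comm]
        simp
      · apply ren_congr
        rintro (x | x | x) <;> rfl
  exact key A X f ψ

/-- Equality of the variables in `A` with those of a second copy, the kernel of parallel wires. -/
noncomputable def diag (A : Type) [Finite A] : St (A ⊕ A) :=
  let _ := Fintype.ofFinite A
  ∏ a : A, dl (.inl a) (.inr a)

theorem diag_eq (A : Type) [Fintype A] : diag A = ∏ a : A, dl (.inl a) (.inr a) := by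
  rw [diag]
  congr!

/-- The kernel of a diagram: the state obtained by bending its inputs. -/
noncomputable def K (D : Mor A B) : St (A ⊕ B) := app D (diag A)

/-- The diagonal is the unit for composition of kernels. -/
theorem sum_diag (ψ : St (X ⊕ A)) :
    sum A (ren (Sum.map Sum.inl id) ψ * ren (Sum.map Sum.inr id) (diag A) : St ((X ⊕ A) ⊕ A)) = ψ := by
  let _ := Fintype.ofFinite A
  have h := sum_delta_all Sum.inr (ren (Sum.map Sum.inl id) ψ : St ((X ⊕ A) ⊕ A))
  rw [ren_ren] at h
  rw [diag_eq, map_prod]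
  simp only [ren_dl, Sum.map_inl, Sum.map_inr, id]
  rw [h]
  exact ren_id' _ (by rintro (x | x) <;> rfl) ψ

theorem ren_swap_diag : ren Sum.swap (diag A) = diag A := by
  let _ := Fintype.ofFinite A
  rw [diag_eq, map_prod]
  exact Finset.prod_congr rfl fun a _ => by rw [ren_dl]; exact dl_comm _ _

/-- A diagram acts by summation against its kernel. -/
theorem app_eq (D : Mor A B) (ψ : St (X ⊕ A)) :
    app D ψ = sum A (ren (Sum.map Sum.inl id) ψ * ren (Sum.elim Sum.inr (Sum.inl ∘ Sum.inr)) (K D)) := by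
  have h : app D (ren Sum.inl ψ * ren (Sum.map Sum.inr id) (diag A)) =
      ren Sum.inl ψ * ren (Sum.map Sum.inr id) (K D) := by
    rw [← mul_app, ← ren_app, K]
  have h1 : ren (rightComm X A A) (ren (Sum.map Sum.inl id) ψ) = (ren Sum.inl ψ : St ((X ⊕ A) ⊕ A)) := by
    rw [ren_ren]
    apply ren_congr
    rintro (x | x) <;> rfl
  have h2 : ren (rightComm X A A) (ren (Sum.map Sum.inr id) (diag A)) =
      ren (Sum.map Sum.inr id) (diag A) := by
    conv_rhs => rw [← ren_swap_diag]
    rw [ren_ren, ren_ren]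
    apply ren_congr
    rintro (x | x) <;> rfl
  conv_lhs => rw [← sum_diag ψ, app_sum, map_mul, h1, h2, h, map_mul, ren_ren, ren_ren]
  congr 2
  · apply ren_congr
    rintro (x | x) <;> rfl
  · apply ren_congr
    rintro (x | x) <;> rfl

theorem K_comp_app (D : Mor A B) (E : Mor B C) : K (D ≫ₘ E) = app E (K D) := by
  rw [K, app_comp, K]

/-- Composition of diagrams is composition of kernels. -/
theorem K_comp (D : Mor A B) (E : Mor B C) : K (D ≫ₘ E) =
    sum B (ren (Sum.map Sum.inl id) (K D) * ren (Sum.elim Sum.inr (Sum.inl ∘ Sum.inr)) (K E)) := by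
  rw [K_comp_app, app_eq]

theorem K_P (f : A → B) [Fintype A] : K (P f) = ∏ a, dl (.inl a) (.inr (f a)) := by
  rw [K, app_P, diag_eq, map_prod]
  exact Finset.prod_congr rfl fun a _ => by rw [ren_dl]; rfl

theorem K_W (e : A ≃ B) [Fintype A] : K (W e) = ∏ a, dl (.inl a) (.inr (e a)) := by
  rw [← P_equiv, K_P]

theorem K_ident : K (ident A) = diag A := by
  rw [K, app_W]
  exact ren_id' _ (by rintro (x | x) <;> rfl) _

theorem K_comp_W (D : Mor A B) (e : B ≃ C) : K (D ≫ₘ W e) = ren (Sum.map id e) (K D) := by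
  rw [K_comp_app, app_W]

theorem K_W_comp (e : A ≃ B) (D : Mor B C) : K (W e ≫ₘ D) = ren (Sum.map e.symm id) (K D) := by
  let _ := Fintype.ofFinite A
  let _ := Fintype.ofFinite B
  rw [K, app_comp, app_W, K, ren_app]
  congr 1
  rw [diag_eq, diag_eq, map_prod, map_prod]
  exact Fintype.prod_equiv e _ _ fun a => by simp

theorem K_state (ψ : St X) : K ψ = ren Sum.inr ψ := by
  have h : diag Empty = W (Equiv.emptySum Empty Empty).symm := by
    rw [diag_eq, Finset.univ_eq_empty, Finset.prod_empty, one_def, ← P_equiv]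
    exact congrArg P (funext fun x => x.elim)
  have h1 : (Sum.inr : X → Empty ⊕ X) = (Equiv.emptySum Empty X).symm := rfl
  rw [K, h, app, ident_empty_tensor, W_comp_assoc, Equiv.symm_trans_self, id_comp, h1, ren_equiv]

theorem app_ident_tensor (E : Mor A B) (ψ : St (X ⊕ (A' ⊕ A))) : app (ident A' ⊗ₘ E) ψ =
    ren (Equiv.sumAssoc X A' B) (app E (ren (Equiv.sumAssoc X A' A).symm ψ)) := by
  have h4 : ident (X ⊕ A') = ident X ⊗ₘ ident A' := by
    rw [W_tensor]
    exact W_congr fun x => by simp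
  rw [ren_equiv, ren_equiv, app, app, tensor_assoc_left, h4]
  simp only [comp_assoc]

theorem app_tensor_ident (D : Mor A B) (ψ : St (X ⊕ (A ⊕ A'))) : app (D ⊗ₘ ident A') ψ =
    ren ((Equiv.sumAssoc X A' B).trans ((Equiv.refl X).sumCongr (Equiv.sumComm A' B)))
      (app D (ren ((Equiv.sumAssoc X A A').symm.trans (rightComm X A A')) ψ)) := by
  rw [tensor_comm, app_comp, app_comp, app_W, app_W, app_ident_tensor, ren_ren, ren_ren]
  congr 1
  congr 1
  apply ren_congr
  rintro (x | (x | x)) <;> rfl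

theorem K_tensor (D : Mor A B) (E : Mor A' B') : K (D ⊗ₘ E) =
    ren (Sum.map Sum.inl Sum.inl) (K D) * ren (Sum.map Sum.inr Sum.inr) (K E) := by
  let _ := Fintype.ofFinite A
  let _ := Fintype.ofFinite A'
  have h0 : diag (A ⊕ A') =
      ren (Sum.map Sum.inl Sum.inl) (diag A) * ren (Sum.map Sum.inr Sum.inr) (diag A') := by
    rw [diag_eq, diag_eq, diag_eq, Fintype.prod_sum_type, map_prod, map_prod]
    simp
  have h1 : app (D ⊗ₘ ident A') (diag (A ⊕ A')) =
      ren (Sum.map Sum.inl Sum.inl) (K D) * ren (Sum.map Sum.inr Sum.inr) (diag A') := by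
    rw [app_tensor_ident, h0, map_mul, ren_ren, ren_ren]
    have h2 : ren (((Equiv.sumAssoc (A ⊕ A') A A').symm.trans (rightComm (A ⊕ A') A A')) ∘
        Sum.map Sum.inr Sum.inr) (diag A') =
        (ren Sum.inl (ren (Sum.map Sum.inr id) (diag A')) : St (((A ⊕ A') ⊕ A') ⊕ A)) := by
      rw [ren_ren]
      apply ren_congr
      rintro (x | x) <;> rfl
    have h3 : ren (((Equiv.sumAssoc (A ⊕ A') A A').symm.trans (rightComm (A ⊕ A') A A')) ∘
        Sum.map Sum.inl Sum.inl) (diag A) =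
        ren (Sum.map (Sum.inl ∘ Sum.inl) id : A ⊕ A → ((A ⊕ A') ⊕ A') ⊕ A) (diag A) := by
      apply ren_congr
      rintro (x | x) <;> rfl
    rw [h2, h3, mul_comm, ← mul_app, ← ren_app, map_mul, ren_ren, ren_ren, ren_ren, mul_comm]
    congr 1
    · apply ren_congr
      rintro (x | x) <;> rfl
    · apply ren_congr
      rintro (x | x) <;> rfl
  rw [K, tensor_eq', app_comp, h1, app_ident_tensor, map_mul, ren_ren, ren_ren]
  have h2 : ren ((Equiv.sumAssoc (A ⊕ A') B A').symm ∘ Sum.map Sum.inl Sum.inl) (K D) =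
      (ren Sum.inl (ren (Sum.map Sum.inl id) (K D)) : St (((A ⊕ A') ⊕ B) ⊕ A')) := by
    rw [ren_ren]
    apply ren_congr
    rintro (x | x) <;> rfl
  have h3 : ren ((Equiv.sumAssoc (A ⊕ A') B A').symm ∘ Sum.map Sum.inr Sum.inr) (diag A') =
      ren (Sum.map (Sum.inl ∘ Sum.inr) id : A' ⊕ A' → ((A ⊕ A') ⊕ B) ⊕ A') (diag A') := by
    apply ren_congr
    rintro (x | x) <;> rfl
  rw [h2, h3, ← mul_app, ← ren_app, map_mul, ren_ren, ren_ren, ren_ren]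
  congr 1
  · apply ren_congr
    rintro (x | x) <;> rfl
  · apply ren_congr
    rintro (x | x) <;> rfl

/-- A scalar multiplies a kernel. -/
theorem K_scale (s : Diagram Empty Empty) (D : Diagram A B) :
    K (scale s D).mor = con s.mor * K D.mor := by
  have h : (scale s D).mor = W (Equiv.emptySum Empty A).symm ≫ₘ
    ((s.mor ⊗ₘ D.mor) ≫ₘ W (Equiv.emptySum Empty B)) := by
    rw [scale, mor_comp, mor_comp, comp_assoc]; rfl
  rw [h, K_W_comp, K_comp_W, K_tensor, K_state]
  simp only [map_mul, ren_ren]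
  congr 1
  · rw [con]
    apply ren_congr
    exact fun x => x.elim
  · apply ren_id'
    rintro (x | x) <;> rfl

end kernels

/-! ### Kernels of the generators -/

section generators

variable {A B C A' B' X Y Z X' Y' : Type} [Finite A] [Finite B] [Finite C] [Finite A'] [Finite B']
  [Finite X] [Finite Y] [Finite Z] [Finite X'] [Finite Y']

theorem diag_unit : diag Unit = dl (.inl ()) (.inr ()) := by
  rw [diag_eq]; simp

theorem sum_delta' (x : X) (ψ : St (X ⊕ Unit)) :
    sum Unit (ψ * dl (.inr ()) (.inl x)) = ren (Sum.elim id fun _ => x) ψ := by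
  rw [dl_comm, sum_delta]

theorem sum_dl (x : X) : sum Unit (dl (.inl x) (.inr ()) : St (X ⊕ Unit)) = 1 := by
  rw [← one_mul (dl _ _), sum_delta, map_one]

theorem dl_mul_dl_aux : K (gr Unit (Unit ⊕ Unit) 0) =
    dl (.inr (.inl ())) (.inr (.inr ())) * dl (.inl ()) (.inr (.inr ())) := by
  have h := gr_fuse Empty Unit Unit Unit 0 0
  rw [add_zero, gr_cup, ← P_unit (fun _ => ()), ident_eq_P, P_tensor] at h
  rw [← W_gr (Equiv.emptySum Empty Unit).symm, ← h, K_W_comp, K_comp_app, app_comp, app_P, app_W, K_tensor,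
    K_state, ← ident_eq_P, K_ident, diag_unit]
  simp only [map_mul, ren_ren, ren_dl]
  congr 1
  rw [dl, two]
  apply ren_congr
  rintro (x | x) <;> rfl

/-- Transitivity of equality. -/
theorem dl_mul_dl (i j k : X) : dl i k * dl j k = dl i j * dl j k := by
  have h := dl_mul_dl_aux
  have h1 := congrArg (ren (Sum.map id (Equiv.sumComm Unit Unit))) h
  rw [← K_comp_W, gr_W, h] at h1
  have h2 := congrArg (ren (Sum.elim (fun _ => i) (Sum.elim (fun _ => j) fun _ => k))) h1
  simp only [map_mul, ren_dl] at h2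
  simp at h2
  rw [mul_comm, h2, dl_comm k j, mul_comm]

/-- The kernel of the green spider that copies its input. -/
theorem K_copy : K (gr Unit (Unit ⊕ Unit) 0) =
    dl (.inl ()) (.inr (.inl ())) * dl (.inl ()) (.inr (.inr ())) := by
  rw [dl_mul_dl_aux, dl_mul_dl, dl_comm (Sum.inr (Sum.inl ())) (Sum.inl ())]

theorem gr_effect_merge (α : Real.Angle) : (ident Unit ⊗ₘ gr Empty Unit α) ≫ₘ gr (Unit ⊕ Unit) Unit 0 =
    gr (Unit ⊕ Empty) Unit α := by
  rw [tensor_comm, comp_assoc, comp_assoc, W_gr, gr_merge, W_gr, add_zero]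

theorem app_phase (α : Real.Angle) (ψ : St (X ⊕ Unit)) : app (gr Unit Unit α) ψ = ψ * ze α (.inr ()) := by
  have h4 : ident (X ⊕ Unit) = ident X ⊗ₘ ident Unit := by
    rw [W_tensor]
    exact W_congr fun x => by simp
  have h1 : ψ * ze α (.inr ()) = ext ψ (gr Empty Unit α) ≫ₘ W (Equiv.sumAssoc X Unit Unit) ≫ₘ
      (ident X ⊗ₘ gr (Unit ⊕ Unit) Unit 0) := by
    rw [ze, ren_def, mul_def, ext_comp_right, comp_assoc, ident_eq_P, P_tensor, P_comp,
      ident_eq_P, ← P_unit (fun _ => ()), P_tensor, W_P]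
    congr 2
    funext x
    rcases x with (x | x) | x <;> rfl
  have h3 : ext ψ (gr Empty Unit α) = ψ ≫ₘ W (Equiv.sumEmpty (X ⊕ Unit) Empty).symm ≫ₘ
      (ident (X ⊕ Unit) ⊗ₘ gr Empty Unit α) := by
    rw [← id_comp (gr Empty Unit α), ext_comp_right, ext_ident, id_comp, comp_assoc]
  have h5 : ident X = W (Equiv.refl X) ≫ₘ ident X := by rw [id_comp]
  rw [h1, h3, h4, tensor_assoc_right]
  simp only [comp_assoc, W_comp_assoc, Equiv.symm_trans_self, id_comp]
  rw [← interchange, id_comp, gr_effect_merge, ← W_gr (Equiv.sumEmpty Unit Empty), h5, interchange,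
    W_tensor, W_comp_assoc, app]
  congr 1
  have h6 : (((Equiv.sumEmpty (X ⊕ Unit) Empty).symm.trans (Equiv.sumAssoc X Unit Empty)).trans
      ((Equiv.refl X).sumCongr (Equiv.sumEmpty Unit Empty))) = Equiv.refl _ := by
    ext x
    rcases x with x | x <;> rfl
  rw [h6, id_comp]

theorem app_discard (ψ : St (X ⊕ A)) : app (discard A) ψ = ren Sum.inl (sum A ψ) := by
  rw [sum_eq, ren_ren, eq_comm]
  apply ren_id'
  rintro (x | x)
  · rfl
  · exact x.elim

theorem K_spread [Fintype B] : K (gr Unit B 0) = ∏ b, dl (.inl ()) (.inr b) := by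
  have key : ∀ (B : Type) [Finite B], ∀ [Fintype B],
      K (gr Unit B 0) = ∏ b, dl (.inl ()) (.inr b) := by
    refine finite_induction ?_ ?_ ?_
    · intro A B _ _ e ih _
      let _ := Fintype.ofEquiv B e.symm
      rw [← gr_W e, K_comp_W, ih, map_prod]
      exact Fintype.prod_equiv e _ _ fun a => by simp
    · intro _
      rw [Finset.univ_eq_empty, Finset.prod_empty, ← discard_unit, K, app_discard, diag_unit, sum_dl,
        map_one]
    · intro A _ ih i1
      let _ := Fintype.ofFinite A
      obtain rfl : i1 = instFintypeSum A Unit := Subsingleton.elim _ _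
      have h := congrArg Mor.flip (gr_merge A Unit Unit 0 0)
      rw [flip_comp, flip_tensor, flip_gr, flip_gr, flip_gr, flip_W, add_zero, Equiv.refl_symm] at h
      have h1 := sum_delta_all (X := Unit ⊕ (A ⊕ Unit)) (A := Unit ⊕ Unit) (fun _ => .inl ())
        (ren (Sum.elim Sum.inr (Sum.inl ∘ Sum.inr)) (K (gr Unit A 0 ⊗ₘ ident Unit)))
      rw [← h, K_comp, K_copy]
      simp only [map_mul, ren_dl, Fintype.prod_sum_type, Finset.univ_unique, Finset.prod_singleton] at h1 ⊢
      rw [mul_comm]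
      refine h1.trans ?_
      rw [K_tensor, K_ident, diag_unit, ih]
      simp
  exact key B

/-- A green spider forces all its legs to be equal to one variable, which carries its phase. -/
theorem K_gr [Fintype A] [Fintype B] (α : Real.Angle) : K (gr A B α) =
    sum Unit (ze α (.inr ()) * (∏ a, dl (.inl (.inl a)) (.inr ())) *
      ∏ b, dl (.inr ()) (.inl (.inr b))) := by
  have h : gr A B α = (gr A Unit 0 ≫ₘ gr Unit Unit α) ≫ₘ gr Unit B 0 := by
    rw [gr_phase, gr_phase, zero_add, add_zero]
  rw [h, K_comp, K_spread, K_comp_app, app_phase, ← P_unit (fun _ => ()), K_P]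
  simp only [map_mul, map_prod, ren_dl, ren_ze]
  congr 2
  exact mul_comm _ _

theorem gr_loop (A B : Type) [Finite A] [Finite B] (α : Real.Angle) :
    gr A (B ⊕ (Unit ⊕ Unit)) α ≫ₘ (ident B ⊗ₘ capM) ≫ₘ W (Equiv.sumEmpty B Empty) = gr A B α := by
  have h := mor_eq_iff.2 (.rule (.loop A B α))
  simp only [mor_comp, comp_assoc] at h
  exact h

theorem capM_eq : capM = P (fun _ => () : Unit ⊕ Unit → Unit) ≫ₘ discard Unit := by
  rw [P_unit, discard_unit, gr_phase, add_zero, gr_cap]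

/-- Reflexivity of equality, from the loop rule. -/
theorem dl_self (i : X) : dl i i = 1 := by
  have h := congrArg K (gr_loop Empty Unit 0)
  rw [K_comp_app, app_comp, app_W, capM_eq, id_tensor_comp, app_comp, ident_eq_P, P_tensor, app_P,
    ← ident_eq_P, app_ident_tensor, app_discard, K_gr, K_gr] at h
  simp only [map_mul, ren_dl, ze_zero, ren_sum, Finset.univ_eq_empty,
    Finset.prod_empty, Finset.univ_unique, Finset.prod_singleton, Fintype.prod_sum_type, mul_one, one_mul] at h
  simp only [Sum.map_inr, Sum.map_inl, id, Equiv.sumAssoc_symm_apply_inr_inr,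
    Equiv.sumAssoc_symm_apply_inr_inl, Equiv.sumAssoc_apply_inl_inr, Equiv.sumEmpty_apply_inl] at h
  rw [mul_comm (dl _ _), sum_delta', map_mul, ren_dl] at h
  simp only [Sum.elim_inl, Sum.elim_inr, id] at h
  rw [sum_delta, dl_comm (Sum.inr ()) (Sum.inl _), sum_dl, ren_dl] at h
  simp only [Sum.elim_inl, Sum.elim_inr, id] at h
  have h2 := congrArg (ren (Sum.elim Empty.elim fun _ => i)) h
  rw [ren_dl, map_one] at h2
  exact h2

theorem K_cup : K cupM = dl (.inr (.inl ())) (.inr (.inr ())) := by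
  rw [K_state, dl, two]
  apply ren_congr
  rintro (x | x) <;> rfl

theorem K_cap : K capM = dl (.inl (.inl ())) (.inl (.inr ())) := by
  rw [capM_eq, K_comp_app, app_discard, K_P]
  simp only [Fintype.prod_sum_type, Finset.univ_unique, Finset.prod_singleton, PUnit.default_eq_unit]
  rw [sum_delta]
  simp

end generators

/-! ### Hadamard nodes and red spiders -/

section hadamard

variable {A B C A' B' X Y Z X' Y' : Type} [Finite A] [Finite B] [Finite C] [Finite A'] [Finite B']
  [Finite X] [Finite Y] [Finite Z] [Finite X'] [Finite Y']

/-- The kernel of the Hadamard node, evaluated at two variables. -/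
noncomputable def hh (i j : X) : St X := two (K hadM) i j

@[simp] theorem ren_hh (f : X → Y) (i j : X) : ren f (hh i j) = hh (f i) (f j) := ren_two f _ i j

theorem K_had : K hadM = hh (.inl ()) (.inr ()) := by
  rw [hh, two, eq_comm]
  apply ren_id'
  rintro (x | x) <;> rfl

theorem K_finTensor {n : ℕ} {A B : Fin n → Type} [∀ i, Finite (A i)] [∀ i, Finite (B i)]
    (D : ∀ i, Diagram (A i) (B i)) : K (finTensor D).mor =
      ∏ i, ren (Sum.map (fun a => (⟨i, a⟩ : Σ i, A i)) (fun b => (⟨i, b⟩ : Σ i, B i))) (K (D i).mor) := by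
  induction n with
  | zero =>
    have := Fintype.ofFinite (Σ i, A i)
    have := K_W (Equiv.equivOfIsEmpty (Σ i, A i) (Σ i, B i))
    rw [Finset.univ_eq_empty, Finset.prod_empty] at this ⊢
    exact this
  | succ n ih =>
    have h : (finTensor D).mor = (W (sigmaFinSucc A) ≫ₘ ((D 0).mor ⊗ₘ (finTensor fun i => D i.succ).mor)) ≫ₘ
      W (sigmaFinSucc B).symm := rfl
    rw [h, K_comp_W, K_W_comp, K_tensor, ih, Fin.prod_univ_succ]
    simp only [map_mul, map_prod, ren_ren]
    congr 1
    · apply ren_congr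
      rintro (x | x) <;> rfl
    · apply Finset.prod_congr rfl
      intro i _
      apply ren_congr
      rintro (x | x) <;> rfl

theorem K_onEach {n : ℕ} (U : Fin n → Diagram Unit Unit) : K (onEach U).mor =
    ∏ i, ren (Sum.map (fun _ => i) (fun _ => i)) (K (U i).mor) := by
  have h : (onEach U).mor = (W (Equiv.sigmaUnique (Fin n) fun _ => Unit).symm ≫ₘ (finTensor U).mor) ≫ₘ
    W (Equiv.sigmaUnique (Fin n) fun _ => Unit) := rfl
  rw [h, K_comp_W, K_W_comp, K_finTensor]
  simp only [map_prod, ren_ren]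
  apply Finset.prod_congr rfl
  intro i _
  apply ren_congr
  rintro (x | x) <;> rfl

theorem W_rd (e : A ≃ A') (α : Real.Angle) : W e ≫ₘ rd A' B α = rd A B α := by
  have := congrArg Mor.swap (W_gr (B := B) e α)
  rwa [swap_comp] at this

theorem rd_W (e : B ≃ B') (α : Real.Angle) : rd A B α ≫ₘ W e = rd A B' α := by
  have := congrArg Mor.swap (gr_W (A := A) e α)
  rwa [swap_comp] at this

/-- The kernel of a red spider with numbered legs, from the colour change rule. -/
theorem K_rd_fin (n m : ℕ) (α : Real.Angle) : K (rd (Fin n) (Fin m) α) =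
    sum Unit (ze α (.inr ()) * (∏ a, hh (.inl (.inl a)) (.inr ())) *
      ∏ b, hh (.inr ()) (.inl (.inr b))) := by
  have h : ((onEach fun _ : Fin n => had).mor ≫ₘ gr (Fin n) (Fin m) α) ≫ₘ (onEach fun _ : Fin m => had).mor =
    rd (Fin n) (Fin m) α := mor_eq_iff.2 (.rule (.colour n m α))
  have hK : ∀ n : ℕ, K (onEach fun _ : Fin n => had).mor = ∏ i : Fin n, hh (.inl i) (.inr i) := by
    intro n
    rw [K_onEach]
    exact Finset.prod_congr rfl fun i _ => by
      rw [show had.mor = hadM from rfl, K_had, ren_hh]; rfl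
  have h1 : K ((onEach fun _ : Fin n => had).mor ≫ₘ gr (Fin n) (Fin m) α) =
      sum Unit (ze α (.inr ()) * (∏ a, hh (.inl (.inl a)) (.inr ())) *
        ∏ b, dl (.inr ()) (.inl (.inr b))) := by
    rw [K_comp, hK, K_gr, ren_sum, mul_sum, sum_comm]
    have h2 := sum_delta_all (A := Fin n) (X := (Fin n ⊕ Fin m) ⊕ Unit) (fun _ => .inr ())
      (ze α (.inl (.inr ())) * (∏ a, hh (.inl (.inl (.inl a))) (.inr a)) *
        ∏ b, dl (.inl (.inr ())) (.inl (.inl (.inr b))))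
    congr 1
    refine Eq.trans ?_ (h2.trans ?_)
    · simp only [map_mul, map_prod, ren_dl, ren_ze, ren_hh, Sum.map_inl, Sum.map_inr, Sum.elim_inl,
        Sum.elim_inr, Function.comp, rightComm_inl_inl, rightComm_inl_inr, rightComm_inr, id,
        dl_comm (Sum.inr _) (Sum.inl (Sum.inr ()))]
      congr 1
      ac_rfl
    · simp only [map_mul, map_prod, ren_dl, ren_ze, ren_hh, Sum.elim_inl, Sum.elim_inr, id]
  have h2 := sum_delta_all (A := Fin m) (X := (Fin n ⊕ Fin m) ⊕ Unit) (fun _ => .inr ())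
    (ze α (.inl (.inr ())) * (∏ a, hh (.inl (.inl (.inl a))) (.inl (.inr ()))) *
      ∏ b, hh (.inr b) (.inl (.inl (.inr b))))
  rw [← h, K_comp, hK, h1, ren_sum, mul_comm, mul_sum, sum_comm]
  congr 1
  refine Eq.trans ?_ (h2.trans ?_)
  · simp only [map_mul, map_prod, ren_dl, ren_ze, ren_hh, Sum.map_inl, Sum.map_inr, Sum.elim_inl,
      Sum.elim_inr, Function.comp, rightComm_inl_inl, rightComm_inl_inr, rightComm_inr, id]
    congr 1
    ac_rfl
  · simp only [map_mul, map_prod, ren_ze, ren_hh, Sum.elim_inl, Sum.elim_inr, id]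

/-- A red spider is a green spider with Hadamard nodes on its legs. -/
theorem K_rd [Fintype A] [Fintype B] (α : Real.Angle) : K (rd A B α) =
    sum Unit (ze α (.inr ()) * (∏ a, hh (.inl (.inl a)) (.inr ())) *
      ∏ b, hh (.inr ()) (.inl (.inr b))) := by
  have e := Finite.equivFin A
  have e' := Finite.equivFin B
  rw [← W_rd e, ← rd_W e'.symm, K_W_comp, K_comp_W, K_rd_fin, ren_ren, ren_sum]
  simp only [map_mul, map_prod, ren_ze, ren_hh]
  congr 2
  · congr 1
    exact Fintype.prod_equiv e.symm _ _ fun _ => rfl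
  · exact Fintype.prod_equiv e'.symm _ _ fun _ => rfl

theorem rd_unit : rd Unit Unit 0 = ident Unit := by
  have := congrArg Mor.swap gr_unit
  rwa [swap_gr, swap_W] at this

theorem rd_cup : rd Empty (Unit ⊕ Unit) 0 = cupM := congrArg Mor.swap gr_cup

/-- The Hadamard node is an involution. -/
theorem sum_hh_hh_aux (i j : X) : sum Unit (hh (.inl i) (.inr ()) * hh (.inr ()) (.inl j)) = dl i j := by
  have h := K_rd (A := Unit) (B := Unit) 0
  rw [rd_unit, K_ident, diag_unit] at h
  have h1 := congrArg (ren (Sum.elim (fun _ => i) fun _ => j)) h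
  rw [ren_dl, ren_sum] at h1
  simpa [ze_zero] using h1.symm

/-- The transpose of the Hadamard kernel is a right inverse, since a red cup is a bent wire. -/
theorem sum_hh_hh_aux' (i j : X) : sum Unit (hh (.inr ()) (.inl i) * hh (.inr ()) (.inl j)) = dl i j := by
  have h := K_rd (A := Empty) (B := Unit ⊕ Unit) 0
  rw [rd_cup, K_cup] at h
  have h1 := congrArg (ren (Sum.elim Empty.elim (Sum.elim (fun _ => i) fun _ => j))) h
  rw [ren_dl, ren_sum] at h1
  simpa [ze_zero] using h1.symm

/-- Summation of a product with a factor that does not involve the summed variable. -/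
theorem sum_mul_right (φ : St X) (ψ : St (X ⊕ A)) : sum A (ψ * ren Sum.inl φ) = sum A ψ * φ := by
  rw [mul_comm, ← mul_sum, mul_comm]

/-- The Hadamard kernel is symmetric. -/
theorem hh_comm (i j : X) : hh i j = hh j i := by
  have key : (hh (.inr ()) (.inl ()) : St (Unit ⊕ Unit)) = hh (.inl ()) (.inr ()) := by
    -- the transpose and the inverse of the Hadamard kernel agree
    let F : St (((Unit ⊕ Unit) ⊕ Unit) ⊕ Unit) := hh (.inl (.inr ())) (.inl (.inl (.inl ()))) *
      (hh (.inl (.inr ())) (.inr ()) * hh (.inr ()) (.inl (.inl (.inr ()))))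
    have h1 : sum Unit (sum Unit F) = hh (.inr ()) (.inl ()) := by
      have h := mul_sum (hh (.inr ()) (.inl (.inl ())) : St ((Unit ⊕ Unit) ⊕ Unit))
        (hh (Sum.inl (.inr ())) (.inr ()) * hh (Sum.inr ()) (.inl (.inl (.inr ()))))
      rw [sum_hh_hh_aux, ren_hh] at h
      rw [← h, sum_delta']
      simp
    have h2 : sum Unit (sum Unit F) = hh (.inl ()) (.inr ()) := by
      have h := sum_mul_right (hh (.inr ()) (.inl (.inr ())) : St ((Unit ⊕ Unit) ⊕ Unit))
        (hh (Sum.inr ()) (.inl (.inl (.inl ()))) * hh (Sum.inr ()) (.inl (.inr ())))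
      rw [sum_hh_hh_aux', ren_hh, mul_assoc] at h
      rw [sum_comm]
      simp only [F, map_mul, ren_hh, rightComm_inl_inl, rightComm_inl_inr, rightComm_inr]
      rw [h, mul_comm, sum_delta]
      simp
    exact h1.symm.trans h2
  have h := congrArg (ren (Sum.elim (fun _ => j) fun _ => i)) key
  simpa using h

end hadamard

/-! ### The Fourier transform and the indicator function of zero -/

section scalars

variable {A B C A' B' X Y Z X' Y' : Type} [Finite A] [Finite B] [Finite C] [Finite A'] [Finite B']
  [Finite X] [Finite Y] [Finite Z] [Finite X'] [Finite Y']

theorem sum_hh_hh (i j : X) : sum Unit (hh (Sum.inl i) (Sum.inr ()) * hh (Sum.inl j) (Sum.inr ())) = dl i j := by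
  rw [hh_comm (Sum.inl j), sum_hh_hh_aux]

/-- The Hadamard transform is an involution. -/
theorem fourier_inv (w : X) (Φ : St (X ⊕ Unit)) :
    sum Unit (hh (Sum.inl w) (Sum.inr ()) * sum Unit (hh (Sum.inl (Sum.inr ())) (Sum.inr ()) *
      ren (Sum.map Sum.inl id) Φ : St ((X ⊕ Unit) ⊕ Unit))) = ren (Sum.elim id fun _ => w) Φ := by
  rw [mul_sum, sum_comm, ← sum_delta]
  congr 1
  rw [← sum_hh_hh, mul_sum]
  congr 1
  simp only [map_mul, ren_hh, ren_ren, rightComm_inl_inl, rightComm_inl_inr, rightComm_inr]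
  rw [hh_comm (Sum.inr ()), ← mul_assoc, mul_comm]
  congr 1
  apply ren_congr
  rintro (x | x) <;> rfl

/-- The state of the red spider of phase `0`, proportional to the indicator function of `0`. -/
noncomputable def kz (i : X) : St X := sum Unit (hh (Sum.inl i) (Sum.inr ()))

/-- The kernel of the red phase shift by `α`. -/
noncomputable def kx (α : Real.Angle) (i j : X) : St X :=
  sum Unit (hh (Sum.inl i) (Sum.inr ()) * (ze α (Sum.inr ()) * hh (Sum.inl j) (Sum.inr ())))

/-- The red spider of phase `0` with three legs, proportional to the indicator function of
`i + j + k = 0`. -/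
noncomputable def tri (i j k : X) : St X :=
  sum Unit (hh (Sum.inl i) (Sum.inr ()) * (hh (Sum.inl j) (Sum.inr ()) * hh (Sum.inl k) (Sum.inr ())))

@[simp] theorem ren_kz (f : X → Y) (i : X) : ren f (kz i) = kz (f i) := by
  rw [kz, ren_sum, kz, ren_hh]; rfl

@[simp] theorem ren_kx (f : X → Y) (α : Real.Angle) (i j : X) :
    ren f (kx α i j) = kx α (f i) (f j) := by
  rw [kx, ren_sum, kx]
  simp only [map_mul, ren_hh, ren_ze]
  rfl

@[simp] theorem ren_tri (f : X → Y) (i j k : X) : ren f (tri i j k) = tri (f i) (f j) (f k) := by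
  rw [tri, ren_sum, tri]
  simp only [map_mul, ren_hh]
  rfl

/-- The Fourier transform of the indicator function of zero is constant. -/
theorem fourier_kz (w : X) : sum Unit (hh (Sum.inl w) (Sum.inr ()) * kz (Sum.inr ())) = 1 := by
  have h := fourier_inv w (1 : St (X ⊕ Unit))
  rwa [map_one, map_one, mul_one] at h

theorem fourier_kx (α : Real.Angle) (w y : X) :
    sum Unit (hh (Sum.inl w) (Sum.inr ()) * kx α (Sum.inr ()) (Sum.inl y)) = ze α w * hh w y := by
  have h := fourier_inv w (ze α (Sum.inr ()) * hh (Sum.inl y) (Sum.inr ()) : St (X ⊕ Unit))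
  simp only [map_mul, ren_ze, ren_hh, Sum.map_inl, Sum.map_inr, Sum.elim_inl, Sum.elim_inr, id] at h
  rw [hh_comm w y]
  exact h

theorem fourier_tri (w j k : X) :
    sum Unit (hh (Sum.inl w) (Sum.inr ()) * tri (Sum.inr ()) (Sum.inl j) (Sum.inl k)) = hh w j * hh w k := by
  have h := fourier_inv w (hh (Sum.inl j) (Sum.inr ()) * hh (Sum.inl k) (Sum.inr ()) : St (X ⊕ Unit))
  simp only [map_mul, ren_hh, Sum.map_inl, Sum.map_inr, Sum.elim_inl, Sum.elim_inr, id] at h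
  rw [hh_comm w j, hh_comm w k]
  exact h

theorem con_empty (c : St Empty) : (con c : St Empty) = c := ren_id' _ (fun x => x.elim) c

theorem con_eq (c : St Empty) : (con c : St X) = ren (Sum.elim Empty.elim Empty.elim) (K c) := by
  rw [K_state, ren_ren, con]
  exact ren_congr (fun x => x.elim) c

theorem ze_eq (α : Real.Angle) : K (gr Empty Unit α) = ze α (Sum.inr ()) := by
  rw [K_state]; rfl

theorem con_gr (α : Real.Angle) : (con (gr Empty Empty α) : St X) = sum Unit (ze α (Sum.inr ())) := by
  rw [con_eq, K_gr, ren_sum]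
  simp

theorem overlap_mor (α β : Real.Angle) : (overlap α β).mor = gr Empty Unit α ≫ₘ rd Unit Empty β := rfl

theorem con_overlap (α β : Real.Angle) : (con (overlap α β).mor : St X) =
    sum Unit (ze α (Sum.inr ()) * sum Unit (ze β (Sum.inr ()) * hh (Sum.inl (Sum.inr ())) (Sum.inr ()))) := by
  rw [con_eq, overlap_mor, K_comp, ze_eq, K_rd, ren_sum]
  simp [ren_sum]

theorem con_overlap_zero : (con (overlap 0 0).mor : St X) = sum Unit (kz (Sum.inr ())) := by
  rw [con_overlap, ze_zero, ze_zero, one_mul, one_mul]; rfl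

theorem sum_con_mul (c : St Empty) (ψ : St (X ⊕ A)) : sum A (con c * ψ) = con c * sum A ψ := by
  rw [mul_sum, ren_con]

/-- The scalar `t`, which stands for `√2`. -/
noncomputable abbrev tt : St Empty := (overlap 0 0).mor

theorem con_tt : (con tt : St X) = sum Unit (kz (Sum.inr ())) := con_overlap_zero

/-- The copy rule: `kz` is supported at a single point. -/
theorem kz_copy (i j : X) : con tt * (kz i * dl i j) = kz i * kz j := by
  have h := congrArg K (mor_eq_iff.2 (.rule .copy))
  have e1 : (red Empty Unit 0 ⨾ green Unit (Unit ⊕ Unit) 0).mor =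
    rd Empty Unit 0 ≫ₘ gr Unit (Unit ⊕ Unit) 0 := rfl
  have e2 : (wires (Equiv.emptySum Empty Empty).symm ⨾ (red Empty Unit 0 ⊠ red Empty Unit 0)).mor =
    W (Equiv.emptySum Empty Empty).symm ≫ₘ (rd Empty Unit 0 ⊗ₘ rd Empty Unit 0) := rfl
  have e3 : K (rd Empty Unit 0) = kz (Sum.inr ()) := by
    rw [K_rd, kz]
    congr 1
    simp [ze_zero]
    exact hh_comm _ _
  rw [K_scale, e1, e2, K_W_comp, K_tensor, K_comp, K_copy, e3] at h
  have h1 := congrArg (ren (Sum.elim Empty.elim (Sum.elim (fun _ => i) fun _ => j))) h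
  simp only [map_mul, ren_con, ren_kz, ren_dl, Function.comp, Sum.elim_inl, Sum.elim_inr,
    Sum.map_inr, id] at h1
  have h2 : ren (Sum.elim Empty.elim (Sum.elim (fun _ => i) fun _ => j))
      (sum Unit (kz (Sum.inr ()) * (dl (Sum.inr ()) (Sum.inl (Sum.inr (Sum.inl ()))) *
        dl (Sum.inr ()) (Sum.inl (Sum.inr (Sum.inr ())))) :
        St ((Empty ⊕ (Unit ⊕ Unit)) ⊕ Unit))) = kz i * dl i j := by
    rw [ren_sum]
    simp only [map_mul, ren_kz, ren_dl, Sum.map_inl, Sum.map_inr, Sum.elim_inl, Sum.elim_inr, id]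
    rw [mul_left_comm, mul_comm, sum_delta']
    simp [mul_comm]
  rw [h2] at h1
  exact h1

/-- The Hadamard kernel is constant on the row of zero. -/
theorem kz_absorb (i j : X) : con tt * (kz i * hh i j) = kz i := by
  have h := congrArg (sum Unit) (congrArg (· * hh (Sum.inl j) (Sum.inr ()))
    (kz_copy (Sum.inl i) (Sum.inr () : X ⊕ Unit)))
  simp only [mul_assoc] at h
  rw [sum_con_mul] at h
  have h1 := mul_sum (kz i) (hh (Sum.inl j) (Sum.inr ()) * kz (Sum.inr ()))
  rw [fourier_kz, ren_kz, mul_comm (hh _ _), mul_one] at h1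
  rw [← h1] at h
  conv at h => lhs; rw [mul_comm (dl _ _), ← mul_assoc, sum_delta]
  simpa [hh_comm] using h

/-- Multiplication by `kz i` substitutes zero for `i`. -/
theorem kz_subst (i : X) (ψ : St (X ⊕ Unit)) :
    con tt * (kz i * ren (Sum.elim id fun _ => i) ψ) = kz i * sum Unit (ψ * kz (Sum.inr ())) := by
  rw [mul_sum, ← sum_delta, mul_sum, mul_sum]
  congr 1
  have h := kz_copy (Sum.inl i) (Sum.inr () : X ⊕ Unit)
  rw [ren_con, ren_kz, mul_left_comm (kz _) ψ, mul_left_comm (kz _) ψ, ← h]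
  ac_rfl

end scalars

/-! ### Invertibility of the square root of two, and the bialgebra rule -/

section invertible

variable {A B C A' B' X Y Z X' Y' : Type} [Finite A] [Finite B] [Finite C] [Finite A'] [Finite B']
  [Finite X] [Finite Y] [Finite Z] [Finite X'] [Finite Y']

/-- The sum of `1` over one variable is `2`. -/
theorem tt_mul_tt : tt * tt = gr Empty Empty 0 := by
  have h := congrArg (sum Unit) (kz_copy (Sum.inr () : Empty ⊕ Unit) (Sum.inr ()))
  rw [dl_self, mul_one, sum_con_mul, ← con_tt, con_empty] at h
  have h1 := fourier_kz (Sum.inr () : Empty ⊕ Unit)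
  have h2 := mul_sum (kz (Sum.inr ())) (hh (Sum.inl (Sum.inr ())) (Sum.inr ()) : St ((Empty ⊕ Unit) ⊕ Unit))
  rw [← kz] at h2
  rw [h, h2, sum_comm]
  simp only [map_mul, ren_kz, ren_hh, rightComm_inl_inr, rightComm_inr]
  rw [← con_empty (gr Empty Empty 0), con_gr, ze_zero, ← h1]
  congr 2
  rw [mul_comm, hh_comm]

/-- By the star rule `2` is invertible, hence so is `√2`. -/
theorem tt_mul_star : tt * (tt * (star : Diagram Empty Empty).mor) = 1 := by
  have h := congrArg K (mor_eq_iff.2 (.rule .star))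
  rw [K_scale, show (green Empty Empty 0).mor = gr Empty Empty 0 from rfl,
    show (idw Empty).mor = ident Empty from rfl, K_ident, K_state, diag_eq] at h
  simp only [Finset.univ_eq_empty, Finset.prod_empty] at h
  have h1 := congrArg (ren (Sum.elim id id)) h
  rw [map_mul, ren_con, con_empty, ren_ren, ren_id' _ (fun x => x.elim), map_one] at h1
  rw [← mul_assoc, tt_mul_tt, mul_comm, h1]

/-- The inverse of the scalar `tt`. -/
noncomputable def ti : St Empty := tt * (star : Diagram Empty Empty).mor

theorem con_tt_mul_ti : (con tt * con ti : St X) = 1 := by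
  rw [← map_mul, ti, tt_mul_star, map_one]

theorem con_tt_cancel {φ ψ : St X} (h : con tt * φ = con tt * ψ) : φ = ψ := by
  have := congrArg (con ti * ·) h
  simpa only [← mul_assoc, mul_comm (con ti) (con tt), con_tt_mul_ti, one_mul] using this

/-- The bialgebra rule: a function supported on `i + j + k = 0` and on `i + j + l = 0` is supported
on `k = l`. -/
theorem tri_mul_tri (i j k l : X) :
    con tt * (tri i j k * tri i j l) = tri i j k * dl k l := by
  have h := congrArg K (mor_eq_iff.2 (.rule .bialgebra))
  have e1 : ((green Unit (Unit ⊕ Unit) 0 ⊠ green Unit (Unit ⊕ Unit) 0) ⨾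
            wires (Equiv.sumSumSumComm Unit Unit Unit Unit) ⨾
            (red (Unit ⊕ Unit) Unit 0 ⊠ red (Unit ⊕ Unit) Unit 0)).mor =
      ((gr Unit (Unit ⊕ Unit) 0 ⊗ₘ gr Unit (Unit ⊕ Unit) 0) ≫ₘ
        W (Equiv.sumSumSumComm Unit Unit Unit Unit)) ≫ₘ
        (rd (Unit ⊕ Unit) Unit 0 ⊗ₘ rd (Unit ⊕ Unit) Unit 0) := rfl
  have e2 : (red (Unit ⊕ Unit) Unit 0 ⨾ green Unit (Unit ⊕ Unit) 0).mor =
      rd (Unit ⊕ Unit) Unit 0 ≫ₘ gr Unit (Unit ⊕ Unit) 0 := rfl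
  have e3 : K (rd (Unit ⊕ Unit) Unit 0) =
      tri (Sum.inl (Sum.inl ())) (Sum.inl (Sum.inr ())) (Sum.inr ()) := by
    rw [K_rd, tri]
    simp only [ze_zero, one_mul, Fintype.prod_sum_type, Finset.univ_unique, Finset.prod_singleton,
      PUnit.default_eq_unit]
    rw [hh_comm (Sum.inr ()), mul_assoc]
  rw [K_scale, e1, e2, K_comp, K_comp_W, K_tensor, K_tensor, K_comp, K_copy, e3] at h
  have h1 := congrArg (ren (Sum.elim (Sum.elim (fun _ => i) fun _ => j)
    (Sum.elim (fun _ => k) fun _ => l))) h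
  simp only [map_mul, ren_con, ren_sum, ren_tri, ren_dl, Function.comp, Sum.elim_inl, Sum.elim_inr,
    Sum.map_inl, Sum.map_inr, id, Equiv.sumSumSumComm_apply, Sum.map_map] at h1
  have h2 := sum_delta_all (A := (Unit ⊕ Unit) ⊕ (Unit ⊕ Unit))
    (Sum.elim (Sum.elim (fun _ => i) fun _ => j) (Sum.elim (fun _ => i) fun _ => j))
    (tri (Sum.inr (Sum.inl (Sum.inl ()))) (Sum.inr (Sum.inl (Sum.inr ()))) (Sum.inl k) *
      tri (Sum.inr (Sum.inr (Sum.inl ()))) (Sum.inr (Sum.inr (Sum.inr ()))) (Sum.inl l))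
  simp only [map_mul, ren_tri, Sum.elim_inl, Sum.elim_inr, Fintype.prod_sum_type,
    Finset.univ_unique, Finset.prod_singleton, PUnit.default_eq_unit, id] at h2
  rw [← h2]
  refine Eq.trans ?_ (h1.trans ?_)
  · congr 2
    rw [mul_comm]
    congr 1
    simp
    ac_rfl
  · rw [mul_comm (dl _ _), ← mul_assoc, sum_delta']
    simp

end invertible

/-! ### Characters, the Hopf law and the Euler decomposition -/

section characters

variable {A B C A' B' X Y Z X' Y' : Type} [Finite A] [Finite B] [Finite C] [Finite A'] [Finite B']
  [Finite X] [Finite Y] [Finite Z] [Finite X'] [Finite Y']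

/-- A function of a variable that is multiplicative up to the scalar `c`:
`∑ r, tri p q r * B r = c * (B p * B q)`. -/
def IsChar (c : St Empty) (p q : X) (B : St (X ⊕ Unit)) : Prop :=
  sum Unit (tri (Sum.inl p) (Sum.inl q) (Sum.inr ()) * B) =
    con c * (ren (Sum.elim id fun _ => p) B * ren (Sum.elim id fun _ => q) B)

/-- The constant function `1` is a character. -/
theorem sum_tri (p q : X) : sum Unit (tri (Sum.inl p) (Sum.inl q) (Sum.inr ())) = con ti := by
  have h1 : sum Unit (tri (Sum.inl p) (Sum.inl q) (Sum.inr ())) =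
      sum Unit (kz (Sum.inr ()) * hh (Sum.inr ()) (Sum.inl p) * hh (Sum.inr ()) (Sum.inl q)) := by
    simp only [tri]
    rw [sum_comm]
    congr 1
    simp only [map_mul, ren_hh, rightComm_inl_inl, rightComm_inl_inr, rightComm_inr]
    have h := mul_sum (hh (Sum.inl p) (Sum.inr ()) * hh (Sum.inl q) (Sum.inr ()))
      (hh (Sum.inl (Sum.inr ())) (Sum.inr ()) : St ((X ⊕ Unit) ⊕ Unit))
    rw [← kz] at h
    rw [hh_comm (Sum.inr ()) (Sum.inl p), hh_comm (Sum.inr ()) (Sum.inl q), mul_assoc (kz _),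
      mul_comm (kz _), h]
    congr 1
    simp only [map_mul, ren_hh]
    rw [hh_comm (Sum.inr ())]
    ac_rfl
  apply con_tt_cancel
  apply con_tt_cancel
  have h2 : con tt * (con tt * (kz (Sum.inr ()) * hh (Sum.inr ()) (Sum.inl p) *
      hh (Sum.inr ()) (Sum.inl q))) = (kz (Sum.inr ()) : St (X ⊕ Unit)) := by
    have h3 := kz_absorb (Sum.inr () : X ⊕ Unit) (Sum.inl q)
    rw [← kz_absorb _ (Sum.inl p)] at h3
    refine Eq.trans ?_ (h3.trans (kz_absorb _ _))
    ac_rfl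
  rw [con_tt_mul_ti, mul_one, h1, ← sum_con_mul, ← sum_con_mul, h2, con_tt]

theorem isChar_one (p q : X) : IsChar ti p q 1 := by
  rw [IsChar, map_one, map_one, mul_one, mul_one, mul_one, sum_tri]

theorem isChar_hh (p q x : X) : IsChar 1 p q (hh (Sum.inl x) (Sum.inr ())) := by
  rw [IsChar, map_one, one_mul, ren_hh, ren_hh]
  simp only [Sum.elim_inl, Sum.elim_inr, id]
  rw [← fourier_tri x p q]
  congr 1
  rw [mul_comm]
  congr 1
  simp only [tri]
  congr 1
  ac_rfl

/-- Products of characters are characters: by the bialgebra rule `tri p q r` may be doubled, with one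
copy for each factor. -/
theorem IsChar.mul {b c : St Empty} {p q : X} {B C : St (X ⊕ Unit)} (hB : IsChar b p q B)
    (hC : IsChar c p q C) : IsChar (tt * b * c) p q (B * C) := by
  have h := sum_delta (Sum.inr ()) (ren Sum.inl (tri (Sum.inl p) (Sum.inl q) (Sum.inr ()) * B) *
    ren (Sum.map Sum.inl id) C : St ((X ⊕ Unit) ⊕ Unit))
  conv_rhs at h =>
    rw [map_mul, ren_ren, ren_ren, ren_id' (Sum.elim id _ ∘ Sum.inl) (fun x => rfl),
      ren_id' (Sum.elim id _ ∘ Sum.map _ _) (by rintro (x | x) <;> rfl), mul_assoc]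
  have h1 := mul_sum (con tt * (tri (Sum.inl p) (Sum.inl q) (Sum.inr ()) * B))
    (ren (Sum.map Sum.inl id) (tri (Sum.inl p) (Sum.inl q) (Sum.inr ()) * C))
  rw [← ren_sum, hC] at h1
  rw [IsChar, ← h]
  have h2 := tri_mul_tri (Sum.inl (Sum.inl p)) (Sum.inl (Sum.inl q)) (Sum.inl (Sum.inr ()))
    (Sum.inr () : (X ⊕ Unit) ⊕ Unit)
  have h3 : (ren Sum.inl (tri (Sum.inl p) (Sum.inl q) (Sum.inr ()) * B) *
      ren (Sum.map Sum.inl id) C * dl (Sum.inl (Sum.inr ())) (Sum.inr ()) : St ((X ⊕ Unit) ⊕ Unit)) =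
      ren Sum.inl (con tt * (tri (Sum.inl p) (Sum.inl q) (Sum.inr ()) * B)) *
      ren (Sum.map Sum.inl id) (tri (Sum.inl p) (Sum.inl q) (Sum.inr ()) * C) := by
    simp only [map_mul, ren_con, ren_tri, Sum.map_inl, Sum.map_inr, id]
    have h4 := congrArg (· * (ren Sum.inl B * ren (Sum.map Sum.inl id) C)) h2
    refine Eq.trans ?_ (h4.symm.trans ?_) <;> ac_rfl
  rw [h3, ← h1, sum_mul_right, sum_con_mul, hB]
  simp only [map_mul]
  ac_rfl

theorem tri_rotate (i j k : X) : tri i j k = tri j k i := by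
  simp only [tri]
  congr 1
  ac_rfl

/-- The Hopf law: the function `hh i j`, whose values are `±1/√2`, has a constant square. -/
theorem hopf (i j : X) : con tt * (con tt * (hh i j * hh i j)) = 1 := by
  have h := congrArg (sum Unit) ((isChar_hh (Sum.inr ()) (Sum.inl j) (Sum.inl i : X ⊕ Unit)).mul
    (isChar_hh (Sum.inr ()) (Sum.inl j) (Sum.inl i : X ⊕ Unit)))
  have h1 := sum_mul_right (hh i j * hh i j) (hh (Sum.inl i) (Sum.inr ()) * hh (Sum.inl i) (Sum.inr ()))
  have h2 := sum_mul_right (hh (Sum.inl i) (Sum.inr ()) * hh (Sum.inl i) (Sum.inr ()))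
    (tri (Sum.inl (Sum.inl j)) (Sum.inl (Sum.inr ())) (Sum.inr ()))
  rw [sum_tri] at h2
  rw [sum_hh_hh, dl_self, one_mul] at h1
  rw [sum_comm] at h
  simp only [mul_one, map_mul, ren_hh, ren_tri, Sum.elim_inl, Sum.elim_inr, id, rightComm_inl_inl,
    rightComm_inl_inr, rightComm_inr] at h h1 h2
  rw [sum_con_mul, tri_rotate, h2, sum_con_mul, sum_hh_hh, dl_self, mul_one] at h
  rw [← con_tt_mul_ti, h, ← h1]

theorem K_gphase (α : Real.Angle) :
    K (gr Unit Unit α) = dl (Sum.inl ()) (Sum.inr ()) * ze α (Sum.inr ()) := by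
  rw [K, app_phase, diag_unit]

theorem K_rphase (α : Real.Angle) : K (rd Unit Unit α) = kx α (Sum.inl ()) (Sum.inr ()) := by
  rw [K_rd, kx]
  simp only [Finset.univ_unique, Finset.prod_singleton, PUnit.default_eq_unit]
  rw [hh_comm (Sum.inr ())]
  congr 1
  ac_rfl

theorem K_gphase_rphase (α β : Real.Angle) : K (gr Unit Unit α ≫ₘ rd Unit Unit β) =
    ze α (Sum.inl ()) * kx β (Sum.inl ()) (Sum.inr ()) := by
  rw [K_comp, K_gphase, K_rphase]
  simp only [map_mul, ren_dl, ren_ze, ren_kx, Sum.map_inl, Sum.map_inr, Sum.elim_inl, Sum.elim_inr,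
    Function.comp, id]
  rw [mul_assoc, mul_comm, sum_delta]
  simp

theorem K_rphase_gphase (α β : Real.Angle) : K (rd Unit Unit α ≫ₘ gr Unit Unit β) =
    kx α (Sum.inl ()) (Sum.inr ()) * ze β (Sum.inr ()) := by
  rw [K_comp_app, app_phase, K_rphase]

theorem kx_comp (α β : Real.Angle) (i j : X) :
    sum Unit (kx α (Sum.inl i) (Sum.inr ()) * kx β (Sum.inr ()) (Sum.inl j)) = kx (α + β) i j := by
  have h := congrArg (fun D => K (Mor.swap D)) (gr_phase (A := Unit) (B := Unit) α β)
  simp only [swap_comp, swap_gr] at h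
  rw [K_comp, K_rphase, K_rphase, K_rphase] at h
  have h1 := congrArg (ren (Sum.elim (fun _ => i) fun _ => j)) h
  simpa only [ren_sum, map_mul, ren_kx, Sum.map_inl, Sum.map_inr, Sum.elim_inl, Sum.elim_inr,
    Function.comp, id] using h1

theorem kx_zero (i j : X) : kx 0 i j = dl i j := by
  rw [kx, ze_zero, one_mul, sum_hh_hh]

/-- The scalar in the Euler decomposition of the Hadamard node. -/
noncomputable def eu : St Empty := (overlap phNegHalf phNegHalf).mor

/-- The scalar in the commutation rule of a red phase shift by `α` and a green one by `π`. -/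
noncomputable def co (α : Real.Angle) : St Empty := (overlap α phPi).colourSwap.mor

/-- The Euler decomposition rule. -/
theorem euler (i j : X) : con tt * (con tt * hh i j) =
    con eu * (ze phHalf i * kx phHalf i j * ze phHalf j) := by
  have h := congrArg K (mor_eq_iff.2 (.rule .euler))
  have e1 : (gphase phHalf ⨾ rphase phHalf ⨾ gphase phHalf).mor =
    (gr Unit Unit phHalf ≫ₘ rd Unit Unit phHalf) ≫ₘ gr Unit Unit phHalf := rfl
  rw [K_scale, K_scale, K_scale, e1, K_comp_app, app_phase, K_gphase_rphase,
    show had.mor = hadM from rfl, K_had] at h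
  have h1 := congrArg (ren (Sum.elim (fun _ => i) fun _ => j)) h
  simp only [map_mul, ren_con, ren_hh, ren_kx, ren_ze, Sum.elim_inl, Sum.elim_inr] at h1
  exact h1

/-- The `π`-commutation rule with the colours interchanged. -/
theorem kx_mul_ze_pi (α : Real.Angle) (i j : X) : con tt * (kx α i j * ze phPi j) =
    con (co α) * (ze phPi i * kx (-α) i j) := by
  have h := congrArg K (mor_eq_iff.2 (.rule_colourSwap (.piComm α)))
  have e0 : (overlap 0 0).colourSwap.mor = tt := by
    have e : (overlap 0 0).colourSwap.mor = rd Empty Unit 0 ≫ₘ gr Unit Empty 0 := rfl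
    have e3 : K (rd Empty Unit 0) = kz (Sum.inr ()) := by
      rw [K_rd, kz]
      simp [ze_zero, hh_comm (Sum.inr ())]
    rw [← con_empty tt, con_tt, e, ← con_empty (Mor.comp _ _), con_eq, K_comp_app, ← discard_unit,
      app_discard, e3, ren_ren, ren_sum, ren_kz]
    rfl
  have e1 : (scale (overlap 0 0) (gphase α ⨾ rphase phPi)).colourSwap =
    scale (overlap 0 0).colourSwap (rphase α ⨾ gphase phPi) := rfl
  have e2 : (scale (overlap α phPi) (rphase phPi ⨾ gphase (-α))).colourSwap =
    scale (overlap α phPi).colourSwap (gphase phPi ⨾ rphase (-α)) := rfl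
  have e3 : (rphase α ⨾ gphase phPi).mor = rd Unit Unit α ≫ₘ gr Unit Unit phPi := rfl
  have e4 : (gphase phPi ⨾ rphase (-α)).mor = gr Unit Unit phPi ≫ₘ rd Unit Unit (-α) := rfl
  rw [e1, e2, K_scale, K_scale, e0, e3, e4, K_gphase_rphase, K_rphase_gphase] at h
  have h1 := congrArg (ren (Sum.elim (fun _ => i) fun _ => j)) h
  simp only [map_mul, ren_con, ren_kx, ren_ze, Sum.elim_inl, Sum.elim_inr] at h1
  exact h1

theorem kx_comm (α : Real.Angle) (i j : X) : kx α i j = kx α j i := by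
  simp only [kx]
  congr 1
  ac_rfl

theorem sum_one : (sum Unit 1 : St X) = con (tt * tt) := by
  rw [tt_mul_tt, con_gr, ze_zero]

theorem con_injective {c d : St Empty} (h : (con c : St (Empty ⊕ Unit)) = con d) : c = d := by
  have h1 := congrArg (sum Unit) h
  rw [← mul_one (con c), ← mul_one (con d), sum_con_mul, sum_con_mul, sum_one, con_empty, con_empty,
    con_empty, mul_comm c, mul_comm d, ← con_empty tt, mul_assoc, mul_assoc] at h1
  exact con_tt_cancel (con_tt_cancel h1)

theorem ze_half_mul_half (i : X) : ze phHalf i * ze phHalf i = ze phPi i := by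
  rw [ze_mul, phPi, phHalf, ← Real.Angle.coe_add]
  congr 2
  ring

theorem ze_pi_mul_pi (i : X) : ze phPi i * ze phPi i = 1 := by
  rw [ze_mul, phPi, ← Real.Angle.coe_add, ← ze_zero i, ← Real.Angle.coe_two_pi]
  congr 2
  ring

/-- The scalars of the Euler and `π`-commutation rules divide a power of the invertible scalar `√2`,
as follows from composing the Euler decomposition with itself. -/
theorem scalar_eq : tt * (tt * tt * (tt * tt)) = eu * eu * co phHalf := by
  apply con_injective
  let i : Empty ⊕ Unit := Sum.inr ()
  have h1 : sum Unit (kx (-phHalf) (Sum.inl i) (Sum.inr ()) * kx phHalf (Sum.inr ()) (Sum.inl i)) = 1 := by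
    rw [kx_comp, neg_add_cancel, kx_zero, dl_self]
  have h2 : sum Unit (hh (Sum.inl i) (Sum.inr ()) * hh (Sum.inl i) (Sum.inr ())) = 1 := by
    rw [sum_hh_hh, dl_self]
  have e := euler (Sum.inl i) (Sum.inr () : (Empty ⊕ Unit) ⊕ Unit)
  have h4 : con (tt * (tt * tt * (tt * tt))) * (hh (Sum.inl i) (Sum.inr ()) * hh (Sum.inl i) (Sum.inr ())) =
      con (eu * eu * co phHalf) * (kx (-phHalf) (Sum.inl i) (Sum.inr ()) *
        kx phHalf (Sum.inr ()) (Sum.inl i)) := by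
    have e1 : con (tt * (tt * tt * (tt * tt))) * (hh (Sum.inl i) (Sum.inr ()) * hh (Sum.inl i) (Sum.inr ())) =
        con tt * ((con tt * (con tt * hh (Sum.inl i) (Sum.inr ()))) *
          (con tt * (con tt * hh (Sum.inl i) (Sum.inr () : (Empty ⊕ Unit) ⊕ Unit)))) := by
      simp only [map_mul]
      ac_rfl
    have e2 := kx_mul_ze_pi phHalf (Sum.inl i) (Sum.inr () : (Empty ⊕ Unit) ⊕ Unit)
    rw [e1, e, kx_comm phHalf (Sum.inr ())]
    calc _ = con eu * con eu * kx phHalf (Sum.inl i) (Sum.inr ()) *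
          (ze phHalf (Sum.inl i) * ze phHalf (Sum.inl i)) *
          (con tt * (kx phHalf (Sum.inl i) (Sum.inr ()) *
            (ze phHalf (Sum.inr ()) * ze phHalf (Sum.inr () : (Empty ⊕ Unit) ⊕ Unit)))) := by ac_rfl
      _ = con eu * con eu * con (co phHalf) * (kx (-phHalf) (Sum.inl i) (Sum.inr ()) *
            kx phHalf (Sum.inl i) (Sum.inr ())) *
          (ze phPi (Sum.inl i) * ze phPi (Sum.inl i)) := by
            rw [ze_half_mul_half, ze_half_mul_half, e2]
            ac_rfl
      _ = _ := by rw [ze_pi_mul_pi, mul_one, map_mul, map_mul]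
  have h5 := congrArg (sum Unit) h4
  rwa [sum_con_mul, sum_con_mul, h1, h2, mul_one, mul_one] at h5

/-- The scalars that are represented by stabilizer diagrams. -/
def stabScalars : Submonoid (St Empty) where
  carrier := {c | ∃ D : Diagram Empty Empty, D.IsStabilizer ∧ D.mor = c}
  one_mem' := ⟨idw Empty, trivial, by
    rw [show (idw Empty).mor = ident Empty from rfl, ident_eq_P, one_def]
    exact congrArg P (funext fun x => x.elim)⟩
  mul_mem' := by
    rintro _ _ ⟨D, hD, rfl⟩ ⟨E, hE, rfl⟩
    refine ⟨scale D E, ⟨⟨trivial, hD, hE⟩, trivial⟩, ?_⟩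
    have h := congrArg (ren (Sum.elim id id)) (K_scale D E)
    rwa [map_mul, ren_con, con_empty, K_state, K_state, ren_ren, ren_ren, ren_id' _ (fun x => x.elim),
      ren_id' _ (fun x => x.elim)] at h

theorem isQuarter_zero : IsQuarter 0 := ⟨0, by simp⟩

theorem isQuarter_half : IsQuarter phHalf := ⟨1, by simp⟩

theorem IsQuarter.add {α β : Real.Angle} (hα : IsQuarter α) (hβ : IsQuarter β) : IsQuarter (α + β) := by
  obtain ⟨k, rfl⟩ := hα
  obtain ⟨l, rfl⟩ := hβ
  exact ⟨k + l, (add_zsmul _ _ _).symm⟩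

theorem IsQuarter.neg {α : Real.Angle} (hα : IsQuarter α) : IsQuarter (-α) := by
  obtain ⟨k, rfl⟩ := hα
  exact ⟨-k, (neg_zsmul _ _).symm⟩

theorem isQuarter_pi : IsQuarter phPi := ⟨2, by
  rw [phPi, phHalf, ← Real.Angle.coe_zsmul]
  congr 1
  simp
  ring⟩

theorem overlap_mem {α β : Real.Angle} (hα : IsQuarter α) (hβ : IsQuarter β) :
    (overlap α β).mor ∈ stabScalars := ⟨overlap α β, ⟨hα, hβ⟩, rfl⟩

theorem tt_mem : tt ∈ stabScalars := overlap_mem isQuarter_zero isQuarter_zero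

theorem ti_mem : ti ∈ stabScalars := mul_mem tt_mem ⟨Diagram.star, trivial, rfl⟩

theorem eu_mem : eu ∈ stabScalars := by
  have h : IsQuarter phNegHalf := isQuarter_half.neg
  exact overlap_mem h h

theorem co_mem : co phHalf ∈ stabScalars :=
  ⟨(overlap phHalf phPi).colourSwap, ⟨isQuarter_half, isQuarter_pi⟩, rfl⟩

theorem gr_mem {α : Real.Angle} (hα : IsQuarter α) : gr Empty Empty α ∈ stabScalars :=
  ⟨green Empty Empty α, hα, rfl⟩

theorem con_mul_cancel {c d : St Empty} (h : c * d = 1) {φ ψ : St X} (hφ : con d * φ = ψ) :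
    φ = con c * ψ := by
  rw [← hφ, ← mul_assoc, ← map_mul, h, map_one, one_mul]

/-- The odd multiples of `π/2`. -/
def IsOdd (α : Real.Angle) : Prop := α = phHalf ∨ α = -phHalf

theorem ti_mul_tt : ti * tt = 1 := by
  have h := con_tt_mul_ti (X := Empty)
  rwa [con_empty, con_empty, mul_comm] at h

theorem ze_mul_ze_neg (α : Real.Angle) (i : X) : ze α i * ze (-α) i = 1 := by
  rw [ze_mul, add_neg_cancel, ze_zero]

/-- The Euler decomposition solved for the red phase shift. -/
theorem exists_kx_half : ∃ c ∈ stabScalars, ∃ d ∈ stabScalars, c * d = 1 ∧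
    ∀ (X : Type) [Finite X] (i j : X),
      kx phHalf i j = con c * (ze (-phHalf) i * (ze (-phHalf) j * hh i j)) := by
  -- `tt ^ 5 = eu ^ 2 * co` makes `eu` invertible
  have h : (eu * co phHalf * (ti * (ti * ti * (ti * ti)))) * eu = 1 := by
    calc _ = (eu * eu * co phHalf) * (ti * (ti * ti * (ti * ti))) := by ac_rfl
      _ = (ti * tt) * ((ti * tt) * (ti * tt) * ((ti * tt) * (ti * tt))) := by
        rw [← scalar_eq]; ac_rfl
      _ = 1 := by simp only [ti_mul_tt, one_mul]
  refine ⟨(eu * co phHalf * (ti * (ti * ti * (ti * ti)))) * (tt * tt), ?_, eu * (ti * ti), ?_, ?_, ?_⟩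
  · have h1 := mul_mem ti_mem ti_mem
    exact mul_mem (mul_mem (mul_mem eu_mem co_mem) (mul_mem ti_mem (mul_mem h1 h1)))
      (mul_mem tt_mem tt_mem)
  · exact mul_mem eu_mem (mul_mem ti_mem ti_mem)
  · calc _ = ((eu * co phHalf * (ti * (ti * ti * (ti * ti)))) * eu) * ((ti * tt) * (ti * tt)) := by ac_rfl
      _ = 1 := by simp only [h, ti_mul_tt, one_mul]
  · intro X _ i j
    have e := euler i j
    rw [map_mul, mul_assoc]
    apply con_mul_cancel h
    calc _ = (con eu * (ze phHalf i * kx phHalf i j * ze phHalf j)) * (ze (-phHalf) i * ze (-phHalf) j) := by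
            have h1 := ze_mul_ze_neg phHalf i
            have h2 := ze_mul_ze_neg phHalf j
            calc _ = con eu * kx phHalf i j * (ze phHalf i * ze (-phHalf) i) *
                  (ze phHalf j * ze (-phHalf) j) := by rw [h1, h2, mul_one, mul_one]
              _ = _ := by ac_rfl
      _ = _ := by
            rw [← e, map_mul]
            ac_rfl

/-- The variant of `exists_kx_half` for both signs; the opposite sign comes from `π`-commutation. -/
theorem exists_kx_odd {α : Real.Angle} (hα : IsOdd α) : ∃ c ∈ stabScalars,
    ∀ (X : Type) [Finite X] (i j : X),
      kx α i j = con c * (ze (-α) i * (ze (-α) j * hh i j)) := by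
  obtain ⟨c, hc, d, hd, hcd, H⟩ := exists_kx_half
  rcases hα with rfl | rfl
  · exact ⟨c, hc, H⟩
  have h : (eu * eu * (ti * (ti * ti * (ti * ti)))) * co phHalf = 1 := by
    calc _ = (eu * eu * co phHalf) * (ti * (ti * ti * (ti * ti))) := by ac_rfl
      _ = (ti * tt) * ((ti * tt) * (ti * tt) * ((ti * tt) * (ti * tt))) := by
        rw [← scalar_eq]; ac_rfl
      _ = 1 := by simp only [ti_mul_tt, one_mul]
  refine ⟨(eu * eu * (ti * (ti * ti * (ti * ti)))) * (tt * c), ?_, ?_⟩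
  · have h1 := mul_mem ti_mem ti_mem
    exact mul_mem (mul_mem (mul_mem eu_mem eu_mem) (mul_mem ti_mem (mul_mem h1 h1))) (mul_mem tt_mem hc)
  intro X _ i j
  rw [map_mul, mul_assoc, neg_neg]
  apply con_mul_cancel h
  have e := kx_mul_ze_pi phHalf i j
  calc _ = (con (co phHalf) * (ze phPi i * kx (-phHalf) i j)) * ze phPi i := by
          calc _ = con (co phHalf) * kx (-phHalf) i j * (ze phPi i * ze phPi i) := by
                rw [ze_pi_mul_pi, mul_one]
            _ = _ := by ac_rfl
    _ = con tt * con c * hh i j * (ze phPi i * ze (-phHalf) i) * (ze phPi j * ze (-phHalf) j) := by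
          rw [← e, H]
          ac_rfl
    _ = _ := by
          rw [← ze_half_mul_half i, ← ze_half_mul_half j, mul_assoc (ze phHalf i), mul_assoc (ze phHalf j),
            ze_mul_ze_neg, ze_mul_ze_neg, map_mul, mul_one, mul_one]
          ac_rfl

end characters

/-! ### Summing over a variable with an odd phase -/

section elimination

variable {A B C A' B' X Y Z X' Y' : Type} [Finite A] [Finite B] [Finite C] [Finite A'] [Finite B']
  [Finite X] [Finite Y] [Finite Z] [Finite X'] [Finite Y']

theorem IsOdd.isQuarter {α : Real.Angle} (hα : IsOdd α) : IsQuarter α := by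
  rcases hα with rfl | rfl
  · exact isQuarter_half
  · exact isQuarter_half.neg

theorem IsOdd.neg {α : Real.Angle} (hα : IsOdd α) : IsOdd (-α) := by
  rcases hα with rfl | rfl
  · exact Or.inr rfl
  · exact Or.inl (neg_neg _)

/-- The value at zero of a Fourier transform is the sum of the function. -/
theorem sum_kz_mul_fourier (Φ : St (X ⊕ Unit)) :
    sum Unit (kz (Sum.inr ()) * sum Unit (hh (Sum.inl (Sum.inr ())) (Sum.inr ()) *
      ren (Sum.map Sum.inl id) Φ : St ((X ⊕ Unit) ⊕ Unit))) = sum Unit Φ := by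
  rw [mul_sum, sum_comm]
  congr 1
  have h := sum_mul_right Φ (hh (Sum.inl (Sum.inr ())) (Sum.inr ()) * kz (Sum.inr ()))
  rw [fourier_kz, one_mul] at h
  conv_rhs => rw [← h]
  congr 1
  simp only [map_mul, ren_hh, ren_kz, ren_ren, rightComm_inl_inr, rightComm_inr]
  rw [← mul_assoc, mul_comm (kz _), hh_comm]
  congr 1
  apply ren_congr
  rintro (x | x) <;> rfl

theorem kz_mul_ze (α : Real.Angle) (i : X) :
    kz i * ze α i = con (ti * (overlap α 0).mor) * kz i := by
  have h := kz_subst i (ze α (Sum.inr ()))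
  have h1 : (con (overlap α 0).mor : St X) = sum Unit (ze α (Sum.inr ()) * kz (Sum.inr ())) := by
    rw [con_overlap]
    simp only [ze_zero, one_mul]
    rfl
  rw [← h1, ren_ze] at h
  apply con_tt_cancel
  rw [show kz i * ze α i = kz i * ze α (Sum.elim id (fun _ => i) (Sum.inr ())) from rfl, h, map_mul,
    ← mul_assoc, ← mul_assoc, con_tt_mul_ti, one_mul, mul_comm]

/-- The Fourier transform of an odd phase is the opposite phase, up to a scalar. -/
theorem exists_fourier_ze {α : Real.Angle} (hα : IsOdd α) : ∃ c ∈ stabScalars,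
    ∀ (X : Type) [Finite X] (i : X),
      sum Unit (hh (Sum.inl i) (Sum.inr ()) * ze α (Sum.inr ())) = con c * ze (-α) i := by
  obtain ⟨c, hc, H⟩ := exists_kx_odd hα
  refine ⟨c * (ti * (overlap (-α) 0).mor), mul_mem hc (mul_mem ti_mem
    (overlap_mem hα.isQuarter.neg isQuarter_zero)), fun X _ i => ?_⟩
  have h := sum_kz_mul_fourier (ze α (Sum.inr ()) * hh (Sum.inl i) (Sum.inr ()))
  simp only [map_mul, ren_ze, ren_hh, Sum.map_inl, Sum.map_inr, id] at h
  have h1 := fourier_kz i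
  have h2 := sum_mul_right (con (c * (ti * (overlap (-α) 0).mor)) * ze (-α) i)
    (hh (Sum.inl i) (Sum.inr ()) * kz (Sum.inr ()))
  rw [h1, one_mul] at h2
  rw [mul_comm, ← h, ← h2]
  congr 1
  have h3 := H _ (Sum.inr ()) (Sum.inl i)
  rw [kx] at h3
  rw [h3]
  have h4 := kz_mul_ze (-α) (Sum.inr () : X ⊕ Unit)
  calc _ = con c * (kz (Sum.inr ()) * ze (-α) (Sum.inr ())) * ze (-α) (Sum.inl i) *
        hh (Sum.inr ()) (Sum.inl i) := by ac_rfl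
    _ = _ := by
      rw [h4, hh_comm, map_mul _ c]
      simp only [map_mul, ren_con, ren_ze]
      ac_rfl

/-- A phase and a Hadamard edge, as a sum of red spiders. -/
theorem exists_ze_mul_hh {α : Real.Angle} (hα : IsOdd α) : ∃ c ∈ stabScalars,
    ∀ (X : Type) [Finite X] (i j : X), ze α i * hh i j =
      con c * (ze (-α) j * sum Unit (ze α (Sum.inr ()) * tri (Sum.inl i) (Sum.inl j) (Sum.inr ()))) := by
  obtain ⟨c, hc, H⟩ := exists_kx_odd hα
  obtain ⟨d, hd, H'⟩ := exists_fourier_ze hα.neg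
  rw [neg_neg] at H'
  refine ⟨c * d, mul_mem hc hd, fun X _ i j => ?_⟩
  have h : con d * sum Unit (ze α (Sum.inr ()) * tri (Sum.inl i) (Sum.inl j) (Sum.inr ())) =
      sum Unit (ze (-α) (Sum.inr ()) * (hh (Sum.inr ()) (Sum.inl i) * hh (Sum.inr ()) (Sum.inl j))) := by
    have h1 := fourier_tri (Sum.inr ()) (Sum.inl i) (Sum.inl j : X ⊕ Unit)
    rw [← sum_con_mul, ← mul_assoc, ← H', ← h1, mul_sum, sum_comm]
    congr 1
    rw [tri_rotate _ _ (Sum.inr ()), tri_rotate _ _ (Sum.inl i)]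
    have h2 := sum_mul_right (tri (Sum.inr ()) (Sum.inl i) (Sum.inl j) : St (X ⊕ Unit))
      (hh (Sum.inl (Sum.inr ())) (Sum.inr ()) * ze (-α) (Sum.inr ()))
    rw [← h2]
    congr 1
    simp only [map_mul, ren_hh, ren_tri, ren_ze, rightComm_inl_inl, rightComm_inl_inr, rightComm_inr]
    rw [hh_comm (Sum.inr ()), mul_comm (hh _ _)]
    ac_rfl
  rw [map_mul, mul_assoc, mul_left_comm (con d), h, mul_sum, ← sum_con_mul, ← fourier_kx]
  congr 1
  rw [H, ren_ze, hh_comm (Sum.inr ()) (Sum.inl i)]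
  ac_rfl

/-- Every product of Hadamard edges at a variable is a character. -/
theorem exists_isChar {ι : Type} (s : Finset ι) : ∃ c ∈ stabScalars,
    ∀ (X : Type) [Finite X] (f : ι → X) (p q : X),
      IsChar c p q (∏ k ∈ s, hh (Sum.inl (f k)) (Sum.inr ())) := by
  classical
  induction s using Finset.induction_on with
  | empty => exact ⟨ti, ti_mem, fun X _ f p q => isChar_one p q⟩
  | insert a s ha ih =>
    obtain ⟨c, hc, H⟩ := ih
    refine ⟨_, mul_mem (mul_mem tt_mem (one_mem _)) hc, fun X _ f p q => ?_⟩
    rw [Finset.prod_insert ha]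
    exact (isChar_hh p q (f a)).mul (H X f p q)

/-- Local complementation: summing over a variable with an odd phase which is joined to `i` and to
the `f k`. -/
theorem exists_sum_odd {α : Real.Angle} (hα : IsOdd α) {ι : Type} (s : Finset ι) : ∃ c ∈ stabScalars,
    ∀ (X : Type) [Finite X] (f : ι → X) (i : X),
      sum Unit (ze α (Sum.inr ()) * hh (Sum.inl i) (Sum.inr ()) *
        ∏ k ∈ s, hh (Sum.inl (f k)) (Sum.inr ())) =
      con c * (ze (-α) i * ((∏ k ∈ s, hh (f k) i) *
        sum Unit (ze α (Sum.inr ()) * ∏ k ∈ s, hh (Sum.inl (f k)) (Sum.inr ())))) := by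
  obtain ⟨c, hc, H⟩ := exists_ze_mul_hh hα
  obtain ⟨d, hd, H'⟩ := exists_isChar s
  refine ⟨c * d, mul_mem hc hd, fun X _ f i => ?_⟩
  have h1 := H' _ (fun k => Sum.inl (f k)) (Sum.inl i) (Sum.inr () : X ⊕ Unit)
  rw [IsChar] at h1
  simp only [map_prod, ren_hh, Sum.elim_inl, Sum.elim_inr, id] at h1
  have h2 : ze α (Sum.inr ()) * hh (Sum.inl i) (Sum.inr ()) *
      ∏ k ∈ s, hh (Sum.inl (f k)) (Sum.inr () : X ⊕ Unit) = ren Sum.inl (con c * ze (-α) i) *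
      ((∏ k ∈ s, hh (Sum.inl (f k)) (Sum.inr ())) * sum Unit (ze α (Sum.inr ()) *
        tri (Sum.inl (Sum.inr ())) (Sum.inl (Sum.inl i)) (Sum.inr ()))) := by
    rw [hh_comm (Sum.inl i), H, map_mul, ren_con, ren_ze]
    ac_rfl
  have h3 := mul_sum (ze α (Sum.inr ())) (tri (Sum.inl (Sum.inl i)) (Sum.inl (Sum.inr ())) (Sum.inr ()) *
        ∏ k ∈ s, hh (Sum.inl (Sum.inl (f k))) (Sum.inr () : (X ⊕ Unit) ⊕ Unit))
  have h4 : sum Unit ((∏ k ∈ s, hh (Sum.inl (f k)) (Sum.inr ())) * sum Unit (ze α (Sum.inr ()) *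
        tri (Sum.inl (Sum.inr ())) (Sum.inl (Sum.inl i)) (Sum.inr ()))) =
      con d * ((∏ k ∈ s, hh (f k) i) *
        sum Unit (ze α (Sum.inr ()) * ∏ k ∈ s, hh (Sum.inl (f k)) (Sum.inr ()))) := by
    rw [mul_sum, sum_comm, mul_sum, ← sum_con_mul]
    congr 1
    simp only [map_mul, map_prod, ren_hh, ren_tri, ren_ze, rightComm_inl_inl, rightComm_inl_inr,
      rightComm_inr] at h3 ⊢
    rw [h1] at h3
    refine Eq.trans ?_ (h3.symm.trans ?_)
    · congr 1
      rw [tri_rotate]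
      ac_rfl
    · ac_rfl
  simp only [h2]
  rw [← mul_sum, h4, map_mul]
  ac_rfl

end elimination

/-! ### Graph functions -/

section graphFunctions

variable {A B C A' B' X Y Z X' Y' : Type} [Finite A] [Finite B] [Finite C] [Finite A'] [Finite B']
  [Finite X] [Finite Y] [Finite Z] [Finite X'] [Finite Y']

/-- The functions that are products of stabilizer scalars, of phases on single variables and of
Hadamard edges between distinct variables. -/
noncomputable def graphFunctions (X : Type) [Finite X] : Submonoid (St X) :=
  Submonoid.closure ({ψ | ∃ c ∈ stabScalars, con c = ψ} ∪ {ψ | ∃ α i, IsQuarter α ∧ ze α i = ψ} ∪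
    {ψ | ∃ i j, i ≠ j ∧ hh i j = ψ})

theorem con_mem {c : St Empty} (hc : c ∈ stabScalars) : (con c : St X) ∈ graphFunctions X :=
  Submonoid.subset_closure (Or.inl (Or.inl ⟨c, hc, rfl⟩))

theorem ze_mem {α : Real.Angle} (hα : IsQuarter α) (i : X) : ze α i ∈ graphFunctions X :=
  Submonoid.subset_closure (Or.inl (Or.inr ⟨α, i, hα, rfl⟩))

theorem hh_mem {i j : X} (h : i ≠ j) : hh i j ∈ graphFunctions X :=
  Submonoid.subset_closure (Or.inr ⟨i, j, h, rfl⟩)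

theorem ren_mem {f : X → Y} (hf : f.Injective) {ψ : St X} (hψ : ψ ∈ graphFunctions X) :
    ren f ψ ∈ graphFunctions Y := by
  have h : graphFunctions X ≤ (graphFunctions Y).comap (ren f) := by
    refine Submonoid.closure_le.2 ?_
    rintro _ ((⟨c, hc, rfl⟩ | ⟨α, i, hα, rfl⟩) | ⟨i, j, hij, rfl⟩) <;>
      rw [SetLike.mem_coe, Submonoid.mem_comap]
    · rw [ren_con]; exact con_mem hc
    · rw [ren_ze]; exact ze_mem hα _
    · rw [ren_hh]; exact hh_mem (hf.ne hij)
  exact h hψ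

/-- Double edges cancel. -/
theorem hh_mul_hh (i j : X) : hh i j * hh i j = con (ti * ti) := by
  rw [← mul_one (con (ti * ti)), ← hopf i j]
  have h : (con ti * con tt : St X) = 1 := by rw [mul_comm, con_tt_mul_ti]
  calc _ = (con ti * con tt) * (con ti * con tt) * (hh i j * hh i j) := by rw [h, one_mul, one_mul]
    _ = _ := by rw [map_mul]; ac_rfl

open Classical in
/-- An edge is added or, if it is present already, cancelled. -/
theorem hh_mul_prod (s : Finset X) (x : X) : ∃ c ∈ stabScalars, ∃ t : Finset X,
    ∀ (Y : Type) [Finite Y] (f : X → Y) (y : Y),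
      hh (f x) y * ∏ k ∈ s, hh (f k) y = con c * ∏ k ∈ t, hh (f k) y := by
  by_cases hx : x ∈ s
  · refine ⟨ti * ti, mul_mem ti_mem ti_mem, s.erase x, fun Y _ f y => ?_⟩
    rw [← Finset.mul_prod_erase s _ hx, ← mul_assoc, hh_mul_hh]
  · refine ⟨1, one_mem _, insert x s, fun Y _ f y => ?_⟩
    rw [Finset.prod_insert hx, map_one, one_mul]

theorem prod_mul_prod (s s' : Finset X) : ∃ c ∈ stabScalars, ∃ t : Finset X,
    ∀ (Y : Type) [Finite Y] (f : X → Y) (y : Y),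
      (∏ k ∈ s, hh (f k) y) * ∏ k ∈ s', hh (f k) y = con c * ∏ k ∈ t, hh (f k) y := by
  classical
  induction s using Finset.induction_on with
  | empty => exact ⟨1, one_mem _, s', fun Y _ f y => by simp⟩
  | insert a s ha ih =>
    obtain ⟨c, hc, t, H⟩ := ih
    obtain ⟨d, hd, t', H'⟩ := hh_mul_prod t a
    refine ⟨c * d, mul_mem hc hd, t', fun Y _ f y => ?_⟩
    rw [Finset.prod_insert ha, mul_assoc, H, mul_left_comm, H', map_mul, mul_assoc]

/-- Every graph function splits into the factors that involve a given variable and the others. -/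
theorem exists_eq_of_mem {M : St (X ⊕ Unit)} (hM : M ∈ graphFunctions (X ⊕ Unit)) :
    ∃ α, IsQuarter α ∧ ∃ s : Finset X, ∃ M' ∈ graphFunctions X,
      M = ze α (Sum.inr ()) * (∏ x ∈ s, hh (Sum.inl x) (Sum.inr ())) * ren Sum.inl M' := by
  induction hM using Submonoid.closure_induction_left with
  | one => exact ⟨0, isQuarter_zero, ∅, 1, one_mem _, by simp [ze_zero]⟩
  | mul_left x hx y hy ih =>
    obtain ⟨α, hα, s, M', hM', rfl⟩ := ih
    have hedge : ∀ i : X, ∃ β, IsQuarter β ∧ ∃ t : Finset X, ∃ M'' ∈ graphFunctions X,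
        hh (Sum.inl i) (Sum.inr ()) * (ze α (Sum.inr ()) * (∏ x ∈ s, hh (Sum.inl x) (Sum.inr ())) *
          ren Sum.inl M') =
        ze β (Sum.inr ()) * (∏ x ∈ t, hh (Sum.inl x) (Sum.inr ())) * ren Sum.inl M'' := by
      intro i
      obtain ⟨c, hc, t, H⟩ := hh_mul_prod s i
      refine ⟨α, hα, t, con c * M', mul_mem (con_mem hc) hM', ?_⟩
      have h := H (X ⊕ Unit) Sum.inl (Sum.inr ())
      calc _ = ze α (Sum.inr ()) * (hh (Sum.inl i) (Sum.inr ()) *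
            ∏ x ∈ s, hh (Sum.inl x) (Sum.inr ())) * ren Sum.inl M' := by ac_rfl
        _ = _ := by
          rw [h, map_mul, ren_con]
          ac_rfl
    rcases hx with (⟨c, hc, rfl⟩ | ⟨β, i | i, hβ, rfl⟩) | ⟨i | i, j | j, hij, rfl⟩
    · refine ⟨α, hα, s, con c * M', mul_mem (con_mem hc) hM', ?_⟩
      rw [map_mul, ren_con]
      ac_rfl
    · refine ⟨α, hα, s, ze β i * M', mul_mem (ze_mem hβ i) hM', ?_⟩
      rw [map_mul, ren_ze]
      ac_rfl
    · refine ⟨β + α, hβ.add hα, s, M', hM', ?_⟩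
      rw [← ze_mul]
      ac_rfl
    · refine ⟨α, hα, s, hh i j * M', mul_mem (hh_mem fun h => hij (congrArg _ h)) hM', ?_⟩
      rw [map_mul, ren_hh]
      ac_rfl
    · exact hedge i
    · rw [hh_comm]
      exact hedge j
    · exact absurd rfl hij

/-- Repeated local complementation at a variable of odd phase. -/
theorem sum_odd_mem {α : Real.Angle} (hα : IsOdd α) (s : Finset X) :
    sum Unit (ze α (Sum.inr ()) * ∏ x ∈ s, hh (Sum.inl x) (Sum.inr ())) ∈ graphFunctions X := by
  classical
  induction s using Finset.induction_on with
  | empty =>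
    rw [Finset.prod_empty, mul_one, ← con_gr]
    exact con_mem (gr_mem hα.isQuarter)
  | insert a s ha ih =>
    obtain ⟨c, hc, H⟩ := exists_sum_odd hα s
    have h := H X id a
    simp only [id] at h
    rw [Finset.prod_insert ha, ← mul_assoc, h]
    refine mul_mem (con_mem hc) (mul_mem (ze_mem hα.neg.isQuarter _) (mul_mem (prod_mem ?_) ih))
    exact fun x hx => hh_mem fun h => ha (h ▸ hx)

/-- The even multiples of `π/2`. -/
def IsEven (α : Real.Angle) : Prop := α = 0 ∨ α = phPi

theorem half_add_half : phHalf + phHalf = phPi := by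
  rw [phPi, phHalf, ← Real.Angle.coe_add]
  congr 1
  ring

theorem pi_add_pi : phPi + phPi = 0 := by
  rw [phPi, ← Real.Angle.coe_add, ← Real.Angle.coe_two_pi]
  congr 1
  ring

theorem half_add_pi : phHalf + phPi = -phHalf := by
  rw [eq_neg_iff_add_eq_zero, add_right_comm, half_add_half, pi_add_pi]

theorem IsOdd.add_isEven {α β : Real.Angle} (hα : IsOdd α) (hβ : IsEven β) : IsOdd (α + β) := by
  rcases hβ with rfl | rfl
  · rwa [add_zero]
  · rcases hα with rfl | rfl
    · exact Or.inr half_add_pi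
    · refine Or.inl ?_
      rw [← half_add_pi, add_assoc, pi_add_pi, add_zero]

theorem isEven_half_add {α : Real.Angle} (hα : IsOdd α) : IsEven (phHalf + α) := by
  rcases hα with rfl | rfl
  · exact Or.inr half_add_half
  · exact Or.inl (add_neg_cancel _)

theorem IsQuarter.odd_or_even {α : Real.Angle} (hα : IsQuarter α) : IsOdd α ∨ IsEven α := by
  obtain ⟨k, rfl⟩ := hα
  have step : ∀ β, IsOdd β ∨ IsEven β → IsOdd (β + phHalf) ∨ IsEven (β + phHalf) := by
    rintro β (h | h)
    · exact Or.inr (add_comm phHalf β ▸ isEven_half_add h)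
    · exact Or.inl (add_comm phHalf β ▸ IsOdd.add_isEven (Or.inl rfl) h)
  have step' : ∀ β, IsOdd β ∨ IsEven β → IsOdd (β - phHalf) ∨ IsEven (β - phHalf) := by
    intro β h
    have h3 := step _ (step _ (step _ h))
    rwa [add_assoc, add_assoc, half_add_half, half_add_pi, ← sub_eq_add_neg] at h3
  induction k using Int.induction_on with
  | zero => exact Or.inr (Or.inl (zero_zsmul _))
  | succ n ih => rw [add_zsmul, one_zsmul]; exact step _ ih
  | pred n ih => rw [sub_zsmul, one_zsmul]; exact step' _ ih

theorem sum_odd_mul_mem {α : Real.Angle} (hα : IsOdd α) (s s' : Finset X) {Φ : St X}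
    (hΦ : Φ ∈ graphFunctions X) :
    sum Unit (ze α (Sum.inr ()) * ((∏ x ∈ s, hh (Sum.inl x) (Sum.inr ())) *
      ∏ x ∈ s', hh (Sum.inl x) (Sum.inr ())) * ren Sum.inl Φ) ∈ graphFunctions X := by
  obtain ⟨c, hc, t, H⟩ := prod_mul_prod s s'
  rw [sum_mul_right, H, mul_left_comm, sum_con_mul]
  exact mul_mem (mul_mem (con_mem hc) (sum_odd_mem hα t)) hΦ

/-- After summing over the neighbour of odd phase, the variable of even phase has an odd one. -/
theorem sum_sum_mem_of_odd {α β : Real.Angle} (hα : IsOdd α) (hβ : IsEven β) (s s' : Finset X) :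
    sum Unit ((ze β (Sum.inr ()) * ∏ x ∈ s', hh (Sum.inl x) (Sum.inr ())) *
      sum Unit (ze α (Sum.inr ()) * hh (Sum.inl (Sum.inr ())) (Sum.inr ()) *
        ∏ x ∈ s, hh (Sum.inl (Sum.inl x)) (Sum.inr ())) : St (X ⊕ Unit)) ∈ graphFunctions X := by
  obtain ⟨c, hc, H⟩ := exists_sum_odd hα s
  have h := H (X ⊕ Unit) Sum.inl (Sum.inr ())
  have hT := sum_odd_mem hα s
  have h1 := sum_odd_mul_mem (hα.neg.add_isEven hβ) s s' hT
  rw [ren_sum] at h1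
  simp only [map_mul, map_prod, ren_ze, ren_hh, Sum.map_inl, Sum.map_inr, id] at h1
  rw [h]
  have h2 := mul_mem (con_mem hc) h1
  rw [← sum_con_mul] at h2
  convert h2 using 2
  rw [← ze_mul]
  ac_rfl

/-- The case of two adjacent variables of even phase. -/
theorem sum_sum_mem_of_even {α β : Real.Angle} (hα : IsEven α) (hβ : IsEven β) (s s' : Finset X) :
    sum Unit ((ze β (Sum.inr ()) * ∏ x ∈ s', hh (Sum.inl x) (Sum.inr ())) *
      sum Unit (ze α (Sum.inr ()) * hh (Sum.inl (Sum.inr ())) (Sum.inr ()) *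
        ∏ x ∈ s, hh (Sum.inl (Sum.inl x)) (Sum.inr ())) : St (X ⊕ Unit)) ∈ graphFunctions X := by
  have hα' : IsOdd (phHalf + α) := IsOdd.add_isEven (Or.inl rfl) hα
  have hβ' : IsOdd (phHalf + β) := IsOdd.add_isEven (Or.inl rfl) hβ
  obtain ⟨c, hc, H⟩ := exists_sum_odd hα' s
  obtain ⟨d, hd, H'⟩ := exists_sum_odd hβ' s'
  obtain ⟨a, ha, b, hb, hab, hk⟩ := exists_kx_half
  have hhk : ∀ (Y : Type) [Finite Y] (i j : Y), hh i j = con b * (ze phHalf i * (ze phHalf j * kx phHalf i j)) := by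
    intro Y _ i j
    have h1 := ze_mul_ze_neg phHalf i
    have h2 := ze_mul_ze_neg phHalf j
    have h3 : (con a * con b : St Y) = 1 := by rw [← map_mul, hab, map_one]
    rw [hk]
    calc _ = (con a * con b) * (ze phHalf i * ze (-phHalf) i) * (ze phHalf j * ze (-phHalf) j) * hh i j := by
          rw [h1, h2, h3, one_mul, one_mul, one_mul]
      _ = _ := by ac_rfl
  have hT := sum_odd_mem hα' s
  have hT' := sum_odd_mem hβ' s'
  have hγ : IsOdd (-(phHalf + α) + (phHalf + -(phHalf + β))) := hα'.neg.add_isEven (isEven_half_add hβ'.neg)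
  -- a new variable on the edge makes both phases odd
  have key : sum Unit ((ze β (Sum.inr ()) * ∏ x ∈ s', hh (Sum.inl x) (Sum.inr ())) *
      sum Unit (ze α (Sum.inr ()) * hh (Sum.inl (Sum.inr ())) (Sum.inr ()) *
        ∏ x ∈ s, hh (Sum.inl (Sum.inl x)) (Sum.inr ())) : St (X ⊕ Unit)) =
      con b * sum Unit (ze phHalf (Sum.inr ()) *
        sum Unit (ze (phHalf + β) (Sum.inr ()) * hh (Sum.inl (Sum.inr ())) (Sum.inr ()) *
          ∏ x ∈ s', hh (Sum.inl (Sum.inl x)) (Sum.inr ())) *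
        sum Unit (ze (phHalf + α) (Sum.inr ()) * hh (Sum.inl (Sum.inr ())) (Sum.inr ()) *
          ∏ x ∈ s, hh (Sum.inl (Sum.inl x)) (Sum.inr ())) : St (X ⊕ Unit)) := by
    have h1 : ∀ Φ Ψ : St ((X ⊕ Unit) ⊕ Unit), ∀ φ : St (X ⊕ Unit), φ * sum Unit Φ * sum Unit Ψ =
        sum Unit (sum Unit (ren (Sum.inl ∘ Sum.inl) φ * ren Sum.inl Φ * ren (Sum.map Sum.inl id) Ψ)) := by
      intro Φ Ψ φ
      rw [mul_sum φ Φ, ← sum_mul_right, ren_sum]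
      congr 1
      rw [mul_sum]
      simp
    rw [h1, sum_comm, ren_sum, ← sum_con_mul]
    congr 1
    rw [sum_comm, ← sum_con_mul, mul_sum]
    congr 1
    simp only [map_mul, map_prod, ren_ze, ren_hh, Function.comp, Sum.map_inl, Sum.map_inr, id,
      rightComm_inl_inl, rightComm_inl_inr, rightComm_inr]
    rw [hhk, kx]
    simp only [← ze_mul]
    have h2 := mul_sum (ze β (Sum.inl (Sum.inr ())) * ze phHalf (Sum.inl (Sum.inr ())) *
      (∏ x ∈ s', hh (Sum.inl (Sum.inl x)) (Sum.inl (Sum.inr ()))) * (ze α (Sum.inr ()) *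
      ze phHalf (Sum.inr ()) * ∏ x ∈ s, hh (Sum.inl (Sum.inl x)) (Sum.inr () : (X ⊕ Unit) ⊕ Unit)))
      (hh (Sum.inl (Sum.inl (Sum.inr ()))) (Sum.inr ()) * (ze phHalf (Sum.inr ()) *
        hh (Sum.inl (Sum.inr ())) (Sum.inr ())))
    simp only [map_mul, map_prod, ren_ze, ren_hh] at h2
    have h3 := congrArg (fun φ => con b * φ) h2
    refine Eq.trans ?_ (h3.trans ?_)
    · ac_rfl
    · rw [hh_comm (Sum.inr ()), hh_comm (Sum.inr ())]
      congr 2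
      ac_rfl
  rw [key, H, H']
  obtain h1 := sum_odd_mul_mem hγ s s' (mul_mem hT hT')
  simp only [map_mul, ren_sum, map_prod, ren_ze, ren_hh, Sum.map_inl, Sum.map_inr, id] at h1
  have h2 := mul_mem (con_mem (mul_mem (mul_mem hc hd) hb)) h1
  rw [← sum_con_mul] at h2
  rw [← sum_con_mul]
  convert h2 using 2
  simp only [← ze_mul, map_mul]
  ac_rfl

/-- Summing over a variable `w` of even phase and one of its neighbours. -/
theorem sum_sum_mem {β : Real.Angle} (hβ : IsEven β) (s : Finset (X ⊕ Unit)) (hs : Sum.inr () ∈ s)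
    {M : St (X ⊕ Unit)} (hM : M ∈ graphFunctions (X ⊕ Unit)) :
    sum Unit (sum Unit (ze β (Sum.inr ()) * (∏ x ∈ s, hh (Sum.inl x) (Sum.inr ())) *
      ren Sum.inl M)) ∈ graphFunctions X := by
  obtain ⟨α, hα, t, M', hM', rfl⟩ := exists_eq_of_mem hM
  have h : sum Unit (sum Unit (ze β (Sum.inr ()) * (∏ x ∈ s, hh (Sum.inl x) (Sum.inr ())) *
      ren Sum.inl (ze α (Sum.inr ()) * (∏ x ∈ t, hh (Sum.inl x) (Sum.inr ())) * ren Sum.inl M'))) =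
      sum Unit ((ze β (Sum.inr ()) * ∏ x ∈ s.toLeft, hh (Sum.inl x) (Sum.inr ())) *
      sum Unit (ze α (Sum.inr ()) * hh (Sum.inl (Sum.inr ())) (Sum.inr ()) *
        ∏ x ∈ t, hh (Sum.inl (Sum.inl x)) (Sum.inr ())) : St (X ⊕ Unit)) * M' := by
    rw [sum_comm, ← sum_mul_right]
    congr 1
    rw [mul_sum, ← sum_mul_right]
    congr 1
    have h1 : s.toRight = Finset.univ := by
      ext ⟨⟩
      simpa using hs
    conv_lhs => rw [← s.toLeft_disjSum_toRight, Finset.prod_disjSum, h1]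
    simp only [map_mul, map_prod, ren_ze, ren_hh, ren_ren, Finset.univ_unique, Finset.prod_singleton,
      PUnit.default_eq_unit, rightComm_inl_inl, rightComm_inl_inr, rightComm_inr]
    rw [hh_comm (Sum.inr ()) (Sum.inl (Sum.inr ()))]
    have h2 : ren ((rightComm X Unit Unit) ∘ Sum.inl ∘ Sum.inl) M' = ren (Sum.inl ∘ Sum.inl) M' := rfl
    rw [h2]
    ac_rfl
  rw [h]
  refine mul_mem ?_ hM'
  rcases hα.odd_or_even with h | h
  · exact sum_sum_mem_of_odd h hβ t _
  · exact sum_sum_mem_of_even h hβ t _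

/-- Summing over a variable gives a graph function unless its phase is even and it has a neighbour. -/
theorem sum_mem_or {M : St (X ⊕ Unit)} (hM : M ∈ graphFunctions (X ⊕ Unit)) :
    sum Unit M ∈ graphFunctions X ∨ ∃ α, IsEven α ∧ ∃ s : Finset X, s.Nonempty ∧
      ∃ M' ∈ graphFunctions X,
        M = ze α (Sum.inr ()) * (∏ x ∈ s, hh (Sum.inl x) (Sum.inr ())) * ren Sum.inl M' := by
  obtain ⟨α, hα, s, M', hM', rfl⟩ := exists_eq_of_mem hM
  rcases hα.odd_or_even with h | h
  · left
    rw [sum_mul_right]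
    exact mul_mem (sum_odd_mem h s) hM'
  · rcases s.eq_empty_or_nonempty with rfl | hs
    · left
      rw [Finset.prod_empty, mul_one, sum_mul_right, ← con_gr]
      exact mul_mem (con_mem (gr_mem hα)) hM'
    · exact Or.inr ⟨α, h, s, hs, M', hM', rfl⟩

end graphFunctions

/-! ### Stabilizer diagrams as sums of graph functions -/

section sumFunctions

variable {A B C A' B' X Y Z X' Y' : Type} [Finite A] [Finite B] [Finite C] [Finite A'] [Finite B']
  [Finite X] [Finite Y] [Finite Z] [Finite X'] [Finite Y']

/-- The functions obtained from graph functions by summing over some of the variables. -/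
def IsGraphSum (ψ : St X) : Prop :=
  ∃ (V : Type) (_ : Finite V), ∃ M ∈ graphFunctions (X ⊕ V), ψ = sum V M

theorem isGraphSum_of_mem {ψ : St X} (h : ψ ∈ graphFunctions X) : IsGraphSum ψ := by
  refine ⟨Empty, inferInstance, ren Sum.inl ψ, ren_mem Sum.inl_injective h, ?_⟩
  rw [sum_isEmpty, ren_ren]
  exact (ren_id' _ (fun x => rfl) ψ).symm

theorem IsGraphSum.mul {φ ψ : St X} (hφ : IsGraphSum φ) (hψ : IsGraphSum ψ) : IsGraphSum (φ * ψ) := by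
  obtain ⟨V, _, M, hM, rfl⟩ := hφ
  obtain ⟨V', _, M', hM', rfl⟩ := hψ
  refine ⟨V ⊕ V', inferInstance, ren (Equiv.sumAssoc X V V') (ren Sum.inl M * ren (Sum.map Sum.inl id) M'),
    ren_mem (Equiv.injective _) (mul_mem (ren_mem Sum.inl_injective hM)
      (ren_mem (Sum.map_injective.2 ⟨Sum.inl_injective, Function.injective_id⟩) hM')), ?_⟩
  rw [← sum_sum, ← mul_sum, ← ren_sum, sum_mul_right]

theorem IsGraphSum.ren {f : X → Y} (hf : f.Injective) {ψ : St X} (hψ : IsGraphSum ψ) :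
    IsGraphSum (ren f ψ) := by
  obtain ⟨V, _, M, hM, rfl⟩ := hψ
  exact ⟨V, inferInstance, _, ren_mem (Sum.map_injective.2 ⟨hf, Function.injective_id⟩) hM, ren_sum f M⟩

theorem IsGraphSum.sum {ψ : St (X ⊕ A)} (hψ : IsGraphSum ψ) : IsGraphSum (sum A ψ) := by
  obtain ⟨V, _, M, hM, rfl⟩ := hψ
  exact ⟨A ⊕ V, inferInstance, _, ren_mem (Equiv.injective _) hM, sum_sum M⟩

theorem isGraphSum_prod {ι : Type} (s : Finset ι) {f : ι → St X} (h : ∀ i ∈ s, IsGraphSum (f i)) :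
    IsGraphSum (∏ i ∈ s, f i) :=
  Finset.prod_induction f IsGraphSum (fun _ _ => IsGraphSum.mul) (isGraphSum_of_mem (one_mem _)) h

/-- An equality is a path of two Hadamard edges. -/
theorem isGraphSum_dl {i j : X} : IsGraphSum (dl i j) := by
  rw [← sum_hh_hh]
  exact (isGraphSum_of_mem (mul_mem (hh_mem Sum.inl_ne_inr) (hh_mem Sum.inl_ne_inr))).sum

theorem isGraphSum_K (D : Diagram A B) (hD : D.IsStabilizer) : IsGraphSum (K D.mor) := by
  have key : ∀ {A B : Type} (D : Diagram A B), ∀ [Finite A] [Finite B], D.IsStabilizer →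
      IsGraphSum (K D.mor) := by
    intro A B D
    induction D with
    | @wires A B _ _ e =>
      intro _ _ _
      let _ := Fintype.ofFinite A
      rw [show (wires e).mor = W e from rfl, K_W]
      exact isGraphSum_prod _ fun _ _ => isGraphSum_dl
    | cup =>
      intro _ _ _
      exact K_cup ▸ isGraphSum_dl
    | cap =>
      intro _ _ _
      exact K_cap ▸ isGraphSum_dl
    | green A B α =>
      intro _ _ h
      let _ := Fintype.ofFinite A
      let _ := Fintype.ofFinite B
      have := K_gr (A := A) (B := B) α
      rw [show (green A B α).mor = gr A B α from rfl, this]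
      exact (((isGraphSum_of_mem (ze_mem h _)).mul (isGraphSum_prod _ fun _ _ => isGraphSum_dl)).mul
        (isGraphSum_prod _ fun _ _ => isGraphSum_dl)).sum
    | red A B α =>
      intro _ _ h
      let _ := Fintype.ofFinite A
      let _ := Fintype.ofFinite B
      have := K_rd (A := A) (B := B) α
      rw [show (red A B α).mor = rd A B α from rfl, this]
      exact (isGraphSum_of_mem (mul_mem (mul_mem (ze_mem h _) (prod_mem fun _ _ => hh_mem Sum.inl_ne_inr))
        (prod_mem fun _ _ => hh_mem Sum.inr_ne_inl))).sum
    | had =>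
      intro _ _ _
      exact K_had ▸ isGraphSum_of_mem (hh_mem Sum.inl_ne_inr)
    | star =>
      intro _ _ _
      rw [K_state]
      have h : (Diagram.star.mor : St Empty) ∈ stabScalars := ⟨Diagram.star, trivial, rfl⟩
      rw [← con_empty Diagram.star.mor, ren_con]
      exact isGraphSum_of_mem (con_mem h)
    | comp D E ihD ihE =>
      intro _ _ h
      have := D.mor.finite.2
      rw [mor_comp, K_comp]
      refine (((ihD h.1).ren ?_).mul ((ihE h.2).ren ?_)).sum
      · exact Sum.map_injective.2 ⟨Sum.inl_injective, Function.injective_id⟩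
      · rintro (x | x) (y | y) h <;> simp_all
    | tensor D E ihD ihE =>
      intro _ _ h
      have := D.mor.finite.1
      have := D.mor.finite.2
      have := E.mor.finite.1
      have := E.mor.finite.2
      rw [mor_tensor, K_tensor]
      exact ((ihD h.1).ren (Sum.map_injective.2 ⟨Sum.inl_injective, Sum.inl_injective⟩)).mul
        ((ihE h.2).ren (Sum.map_injective.2 ⟨Sum.inr_injective, Sum.inr_injective⟩))
  exact key D hD

theorem isGraphSum_mor (D : Diagram Empty X) (hD : D.IsStabilizer) : IsGraphSum (D.mor : St X) := by
  have h := isGraphSum_K D hD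
  rw [K_state] at h
  have h1 := h.ren (f := Sum.elim Empty.elim id) (by
    rintro (x | x) (y | y) h
    exacts [x.elim, x.elim, y.elim, congrArg _ h])
  rw [ren_ren] at h1
  rwa [ren_id' (Sum.elim Empty.elim id ∘ Sum.inr) fun x => rfl] at h1

end sumFunctions

/-! ### Local operators and graph states -/

section localOperators

variable {A B C X Y Z : Type} [Finite A] [Finite B] [Finite C] [Finite X] [Finite Y] [Finite Z] {n : ℕ}

/-- A diagram acts on a state by summation against its kernel. -/
theorem state_comp (ψ : St A) (D : Mor A B) :
    ψ ≫ₘ D = sum A (ren Sum.inr ψ * ren Sum.swap (K D)) := by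
  have h := congrArg (ren (Sum.elim Empty.elim id)) (K_comp ψ D)
  rw [K_state, K_state, ren_ren, ren_id' (Sum.elim Empty.elim id ∘ Sum.inr) fun x => rfl, ren_sum] at h
  rw [h]
  simp only [map_mul, ren_ren]
  congr 2
  apply ren_congr
  rintro (x | x) <;> rfl

theorem con_mul_comp (c : St Empty) (ψ : St A) (D : Mor A B) :
    (con c * ψ) ≫ₘ D = con c * (ψ ≫ₘ D) := by
  rw [state_comp, state_comp, map_mul, ren_con, mul_assoc, sum_con_mul]

theorem scale_mor (s : Diagram Empty Empty) (D : Diagram Empty X) :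
    (scale s D).mor = con s.mor * (D.mor : St X) := by
  have h := congrArg (ren (Sum.elim Empty.elim id)) (K_scale s D)
  rwa [map_mul, ren_con, K_state, K_state, ren_ren, ren_ren,
    ren_id' (Sum.elim Empty.elim id ∘ Sum.inr) fun x => rfl,
    ren_id' (Sum.elim Empty.elim id ∘ Sum.inr) fun x => rfl] at h

theorem finTensor_comp {n : ℕ} {A B C : Fin n → Type} [∀ i, Finite (A i)] [∀ i, Finite (B i)]
    [∀ i, Finite (C i)] (D : ∀ i, Diagram (A i) (B i)) (E : ∀ i, Diagram (B i) (C i)) :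
    (finTensor D).mor ≫ₘ (finTensor E).mor = (finTensor fun i => D i ⨾ E i).mor := by
  induction n with
  | zero =>
    exact (W_comp _ _).trans (W_congr fun x => x.1.elim0)
  | succ n ih =>
    have h : ∀ {A B : Fin (n + 1) → Type} [∀ i, Finite (A i)] [∀ i, Finite (B i)]
        (D : ∀ i, Diagram (A i) (B i)), (finTensor D).mor =
        W (sigmaFinSucc A) ≫ₘ ((D 0).mor ⊗ₘ (finTensor fun i => D i.succ).mor) ≫ₘ
          W (sigmaFinSucc B).symm := by
      intro A B _ _ D
      rw [← comp_assoc]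
      rfl
    rw [h, h, h, comp_assoc, comp_assoc, W_comp_assoc, ← ih, Equiv.symm_trans_self, mor_comp,
      interchange, comp_assoc]
    congr 2
    exact id_comp _

theorem onEach_comp (U V : Fin n → Diagram Unit Unit) :
    (onEach U).mor ≫ₘ (onEach V).mor = (onEach fun i => U i ⨾ V i).mor := by
  have h : ∀ U : Fin n → Diagram Unit Unit, (onEach U).mor =
      W (Equiv.sigmaUnique (Fin n) fun _ => Unit).symm ≫ₘ (finTensor U).mor ≫ₘ
        W (Equiv.sigmaUnique (Fin n) fun _ => Unit) := by
    intro U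
    rw [← comp_assoc]
    rfl
  rw [h, h, h, ← finTensor_comp, comp_assoc, comp_assoc, W_comp_assoc, Equiv.self_trans_symm, comp_assoc]
  congr 2
  exact id_comp _

/-- The action of a Hadamard node on one of the variables. -/
theorem comp_onEach_had (ψ : St (Fin n)) (i : Fin n) :
    ψ ≫ₘ (onEach (Function.update (fun _ => idw Unit) i had)).mor =
      sum Unit (hh (Sum.inl i) (Sum.inr ()) * ren (fun j => if j = i then Sum.inr () else Sum.inl j) ψ) := by
  let f : Fin n → Fin n ⊕ Unit := fun j => if j = i then Sum.inr () else Sum.inl j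
  have h1 : ren Sum.swap (K (onEach (Function.update (fun _ => idw Unit) i had)).mor) =
      hh (Sum.inl i) (Sum.inr i) * ∏ j ∈ Finset.univ.erase i, dl (Sum.inl j) (Sum.inr j) := by
    rw [K_onEach, ← Finset.mul_prod_erase _ _ (Finset.mem_univ i), map_mul, map_prod,
      Function.update_self, show had.mor = hadM from rfl, K_had, ren_hh, ren_hh, hh_comm]
    congr 1
    refine Finset.prod_congr rfl fun j hj => ?_
    rw [Function.update_of_ne (Finset.ne_of_mem_erase hj), show (idw Unit).mor = ident Unit from rfl,
      K_ident, diag_unit, ren_dl, ren_dl, dl_comm]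
    rfl
  have h2 := sum_delta' (Sum.inr i) (hh (Sum.inl (Sum.inl i)) (Sum.inr ()) : St ((Fin n ⊕ Fin n) ⊕ Unit))
  rw [ren_hh] at h2
  have h3 := sum_delta_all f (hh (Sum.inl (Sum.inl i)) (Sum.inl (Sum.inr ())) * ren Sum.inr ψ)
  rw [map_mul, ren_hh, ren_ren, ← Finset.mul_prod_erase _ _ (Finset.mem_univ i)] at h3
  refine Eq.trans ?_ (congrArg (sum Unit) h3)
  rw [state_comp, h1, ← mul_assoc, mul_comm, ← mul_assoc]
  simp only [Sum.elim_inl, Sum.elim_inr, id] at h2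
  rw [← h2, mul_sum, sum_comm]
  congr 2
  simp only [map_mul, map_prod, ren_hh, ren_dl, ren_ren, rightComm_inl_inl, rightComm_inl_inr,
    rightComm_inr]
  have h4 : ∏ j ∈ Finset.univ.erase i, dl (Sum.inl (f j)) (Sum.inr j) =
      ∏ j ∈ Finset.univ.erase i, dl (Sum.inl (Sum.inl j)) (Sum.inr j : (Fin n ⊕ Unit) ⊕ Fin n) :=
    Finset.prod_congr rfl fun j hj => by simp [f, Finset.ne_of_mem_erase hj]
  have h5 : f i = Sum.inr () := if_pos rfl
  rw [h4, h5]
  have h6 : ren (rightComm (Fin n) (Fin n) Unit ∘ Sum.inl ∘ Sum.inr) ψ =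
    ren (Sum.inr : _ → (Fin n ⊕ Unit) ⊕ Fin n) ψ := rfl
  rw [h6]
  ac_rfl

/-- Hadamard nodes on one output cancel, being involutions. -/
theorem had_had (ψ : St (Fin n)) (i : Fin n) :
    (ψ ≫ₘ (onEach (Function.update (fun _ => idw Unit) i had)).mor) ≫ₘ
      (onEach (Function.update (fun _ => idw Unit) i had)).mor = ψ := by
  rw [comp_onEach_had, comp_onEach_had, ren_sum]
  have h := fourier_inv i (ren (fun j => if j = i then Sum.inr () else Sum.inl j) ψ)
  rw [ren_ren, ren_ren, ren_id' (Sum.elim id (fun _ => i) ∘ _)] at h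
  · refine Eq.trans ?_ h
    simp only [map_mul, ren_hh, ren_ren, Sum.map_inl, if_true]
    refine congrArg (sum Unit) (congrArg _ (congrArg (sum Unit) (congrArg _ (ren_congr ?_ ψ))))
    intro j
    by_cases hj : j = i <;> simp [hj]
  · intro j
    by_cases hj : j = i <;> simp [hj]

/-- Phase shifts on the outputs multiply a state by phases. -/
theorem comp_onEach_gphase (ψ : St (Fin n)) (α : Fin n → Real.Angle) :
    ψ ≫ₘ (onEach fun i => gphase (α i)).mor = ψ * ∏ i, ze (α i) i := by
  rw [state_comp, K_onEach]
  have h := sum_delta_all id (ren Sum.inr ψ * ∏ i : Fin n, ze (α i) (Sum.inl i))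
  rw [map_mul, ren_ren, ren_id' (Sum.elim id id ∘ Sum.inr) fun x => rfl] at h
  simp only [map_prod, ren_ze, Sum.elim_inl, id] at h
  rw [← h]
  congr 1
  rw [mul_assoc, ← Finset.prod_mul_distrib]
  congr 1
  rw [map_prod]
  refine Finset.prod_congr rfl fun i _ => ?_
  rw [show (gphase (α i)).mor = gr Unit Unit (α i) from rfl, K_gphase]
  simp only [map_mul, ren_dl, ren_ze, Sum.map_inl, Sum.map_inr, Sum.swap_inl, Sum.swap_inr]
  rw [mul_comm, dl_comm]

end localOperators

section graphState

variable {n k : ℕ} {G : SimpleGraph (Fin n)}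

theorem K_green_star (L : Type) [Fintype L] : K (gr Empty (Unit ⊕ L) 0) =
    ∏ l : L, dl (Sum.inr (Sum.inl ())) (Sum.inr (Sum.inr l)) := by
  rw [K_gr]
  simp only [ze_zero, one_mul, Finset.univ_eq_empty, Finset.prod_empty, Fintype.prod_sum_type,
    Finset.univ_unique, Finset.prod_singleton, PUnit.default_eq_unit]
  rw [mul_comm, sum_delta']
  simp [map_prod]

theorem K_hadCap : K hadCap.mor = hh (Sum.inl (Sum.inl ())) (Sum.inl (Sum.inr ())) := by
  rw [show hadCap.mor = (hadM ⊗ₘ ident Unit) ≫ₘ capM from rfl, capM_eq, K_comp_app, app_comp, app_P,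
    app_discard, K_tensor, K_had, K_ident, diag_unit]
  simp only [map_mul, ren_hh, ren_dl, Sum.map_inl, Sum.map_inr, id]
  rw [sum_delta]
  simp

/-- A graph state is the product of the Hadamard edges of its graph. -/
theorem graphState_mor (ε : Fin k ≃ Edge G) :
    (graphState ε).mor = ∏ j, hh (ε j).1.1 (ε j).1.2 := by
  let S : St (Fin n ⊕ (Σ _ : Fin k, Unit ⊕ Unit)) := (W (sigmaNone n).symm ≫ₘ
    (finTensor (fun v : Fin n => green Empty (Unit ⊕ Leg ε v) 0)).mor) ≫ₘ W (wiring ε)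
  let F : Mor (Σ _ : Fin k, Unit ⊕ Unit) (Σ _ : Fin k, Empty) := (finTensor fun _ : Fin k => hadCap).mor
  have h : (graphState ε).mor = app F S ≫ₘ
    W ((Equiv.sumCongr (Equiv.refl (Fin n)) (sigmaNone k)).trans (Equiv.sumEmpty (Fin n) Empty)) := rfl
  have hF : K F = ∏ j, hh (Sum.inl ⟨j, Sum.inl ()⟩) (Sum.inl ⟨j, Sum.inr ()⟩) := by
    rw [K_finTensor]
    exact Finset.prod_congr rfl fun j _ => by rw [K_hadCap, ren_hh]; rfl
  have hS : S = ∏ x : Σ _ : Fin k, Unit ⊕ Unit, dl (Sum.inl (endpoint ε (x.1, x.2))) (Sum.inr x) := by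
    have h1 : K S = ∏ v, ∏ l : Leg ε v, dl (Sum.inr (Sum.inl v)) (Sum.inr (Sum.inr ⟨l.1.1, l.1.2⟩)) := by
      rw [K_comp_W, K_W_comp, K_finTensor]
      simp only [map_prod]
      refine Finset.prod_congr rfl fun v _ => ?_
      rw [show (green Empty (Unit ⊕ Leg ε v) 0).mor = gr Empty (Unit ⊕ Leg ε v) 0 from rfl, K_green_star]
      simp only [map_prod, ren_dl]
      rfl
    have h2 := congrArg (ren (Sum.elim Empty.elim id)) h1
    rw [K_state, ren_ren, ren_id' (Sum.elim Empty.elim id ∘ Sum.inr) fun x => rfl] at h2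
    simp only [map_prod, ren_dl, Sum.elim_inr, id] at h2
    rw [h2]
    refine (Fintype.prod_sigma' fun v (l : Leg ε v) => (dl (Sum.inl v) (Sum.inr ⟨l.1.1, l.1.2⟩) :
      St (Fin n ⊕ (Σ _ : Fin k, Unit ⊕ Unit)))).symm.trans (Fintype.prod_equiv
        ((Equiv.sigmaFiberEquiv (endpoint ε)).trans (Equiv.sigmaEquivProd (Fin k) (Unit ⊕ Unit)).symm) _ _ ?_)
    rintro ⟨v, ⟨l, rfl⟩⟩
    rfl
  have h3 := sum_delta_all (fun x : Σ _ : Fin k, Unit ⊕ Unit => Sum.inl (endpoint ε (x.1, x.2)))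
    (∏ j, hh (Sum.inr ⟨j, Sum.inl ()⟩) (Sum.inr ⟨j, Sum.inr ()⟩) :
      St ((Fin n ⊕ (Σ _ : Fin k, Empty)) ⊕ (Σ _ : Fin k, Unit ⊕ Unit)))
  simp only [map_prod, ren_hh, Sum.elim_inr] at h3
  have h4 : app F S = ∏ j, hh (Sum.inl (ε j).1.1) (Sum.inl (ε j).1.2) := by
    rw [app_eq, hS, hF]
    simp only [map_prod, ren_dl, ren_hh, Sum.map_inl, Sum.map_inr, Sum.elim_inl, id]
    rw [mul_comm, h3]
    rfl
  rw [h, h4, ← ren_equiv, map_prod]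
  exact Finset.prod_congr rfl fun j _ => by rw [ren_hh]; rfl

end graphState

/-! ### Reduction to graph states with local Clifford operators -/

section reduction

variable {X Y : Type} [Finite X] [Finite Y] {n : ℕ}

/-- The states represented by a GS-LC diagram. -/
def IsGSLCState (ψ : St (Fin n)) : Prop := ∃ E : Diagram Empty (Fin n), IsGSLC E ∧ E.mor = ψ

theorem IsGSLCState.comp {ψ : St (Fin n)} (h : IsGSLCState ψ) {V : Fin n → Diagram Unit Unit}
    (hV : ∀ i, IsClifford (V i)) : IsGSLCState (ψ ≫ₘ (onEach V).mor) := by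
  obtain ⟨_, ⟨G, k, ε, U, s, hU, hs, rfl⟩, rfl⟩ := h
  refine ⟨_, ⟨G, k, ε, fun i => U i ⨾ V i, s, fun i => (hU i).comp (hV i), hs, rfl⟩, ?_⟩
  rw [scale_mor, scale_mor, con_mul_comp, mor_comp, mor_comp, comp_assoc, onEach_comp]

theorem isGSLCState_of_comp_had {ψ : St (Fin n)} (i : Fin n)
    (h : IsGSLCState (ψ ≫ₘ (onEach (Function.update (fun _ => idw Unit) i had)).mor)) :
    IsGSLCState ψ := by
  rw [← had_had ψ i]
  refine h.comp fun j => ?_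
  by_cases hj : j = i
  · subst hj
    rw [Function.update_self]
    exact .had
  · rw [Function.update_of_ne hj]
    exact .id

theorem prod_ze_update (α : Fin n → Real.Angle) (i : Fin n) (β : Real.Angle) :
    ∏ j, ze (Function.update α i (β + α i) j) j = (ze β i * ∏ j, ze (α j) j : St (Fin n)) := by
  have h : ∏ j ∈ Finset.univ.erase i, ze (Function.update α i (β + α i) j) j =
      (∏ j ∈ Finset.univ.erase i, ze (α j) j : St (Fin n)) :=
    Finset.prod_congr rfl fun j hj => by rw [Function.update_of_ne (Finset.ne_of_mem_erase hj)]
  rw [← Finset.mul_prod_erase Finset.univ (fun j => ze (Function.update α i (β + α i) j) j)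
    (Finset.mem_univ i), h, Function.update_self, ← ze_mul, mul_assoc,
    Finset.mul_prod_erase Finset.univ (fun j => ze (α j) j) (Finset.mem_univ i)]

/-- The normal form of a graph function, with every edge occurring once. -/
theorem exists_eq_of_mem_fin {ψ : St (Fin n)} (h : ψ ∈ graphFunctions (Fin n)) :
    ∃ c ∈ stabScalars, ∃ α : Fin n → Real.Angle, (∀ i, IsQuarter (α i)) ∧
      ∃ s : Finset (Fin n × Fin n), (∀ p ∈ s, p.1 < p.2) ∧
        ψ = con c * ((∏ p ∈ s, hh p.1 p.2) * ∏ i, ze (α i) i) := by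
  classical
  induction h using Submonoid.closure_induction_left with
  | one =>
    exact ⟨1, one_mem _, fun _ => 0, fun _ => isQuarter_zero, ∅, by simp, by simp [ze_zero]⟩
  | mul_left x hx y hy ih =>
    obtain ⟨c, hc, α, hα, s, hs, rfl⟩ := ih
    have hedge : ∀ i j : Fin n, i < j → ∃ d ∈ stabScalars, ∃ β : Fin n → Real.Angle,
        (∀ i, IsQuarter (β i)) ∧ ∃ t : Finset (Fin n × Fin n), (∀ p ∈ t, p.1 < p.2) ∧
        hh i j * (con c * ((∏ p ∈ s, hh p.1 p.2) * ∏ i, ze (α i) i)) =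
          con d * ((∏ p ∈ t, hh p.1 p.2) * ∏ i, ze (β i) i) := by
      intro i j hij
      by_cases h : (i, j) ∈ s
      · refine ⟨ti * ti * c, mul_mem (mul_mem ti_mem ti_mem) hc, α, hα, s.erase (i, j),
          fun p hp => hs p (Finset.mem_of_mem_erase hp), ?_⟩
        rw [← Finset.mul_prod_erase s _ h, map_mul _ _ c, ← hh_mul_hh i j]
        ac_rfl
      · refine ⟨c, hc, α, hα, insert (i, j) s, ?_, ?_⟩
        · intro p hp
          rcases Finset.mem_insert.1 hp with rfl | hp
          exacts [hij, hs p hp]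
        · rw [Finset.prod_insert h]
          ac_rfl
    rcases hx with (⟨d, hd, rfl⟩ | ⟨β, i, hβ, rfl⟩) | ⟨i, j, hij, rfl⟩
    · exact ⟨d * c, mul_mem hd hc, α, hα, s, hs, by rw [map_mul, mul_assoc]⟩
    · refine ⟨c, hc, Function.update α i (β + α i), ?_, s, hs, ?_⟩
      · intro j
        by_cases hj : j = i
        · subst hj
          rw [Function.update_self]
          exact hβ.add (hα j)
        · rw [Function.update_of_ne hj]
          exact hα j
      · rw [prod_ze_update]
        ac_rfl
    · rcases lt_or_gt_of_ne hij with h | h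
      · exact hedge i j h
      · rw [hh_comm]
        exact hedge j i h

theorem isGSLCState_of_mem {ψ : St (Fin n)} (h : ψ ∈ graphFunctions (Fin n)) : IsGSLCState ψ := by
  obtain ⟨_, ⟨s, hs, rfl⟩, α, hα, t, ht, rfl⟩ := exists_eq_of_mem_fin h
  let G : SimpleGraph (Fin n) :=
    { Adj := fun i j => (i, j) ∈ t ∨ (j, i) ∈ t
      symm := ⟨fun i j h => Or.symm h⟩
      loopless := ⟨fun i h => lt_irrefl i (by rcases h with h | h <;> exact ht _ h)⟩ }
  let e : t ≃ Edge G := Equiv.subtypeEquivRight fun p =>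
    ⟨fun h => ⟨ht p h, Or.inl h⟩, fun h => h.2.resolve_right fun h' => lt_asymm h.1 (ht _ h')⟩
  refine ⟨_, ⟨G, _, t.equivFin.symm.trans e, fun i => gphase (α i), s, fun i => .green (hα i), hs, rfl⟩, ?_⟩
  rw [scale_mor, mor_comp, comp_onEach_gphase, graphState_mor]
  congr 2
  rw [← Finset.prod_coe_sort t fun p => (hh p.1 p.2 : St (Fin n))]
  exact Fintype.prod_equiv t.equivFin.symm _ _ fun _ => rfl

/-- Summing over one of the variables first. -/
theorem sum_split {V V' : Type} [Finite V] [Finite V'] (e : V ≃ V' ⊕ Unit) (ψ : St (X ⊕ V)) :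
    sum V ψ = sum V' (sum Unit (ren ((Equiv.sumAssoc _ _ _).symm ∘ Sum.map id e) ψ)) := by
  rw [sum_sum, ren_ren, ← sum_equiv e]
  congr 1
  apply ren_congr
  rintro (x | x)
  · rfl
  · exact (Equiv.apply_symm_apply (Equiv.sumAssoc X V' Unit) _).symm

theorem split_injective {V V' : Type} (e : V ≃ V' ⊕ Unit) :
    ((Equiv.sumAssoc X V' Unit).symm ∘ Sum.map id e).Injective :=
  (Equiv.injective _).comp (Sum.map_injective.2 ⟨Function.injective_id, e.injective⟩)

/-- A relabelled form of `sum_sum_mem`, where `f` sends a neighbour of the innermost summed variable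
to the other one. -/
theorem sum_sum_mem_of_injective {β : Real.Angle} (hβ : IsEven β) {f : Y → X ⊕ Unit} (hf : f.Injective)
    {s : Finset Y} {y : Y} (hy : y ∈ s) (hfy : f y = Sum.inr ()) {Φ : St (X ⊕ Unit)}
    (hΦ : Φ ∈ graphFunctions (X ⊕ Unit)) :
    sum Unit (sum Unit (ze β (Sum.inr ()) * (∏ x ∈ s, hh (Sum.inl (f x)) (Sum.inr ())) *
      ren Sum.inl Φ)) ∈ graphFunctions X := by
  have h := sum_sum_mem hβ (s.map ⟨f, hf⟩) (Finset.mem_map.2 ⟨y, hy, hfy⟩) hΦ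
  rwa [Finset.prod_map] at h

/-- Removing one of the elements of a finite type. -/
noncomputable def removeOne {V : Type} (v : V) : V ≃ {w // w ≠ v} ⊕ Unit := by
  classical exact (Equiv.optionSubtypeNe v).symm.trans (Equiv.optionEquivSumPUnit _)

theorem removeOne_self {V : Type} (v : V) : removeOne v v = Sum.inr () := by
  simp [removeOne]

/-- Sums of graph functions are represented by GS-LC diagrams, by induction on the number of summed
variables. -/
theorem isGSLCState_sum (V : Type) [Finite V] {M : St (Fin n ⊕ V)}
    (hM : M ∈ graphFunctions (Fin n ⊕ V)) : IsGSLCState (sum V M) := by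
  classical
  induction h : Nat.card V using Nat.strong_induction_on generalizing V with
  | _ k ih =>
  rcases isEmpty_or_nonempty V with hV | ⟨⟨v⟩⟩
  · rw [sum_isEmpty]
    refine isGSLCState_of_mem (ren_mem ?_ hM)
    rintro (x | x) (y | y) h
    exacts [congrArg _ h, isEmptyElim y, isEmptyElim x, isEmptyElim x]
  -- the variable `v` is split off
  have hcard := Nat.card_congr (removeOne v)
  rw [Nat.card_sum, h, Nat.card_unique (α := Unit)] at hcard
  have hM' := ren_mem (split_injective (X := Fin n) (removeOne v)) hM
  rw [sum_split (removeOne v)]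
  generalize ren ((Equiv.sumAssoc _ _ _).symm ∘ Sum.map id (removeOne v)) M = M' at hM'
  rcases sum_mem_or hM' with h1 | ⟨β, hβ, s, ⟨x, hx⟩, Φ, hΦ, rfl⟩
  · exact ih _ (by omega) _ h1 rfl
  rcases x with i | u
  · -- the neighbour is an output: after inserting a Hadamard node there it is a summed variable
    apply isGSLCState_of_comp_had i
    let g : Fin n → Fin n ⊕ Unit := fun j => if j = i then Sum.inr () else Sum.inl j
    let f : Fin n ⊕ {w // w ≠ v} → (Fin n ⊕ {w // w ≠ v}) ⊕ Unit :=
      rightComm (Fin n) Unit {w // w ≠ v} ∘ Sum.map g id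
    have hg : g.Injective := by
      intro j j' h
      by_cases hj : j = i <;> by_cases hj' : j' = i <;> simp_all [g]
    have hf : f.Injective :=
      (Equiv.injective _).comp (Sum.map_injective.2 ⟨hg, Function.injective_id⟩)
    have hfi : f (Sum.inl i) = Sum.inr () := by simp [f, g]
    have h2 := sum_sum_mem_of_injective hβ hf hx hfi
      (mul_mem (hh_mem (Sum.inl_ne_inr : Sum.inl (Sum.inl i) ≠ Sum.inr ())) (ren_mem hf hΦ))
    have h3 := ih _ (by omega) _ h2 rfl
    rw [comp_onEach_had, ren_sum, mul_sum, sum_comm, map_mul, ren_ren, ren_sum, ren_hh, ren_sum, mul_sum]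
    simp only [map_mul, map_prod, ren_ze, ren_hh, ren_ren, Sum.map_inl, Sum.map_inr, id] at h3 ⊢
    convert h3 using 4
    rw [mul_left_comm]
    rfl
  · -- the neighbour is another summed variable
    have hcard' := Nat.card_congr (removeOne u)
    rw [Nat.card_sum, Nat.card_unique (α := Unit)] at hcard'
    have hf := split_injective (X := Fin n) (removeOne u)
    have h2 := sum_sum_mem_of_injective hβ hf hx (by simp [removeOne_self]) (ren_mem hf hΦ)
    have h3 := ih _ (by omega) _ h2 rfl
    rw [sum_split (removeOne u), ren_sum]
    simp only [map_mul, map_prod, ren_ze, ren_hh, ren_ren, Sum.map_inl, Sum.map_inr, id] at h3 ⊢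
    exact h3

end reduction
end ZX

theorem mainTheorem3 (n : ℕ) (hn : 0 < n) (D : ZX.Diagram Empty (Fin n))
    (hD : D.IsStabilizer) :
    ∃ E : ZX.Diagram Empty (Fin n), ZX.IsGSLC E ∧ ZX.Equal D E := by
  obtain ⟨V, _, M, hM, h⟩ := ZX.isGraphSum_mor D hD
  obtain ⟨E, hE, h'⟩ := ZX.isGSLCState_sum V hM
  exact ⟨E, hE, ZX.mor_eq_iff.1 (h.trans h'.symm)⟩
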